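/- Write $[M]=\{1,\dots,M\}$, $e(\theta)=e^{2\pi i\theta}$, $\mathbb{T}=\mathbb{R}/\mathbb{Z}$, $\|\theta\|_{\mathbb{T}}$ for the distance from $\theta$ to the nearest integer, and $\mathbb{E}_{s\in S}=\frac1{|S|}\sum_{s\in S}$ for a finite non-empty set $S$; intervals such as $[-N,2N]$ denote sets of integers. For a positive integer $N$ let $\mu_N(d)=\frac1N\bigl(1-\frac{|d|}{N}\bigr)_+$ for $d\in\mathbb{Z}$, where $t_+=\max\{t,0\}$, and for $f_0,f_1,f_2:\mathbb{Z}^2\to\mathbb{C}$ put $$\Lambda_N(f_0,f_1,f_2)=\mathbb{E}_{x\in[N]}\,\mathbb{E}_{y\in[N^2]}\sum_{d\in\mathbb{Z}}\mu_N(d)\,f_0(x,y)\,f_1(x+d,y)\,f_2(x,y+d^2).$$ There exist absolute constants $C>0$ and $k\in\{0,1,2,\dots\}$ such that the following holds. Let $N$ be a positive integer, let $\delta>0$, and let $f_0,f_1,f_2:\mathbb{Z}^2\to\mathbb{C}$ satisfy $|f_i|\le 1$ everywhere. If $|\Lambda_N(f_0,f_1,f_2)|\ge\delta$, then either $N\le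 C\delta^{-k}$, or there exist $\beta\in\mathbb{T}$ and a positive integer $q\le C\delta^{-k}$ such that $\|q\beta\|_{\mathbb{T}}\le C\delta^{-k}/N$ and $$\mathbb{E}_{y\in[N^2]}\Bigl|\mathbb{E}_{x\in[-N,2N]}f_1(x,y)\,e(\beta x)\Bigr|\ \ge\ C^{-1}\delta^{k}.$$ -/

import Mathlib

open scoped BigOperators

noncomputable section

namespace CountingOperator

/-- The character `e(θ) = exp(2πiθ)` on the circle `𝕋 = ℝ/ℤ`. The norm on `UnitAddCircle` is the
distance to the nearest integer. -/
def e (θ : UnitAddCircle) : ℂ := (AddCircle.toCircle θ : ℂ)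

theorem e_coe (t : ℝ) :
    e (t : UnitAddCircle) = Complex.exp (2 * (Real.pi : ℂ) * Complex.I * (t : ℂ)) := by
  simp only [e, AddCircle.toCircle_apply_mk, Circle.coe_exp]
  congr 1
  push_cast
  ring

/-- The normalised Fejér kernel `μ_N(d) = (1/N) (1 - |d|/N)₊` on `ℤ`. -/
def fejer (N : ℕ) (d : ℤ) : ℝ := (1 / (N : ℝ)) * max (1 - |(d : ℝ)| / (N : ℝ)) 0

theorem fejer_eq_zero {N : ℕ} (hN : 0 < N) {d : ℤ}
    (hd : d ∉ Finset.Icc (-(N : ℤ)) (N : ℤ)) : fejer N d = 0 := by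
  have hN' : (0 : ℝ) < N := by exact_mod_cast hN
  have h : (N : ℤ) ≤ |d| := by
    by_contra hlt
    have h2 := abs_lt.mp (not_le.mp hlt)
    exact hd (Finset.mem_Icc.mpr ⟨h2.1.le, h2.2.le⟩)
  have h' : (N : ℝ) ≤ |(d : ℝ)| := by exact_mod_cast h
  have h3 : (1 : ℝ) ≤ |(d : ℝ)| / (N : ℝ) := (one_le_div hN').mpr h'
  rw [fejer, max_eq_right (by linarith), mul_zero]

/-- The counting operator
`Λ_N(f₀,f₁,f₂) = 𝔼_{x ∈ [N]} 𝔼_{y ∈ [N²]} ∑_d μ_N(d) f₀(x,y) f₁(x+d,y) f₂(x,y+d²)`.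
The sum is over all `d ∈ ℤ`; only finitely many terms are non-zero. -/
def Lam (N : ℕ) (f₀ f₁ f₂ : ℤ × ℤ → ℂ) : ℂ :=
  𝔼 x ∈ Finset.Icc (1 : ℤ) (N : ℤ), 𝔼 y ∈ Finset.Icc (1 : ℤ) ((N : ℤ) ^ 2),
    ∑' d : ℤ, (fejer N d : ℂ) * f₀ (x, y) * f₁ (x + d, y) * f₂ (x, y + d ^ 2)

theorem Lam_eq_sum {N : ℕ} (hN : 0 < N) (f₀ f₁ f₂ : ℤ × ℤ → ℂ) :
    Lam N f₀ f₁ f₂ =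
      𝔼 x ∈ Finset.Icc (1 : ℤ) (N : ℤ), 𝔼 y ∈ Finset.Icc (1 : ℤ) ((N : ℤ) ^ 2),
        ∑ d ∈ Finset.Icc (-(N : ℤ)) (N : ℤ),
          (fejer N d : ℂ) * f₀ (x, y) * f₁ (x + d, y) * f₂ (x, y + d ^ 2) := by
  refine Finset.expect_congr rfl fun x _ => Finset.expect_congr rfl fun y _ => ?_
  refine tsum_eq_sum fun d hd => ?_
  simp [fejer_eq_zero hN hd]

/-- The function is bounded in modulus by `1`. -/
def OneBounded (f : ℤ × ℤ → ℂ) : Prop := ∀ p, ‖f p‖ ≤ 1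

end CountingOperator

end

/-! The count is shown to be controlled by a `U³`-type norm in `y`, this is lowered to Fourier
coefficients, and Weyl's inequality identifies the frequencies. Every loss is polynomial in `δ`.

Transfer. The Fejér weight is an overlap of translates of `[N]`, so the count is an average of
weight-free counts in which `x` and `u = x + d` run over intervals of length `N`, while `y` may be
taken in `ℤ/M` with `2N² ≤ M ≤ 6N²` (`exists_shift_cnt`). One Cauchy-Schwarz replaces `f₂` by the
conjugate of the dual function `F_x(y) = 𝔼_u f₀(x, y - d²) f₁(u, y - d²)`, with `d` the displacement
from `x` to `u` (`normSq_cnt_le`); all later information about `F` is therefore information about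
`f₁`.

Differencing. Two van der Corput steps, with shifts that are multiples of a chosen integer, make the
squares linear. A third averaging gives a box norm of `F_x` along three arithmetic progressions
(`exists_boxNorm_ge`).

Degree lowering. The modulus is `M = p r` with `p`, `r` prime, `p` slightly smaller than `N`, and
the differencing shifts are multiples of `p`. Each progression is then dense in the subgroup `p
ℤ/M`, so averaging along it can be replaced, after one modulation, by projection to functions on
`ℤ/p` (`exists_frequency`). Since `p ≤ N`, the variables `x` and `u` see all of `ℤ/p`, and complete
Gauss sums show that the pair `y + u²`, `y + (u + β)²` behaves independently there
(`expect_normSq_quadratic_le`). A count whose last function is `p`-periodic is thus governed by the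
means of that function (`norm_cnt_periodic_le`), and this turns one progression of the box norm into
the full group (`boxNorm_lowering`). Three rounds reach the `U³` norm.

Fourier analysis. The derivatives of `F_x` have dominant frequencies `φ_x(b)`. Another
Cauchy-Schwarz with Weyl and Vinogradov estimates shows that `φ_x(b) - φ_x(b')` often lies in a
major arc. There are boundedly many major-arc frequencies, so `F_x` itself has a large Fourier
coefficient (`exists_large_dft`), and the same estimates place its frequency in a major arc, which
may be taken the same for all `x` (`exists_major_frequency`).

Conclusion. Now `f₁(·, y)` correlates with a quadratic phase whose leading coefficient is near a
rational of denominator `q`. This phase is almost constant on short progressions of difference `q`,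
and large averages along those are detected only by linear phases `β` with `q β` near an integer.
These are few, so one `β` serves for all `y` on average (`exists_linear_phase_of_quadratic`). -/

open scoped BigOperators ComplexConjugate

noncomputable section

namespace CountingOperator

/-! ### Cauchy-Schwarz and box norm inequalities for finite averages -/

section Averages

variable {ι κ τ : Type*} [Fintype ι] [Fintype κ] [Fintype τ]

theorem norm_expect_le {α : Type*} (s : Finset α) (f : α → ℂ) :
    ‖𝔼 i ∈ s, f i‖ ≤ 𝔼 i ∈ s, ‖f i‖ := by
  rw [Finset.expect_eq_sum_div_card, Finset.expect_eq_sum_div_card, norm_div]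
  simp only [Complex.norm_natCast]
  gcongr
  exact norm_sum_le _ _

theorem expect_mono {f g : ι → ℝ} (h : ∀ i, f i ≤ g i) : 𝔼 i, f i ≤ 𝔼 i, g i :=
  Finset.expect_le_expect fun i _ => h i

theorem expect_nonneg' {f : ι → ℝ} (h : ∀ i, 0 ≤ f i) : 0 ≤ 𝔼 i, f i :=
  Finset.expect_nonneg fun i _ => h i

theorem expect_le_of_forall [Nonempty ι] {f : ι → ℝ} {a : ℝ} (h : ∀ i, f i ≤ a) :
    𝔼 i, f i ≤ a :=
  Finset.expect_le Finset.univ_nonempty fun i _ => h i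

theorem norm_expect_le_one [Nonempty ι] {f : ι → ℂ} (h : ∀ i, ‖f i‖ ≤ 1) : ‖𝔼 i, f i‖ ≤ 1 :=
  (norm_expect_le _ _).trans (expect_le_of_forall h)

theorem exists_le_of_le_expect' [Nonempty ι] {f : ι → ℝ} {a : ℝ} (h : a ≤ 𝔼 i, f i) :
    ∃ i, a ≤ f i := by
  obtain ⟨i, -, hi⟩ := Finset.exists_le_of_le_expect Finset.univ_nonempty h
  exact ⟨i, hi⟩

theorem ofReal_expect {α : Type*} (s : Finset α) (f : α → ℝ) :
    ((𝔼 i ∈ s, f i : ℝ) : ℂ) = 𝔼 i ∈ s, (f i : ℂ) := by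
  simp [Finset.expect_eq_sum_div_card]

theorem conj_expect {α : Type*} (s : Finset α) (f : α → ℂ) :
    conj (𝔼 i ∈ s, f i) = 𝔼 i ∈ s, conj (f i) := by
  simp [Finset.expect_eq_sum_div_card, map_sum]

theorem pow_expect_le [Nonempty ι] {f : ι → ℝ} (hf : ∀ i, 0 ≤ f i) (n : ℕ) :
    (𝔼 i, f i) ^ n ≤ 𝔼 i, f i ^ n := by
  have hc : (0 : ℝ) < Fintype.card ι := by exact_mod_cast Fintype.card_pos
  have := Real.pow_arith_mean_le_arith_mean_pow (Finset.univ : Finset ι)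
    (fun _ => (Fintype.card ι : ℝ)⁻¹) f (fun _ _ => by positivity)
    (by simp [hc.ne']) (fun i _ => hf i) n
  simpa [Fintype.expect_eq_sum_div_card, ← Finset.mul_sum, div_eq_inv_mul] using this

theorem pow_le_expect_pow [Nonempty ι] {f : ι → ℝ} (hf : ∀ i, 0 ≤ f i) {η : ℝ} (hη : 0 ≤ η)
    (h : η ≤ 𝔼 i, f i) (n : ℕ) : η ^ n ≤ 𝔼 i, f i ^ n :=
  (pow_le_pow_left₀ hη h n).trans (pow_expect_le hf n)

theorem normSq_expect_le [Nonempty ι] (f : ι → ℂ) : ‖𝔼 i, f i‖ ^ 2 ≤ 𝔼 i, ‖f i‖ ^ 2 :=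
  (pow_le_pow_left₀ (norm_nonneg _) (norm_expect_le _ _) 2).trans
    (pow_expect_le (fun _ => norm_nonneg _) 2)

theorem normSq_expect_mul_le [Nonempty ι] {a : ι → ℂ} (ha : ∀ i, ‖a i‖ ≤ 1) (f : ι → ℂ) :
    ‖𝔼 i, a i * f i‖ ^ 2 ≤ 𝔼 i, ‖f i‖ ^ 2 := by
  refine (normSq_expect_le _).trans (expect_mono fun i => ?_)
  rw [norm_mul]
  exact pow_le_pow_left₀ (by positivity)
    (mul_le_of_le_one_left (norm_nonneg _) (ha i)) 2

theorem norm_expect_mul_le {a : ι → ℂ} (ha : ∀ i, ‖a i‖ ≤ 1) (f : ι → ℂ) :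
    ‖𝔼 i, a i * f i‖ ≤ 𝔼 i, ‖f i‖ := by
  refine (norm_expect_le _ _).trans (expect_mono fun i => ?_)
  rw [norm_mul]
  exact mul_le_of_le_one_left (norm_nonneg _) (ha i)

theorem normSq_eq (z : ℂ) : ((‖z‖ ^ 2 : ℝ) : ℂ) = z * conj z := by
  rw [Complex.mul_conj, Complex.normSq_eq_norm_sq]

theorem normSq_expect_eq (f : ι → ℂ) :
    ((‖𝔼 i, f i‖ ^ 2 : ℝ) : ℂ) = 𝔼 i, 𝔼 i', f i * conj (f i') := by
  rw [normSq_eq, conj_expect, Finset.expect_mul_expect]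

theorem expect_normSq_expect_eq (f : ι → κ → ℂ) :
    ((𝔼 j, ‖𝔼 i, f i j‖ ^ 2 : ℝ) : ℂ) = 𝔼 i, 𝔼 i', 𝔼 j, f i j * conj (f i' j) := by
  simp_rw [ofReal_expect, normSq_expect_eq]
  rw [Finset.expect_comm]
  refine Finset.expect_congr rfl fun i _ => ?_
  rw [Finset.expect_comm]

/-- Cauchy-Schwarz, eliminating a bounded weight in the second variable. -/
theorem normSq_expect_expect_le [Nonempty κ] {Q : κ → ℂ} (hQ : ∀ j, ‖Q j‖ ≤ 1)
    (f : ι → κ → ℂ) :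
    ‖𝔼 i, 𝔼 j, f i j * Q j‖ ^ 2 ≤ ‖𝔼 i, 𝔼 i', 𝔼 j, f i j * conj (f i' j)‖ := by
  rw [← expect_normSq_expect_eq, Complex.norm_real, Real.norm_of_nonneg
    (expect_nonneg' fun _ => by positivity), Finset.expect_comm]
  simp_rw [← Finset.expect_mul, mul_comm _ (Q _)]
  exact normSq_expect_mul_le hQ _

theorem norm_mul_conj_le_one {a b : ℂ} (ha : ‖a‖ ≤ 1) (hb : ‖b‖ ≤ 1) : ‖a * conj b‖ ≤ 1 := by
  rw [norm_mul, RCLike.norm_conj]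
  exact mul_le_one₀ ha (norm_nonneg _) hb

theorem norm_mul_le_one' {a b : ℂ} (ha : ‖a‖ ≤ 1) (hb : ‖b‖ ≤ 1) : ‖a * b‖ ≤ 1 := by
  rw [norm_mul]
  exact mul_le_one₀ ha (norm_nonneg _) hb

theorem norm_conj_le_one {a : ℂ} (ha : ‖a‖ ≤ 1) : ‖conj a‖ ≤ 1 := by
  rwa [RCLike.norm_conj]

/-- The box norm inequality in two variables. -/
theorem box_two [Nonempty ι] [Nonempty κ] {P : ι → ℂ} {Q : κ → ℂ} (hP : ∀ i, ‖P i‖ ≤ 1)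
    (hQ : ∀ j, ‖Q j‖ ≤ 1) (f : ι → κ → ℂ) :
    ‖𝔼 i, 𝔼 j, f i j * P i * Q j‖ ^ 4 ≤ 𝔼 i, 𝔼 i', ‖𝔼 j, f i j * conj (f i' j)‖ ^ 2 := by
  have h1 := normSq_expect_expect_le hQ (fun i j => f i j * P i)
  have h2 : ‖𝔼 i, 𝔼 i', 𝔼 j, f i j * P i * conj (f i' j * P i')‖
      ≤ 𝔼 i, 𝔼 i', ‖𝔼 j, f i j * conj (f i' j)‖ := by
    refine (norm_expect_le _ _).trans (expect_mono fun i => ?_)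
    have : ∀ i', 𝔼 j, f i j * P i * conj (f i' j * P i')
        = (P i * conj (P i')) * 𝔼 j, f i j * conj (f i' j) := fun i' => by
      rw [Finset.mul_expect]
      refine Finset.expect_congr rfl fun j _ => ?_
      rw [map_mul]; ring
    simp_rw [this]
    exact norm_expect_mul_le (fun i' => norm_mul_conj_le_one (hP i) (hP i')) _
  calc _ = (‖𝔼 i, 𝔼 j, f i j * P i * Q j‖ ^ 2) ^ 2 := by ring
    _ ≤ (𝔼 i, 𝔼 i', ‖𝔼 j, f i j * conj (f i' j)‖) ^ 2 := by
      exact pow_le_pow_left₀ (by positivity) (h1.trans h2) 2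
    _ ≤ _ := by
      refine (pow_expect_le (fun i => expect_nonneg' fun _ => norm_nonneg _) 2).trans
        (expect_mono fun i => pow_expect_le (fun _ => norm_nonneg _) 2)

/-- The box norm inequality in three variables. -/
theorem box_three [Nonempty ι] [Nonempty κ] [Nonempty τ] {φ₁ : κ → τ → ℂ} {φ₂ : ι → τ → ℂ}
    {φ₃ : ι → κ → ℂ} (h₁ : ∀ j k, ‖φ₁ j k‖ ≤ 1) (h₂ : ∀ i k, ‖φ₂ i k‖ ≤ 1)
    (h₃ : ∀ i j, ‖φ₃ i j‖ ≤ 1) (f : ι → κ → τ → ℂ) :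
    ‖𝔼 i, 𝔼 j, 𝔼 k, f i j k * φ₁ j k * φ₂ i k * φ₃ i j‖ ^ 8 ≤
      𝔼 i, 𝔼 i', 𝔼 j, 𝔼 j',
        ‖𝔼 k, f i j k * conj (f i' j k) * conj (f i j' k * conj (f i' j' k))‖ ^ 2 := by
  have h1 : ‖𝔼 i, 𝔼 j, 𝔼 k, f i j k * φ₁ j k * φ₂ i k * φ₃ i j‖ ^ 2
      ≤ 𝔼 i, 𝔼 i', ‖𝔼 j, 𝔼 k, (f i j k * conj (f i' j k)) * (φ₃ i j * conj (φ₃ i' j)) *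
        (φ₂ i k * conj (φ₂ i' k))‖ := by
    -- The pair `(j, k)` is treated as one variable, which removes `φ₁` and doubles `i`. For fixed
    -- `(i, i')` the remaining weights depend on `j` alone and on `k` alone, which is the
    -- two-variable case.
    have := normSq_expect_expect_le (Q := fun q : κ × τ => φ₁ q.1 q.2) (fun q => h₁ _ _)
      (fun i (q : κ × τ) => f i q.1 q.2 * φ₂ i q.2 * φ₃ i q.1)
    have e1 : 𝔼 i, 𝔼 j, 𝔼 k, f i j k * φ₁ j k * φ₂ i k * φ₃ i j
      = 𝔼 i, 𝔼 q : κ × τ, f i q.1 q.2 * φ₂ i q.2 * φ₃ i q.1 * φ₁ q.1 q.2 := by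
      refine Finset.expect_congr rfl fun i _ => ?_
      rw [← Finset.univ_product_univ, Finset.expect_product]
      refine Finset.expect_congr rfl fun j _ => Finset.expect_congr rfl fun k _ => ?_
      ring
    rw [e1]
    refine this.trans ((norm_expect_le _ _).trans (expect_mono fun i =>
      (norm_expect_le _ _).trans (expect_mono fun i' => le_of_eq ?_)))
    congr 1
    rw [← Finset.univ_product_univ, Finset.expect_product]
    refine Finset.expect_congr rfl fun j _ => Finset.expect_congr rfl fun k _ => ?_
    simp only [map_mul]; ring
  have h2 : ∀ i i', ‖𝔼 j, 𝔼 k, (f i j k * conj (f i' j k)) * (φ₃ i j * conj (φ₃ i' j)) *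
        (φ₂ i k * conj (φ₂ i' k))‖ ^ 4 ≤ 𝔼 j, 𝔼 j',
        ‖𝔼 k, f i j k * conj (f i' j k) * conj (f i j' k * conj (f i' j' k))‖ ^ 2 :=
    fun i i' => box_two (fun j => norm_mul_conj_le_one (h₃ _ _) (h₃ _ _))
      (fun k => norm_mul_conj_le_one (h₂ _ _) (h₂ _ _)) _
  calc _ = (‖𝔼 i, 𝔼 j, 𝔼 k, f i j k * φ₁ j k * φ₂ i k * φ₃ i j‖ ^ 2) ^ 4 := by ring
    _ ≤ _ := pow_le_pow_left₀ (by positivity) h1 4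
    _ ≤ _ := (pow_expect_le (fun i => expect_nonneg' fun _ => norm_nonneg _) 4).trans
        (expect_mono fun i => (pow_expect_le (fun _ => norm_nonneg _) 4).trans
          (expect_mono fun i' => h2 i i'))

end Averages

theorem norm_e (θ : UnitAddCircle) : ‖e θ‖ = 1 := Circle.norm_coe _

theorem e_add (θ φ : UnitAddCircle) : e (θ + φ) = e θ * e φ := by
  simp [e, AddCircle.toCircle_add]

theorem e_zero : e 0 = 1 := by simp [e]

theorem e_neg (θ : UnitAddCircle) : e (-θ) = conj (e θ) := by
  rw [e, AddCircle.toCircle_neg, Circle.coe_inv_eq_conj, e]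

/-! ### Fourier analysis on `ℤ/M` and projection to `p`-periodic functions -/

section Fourier

variable {M : ℕ} [NeZero M]

/-- The standard additive character of `ℤ/Mℤ`. -/
def chi (a : ZMod M) : ℂ := e (ZMod.toAddCircle a)

theorem chi_eq_stdAddChar (a : ZMod M) : chi a = ZMod.stdAddChar a := rfl

@[simp] theorem norm_chi (a : ZMod M) : ‖chi a‖ = 1 := norm_e _

@[simp] theorem chi_zero : chi (0 : ZMod M) = 1 := by simp [chi, e_zero]

theorem chi_add (a b : ZMod M) : chi (a + b) = chi a * chi b := by simp [chi, e_add]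

theorem chi_neg (a : ZMod M) : chi (-a) = conj (chi a) := by simp [chi, e_neg]

theorem sum_chi_mul (b : ZMod M) : ∑ x : ZMod M, chi (x * b) = if b = 0 then (M : ℂ) else 0 := by
  have := AddChar.sum_mulShift b (ZMod.isPrimitive_stdAddChar M)
  simp only [chi_eq_stdAddChar, this, ZMod.card]
  split_ifs <;> simp

theorem expect_chi_mul (b : ZMod M) : 𝔼 x : ZMod M, chi (x * b) = if b = 0 then 1 else 0 := by
  have hM : (M : ℂ) ≠ 0 := by exact_mod_cast NeZero.ne M
  rw [Fintype.expect_eq_sum_div_card, sum_chi_mul, ZMod.card]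
  split_ifs <;> simp [hM]

theorem expect_chi_mul' (b : ZMod M) : 𝔼 x : ZMod M, chi (b * x) = if b = 0 then 1 else 0 := by
  simp_rw [mul_comm b, expect_chi_mul]

theorem expect_add_right {E : Type*} [AddCommMonoid E] [Module ℚ≥0 E] (f : ZMod M → E)
    (a : ZMod M) : 𝔼 y, f (y + a) = 𝔼 y, f y :=
  Fintype.expect_equiv (Equiv.addRight a) _ _ fun _ => rfl

theorem expect_sub_right {E : Type*} [AddCommMonoid E] [Module ℚ≥0 E] (f : ZMod M → E)
    (a : ZMod M) : 𝔼 y, f (y - a) = 𝔼 y, f y :=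
  Fintype.expect_equiv (Equiv.subRight a) _ _ fun _ => rfl

/-- The normalised Fourier transform on `ℤ/Mℤ`. -/
def dft (f : ZMod M → ℂ) (ξ : ZMod M) : ℂ := 𝔼 y, f y * chi (ξ * y)

theorem dft_inversion (f : ZMod M → ℂ) (y : ZMod M) :
    f y = ∑ ξ, dft f ξ * chi (-(ξ * y)) := by
  simp only [dft, Finset.expect_mul]
  rw [← Finset.expect_sum_comm]
  have : ∀ z, ∑ ξ : ZMod M, f z * chi (ξ * z) * chi (-(ξ * y))
      = (Fintype.card (ZMod M) : ℂ) * (if z = y then f z else 0) := fun z => by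
    have h1 : ∀ ξ : ZMod M, f z * chi (ξ * z) * chi (-(ξ * y)) = f z * chi (ξ * (z - y)) :=
      fun ξ => by rw [mul_assoc, ← chi_add]; congr 2; ring
    simp_rw [h1, ← Finset.mul_sum, sum_chi_mul, sub_eq_zero, ZMod.card]
    split_ifs <;> ring
  simp_rw [this, ← Finset.mul_expect]
  rw [Fintype.card_mul_expect]
  simp

theorem sum_dft_mul_conj (f g : ZMod M → ℂ) :
    ∑ ξ, dft f ξ * conj (dft g ξ) = 𝔼 y, f y * conj (g y) := by
  have h : ∀ y, f y * conj (g y) = ∑ ξ, f y * chi (ξ * y) * conj (dft g ξ) := fun y => by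
    conv_lhs => rw [dft_inversion g y]
    rw [map_sum, Finset.mul_sum]
    refine Finset.sum_congr rfl fun ξ _ => ?_
    rw [map_mul, chi_neg, Complex.conj_conj]; ring
  simp_rw [h]
  rw [Finset.expect_sum_comm]
  simp_rw [← Finset.expect_mul]
  rfl

theorem sum_normSq_dft (f : ZMod M → ℂ) : ∑ ξ, ‖dft f ξ‖ ^ 2 = 𝔼 y, ‖f y‖ ^ 2 := by
  have := sum_dft_mul_conj f f
  simp_rw [← normSq_eq, ← ofReal_expect] at this
  exact_mod_cast this

theorem norm_dft_le_one {f : ZMod M → ℂ} (hf : ∀ y, ‖f y‖ ≤ 1) (ξ : ZMod M) : ‖dft f ξ‖ ≤ 1 :=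
  norm_expect_le_one fun y => by simpa using hf y

theorem sum_normSq_dft_le_one {f : ZMod M → ℂ} (hf : ∀ y, ‖f y‖ ≤ 1) :
    ∑ ξ, ‖dft f ξ‖ ^ 2 ≤ 1 := by
  rw [sum_normSq_dft]
  exact expect_le_of_forall fun y => pow_le_one₀ (norm_nonneg _) (hf y)

theorem dft_shift (f : ZMod M → ℂ) (a ξ : ZMod M) :
    dft (fun y => f (y + a)) ξ = chi (-(ξ * a)) * dft f ξ := by
  simp only [dft]
  rw [← expect_sub_right _ a, Finset.mul_expect]
  refine Finset.expect_congr rfl fun y _ => ?_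
  rw [sub_add_cancel, mul_sub, sub_eq_add_neg, chi_add]; ring

theorem dft_expect {κ : Type*} [Fintype κ] (f : κ → ZMod M → ℂ) (ξ : ZMod M) :
    dft (fun y => 𝔼 k, f k y) ξ = 𝔼 k, dft (f k) ξ := by
  simp only [dft, Finset.expect_mul]
  rw [Finset.expect_comm]

theorem dft_mul_chi (f : ZMod M → ℂ) (ξ ζ : ZMod M) :
    dft (fun y => f y * chi (ξ * y)) ζ = dft f (ξ + ζ) := by
  simp only [dft]
  refine Finset.expect_congr rfl fun y _ => ?_
  rw [mul_assoc, ← chi_add]; congr 2; ring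

theorem dft_autocorrelation (f : ZMod M → ℂ) (ξ : ZMod M) :
    dft (fun h => 𝔼 y, f (y + h) * conj (f y)) ξ = ((‖dft f ξ‖ ^ 2 : ℝ) : ℂ) := by
  have h : ∀ h : ZMod M, 𝔼 y, f (y + h) * conj (f y) = 𝔼 y, conj (f y) * f (y + h) :=
    fun h => Finset.expect_congr rfl fun y _ => mul_comm _ _
  simp_rw [h]
  rw [normSq_eq]
  simp only [dft]
  rw [conj_expect, mul_comm, Finset.expect_mul_expect, ]
  simp_rw [Finset.expect_mul]
  rw [Finset.expect_comm]
  refine Finset.expect_congr rfl fun y _ => ?_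
  rw [← expect_sub_right _ y]
  refine Finset.expect_congr rfl fun z _ => ?_
  rw [add_sub_cancel, mul_sub, sub_eq_add_neg, chi_add, chi_neg, map_mul]; ring

/-- The `U²` identity. -/
theorem expect_normSq_autocorrelation (f : ZMod M → ℂ) :
    𝔼 h, ‖𝔼 y, f (y + h) * conj (f y)‖ ^ 2 = ∑ ξ, ‖dft f ξ‖ ^ 4 := by
  rw [← sum_normSq_dft]
  refine Finset.sum_congr rfl fun ξ _ => ?_
  rw [dft_autocorrelation, Complex.norm_real, Real.norm_of_nonneg (by positivity)]
  ring

/-- A nonempty solution set is a coset of the `q`-torsion, and a cyclic group has at most `q`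
elements killed by `q`. -/
theorem card_mul_eq_le {q : ℕ} (hq : 0 < q) (ζ : ZMod M) :
    (Finset.univ.filter fun ξ : ZMod M => (q : ZMod M) * ξ = ζ).card ≤ q := by
  classical
  by_cases hne : (Finset.univ.filter fun ξ : ZMod M => (q : ZMod M) * ξ = ζ).Nonempty
  · obtain ⟨ξ₀, h₀⟩ := hne
    simp only [Finset.mem_filter, Finset.mem_univ, true_and] at h₀
    refine le_trans ?_ (IsAddCyclic.card_nsmul_eq_zero_le (α := ZMod M) hq)
    refine Finset.card_le_card_of_injOn (fun ξ => ξ - ξ₀) ?_ (fun a _ b _ h => by simpa using h)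
    intro ξ hξ
    simp only [Finset.coe_filter, Finset.mem_univ, true_and, Set.mem_ofPred_eq] at hξ ⊢
    rw [nsmul_eq_mul, mul_sub, hξ, h₀, sub_self]
  · rw [Finset.not_nonempty_iff_eq_empty.mp hne]; simp

/-- The projection onto functions invariant under translation by multiples of `p`. -/
def proj (p : ZMod M) (f : ZMod M → ℂ) (y : ZMod M) : ℂ := 𝔼 t, f (y + p * t)

theorem proj_periodic (p : ZMod M) (f : ZMod M → ℂ) (y s : ZMod M) :
    proj p f (y + p * s) = proj p f y := by
  simp only [proj]
  rw [← expect_add_right (fun t => f (y + p * t)) s]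
  refine Finset.expect_congr rfl fun t _ => ?_
  congr 1; ring

theorem norm_proj_le_one (p : ZMod M) {f : ZMod M → ℂ} (hf : ∀ y, ‖f y‖ ≤ 1) (y : ZMod M) :
    ‖proj p f y‖ ≤ 1 :=
  norm_expect_le_one fun _ => hf _

/-- The projection is self-adjoint and fixes `v`. This is how projected functions are later
exchanged for the functions they came from. -/
theorem expect_proj_mul (p : ZMod M) (f : ZMod M → ℂ) {v : ZMod M → ℂ}
    (hv : ∀ y s, v (y + p * s) = v y) : 𝔼 y, proj p f y * v y = 𝔼 y, f y * v y := by
  simp only [proj, Finset.expect_mul]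
  rw [Finset.expect_comm]
  have : ∀ t, 𝔼 y, f (y + p * t) * v y = 𝔼 y, f y * v y := fun t => by
    rw [← expect_add_right (fun y => f y * v y) (p * t)]
    simp_rw [hv]
  simp_rw [this]
  simp

theorem dft_proj (p : ZMod M) (f : ZMod M → ℂ) (ζ : ZMod M) :
    dft (proj p f) ζ = if p * ζ = 0 then dft f ζ else 0 := by
  have h : dft (proj p f) ζ = 𝔼 t, dft (fun y => f (y + p * t)) ζ := dft_expect _ _
  simp_rw [h, dft_shift, ← Finset.expect_mul]
  have h2 : ∀ t : ZMod M, -(ζ * (p * t)) = t * (-(p * ζ)) := fun t => by ring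
  simp_rw [h2, expect_chi_mul, neg_eq_zero]
  split_ifs <;> simp

/-- Multiples of `r` are killed by `p`, and each of them is hit at most `r` times by `j ↦ r j`. -/
theorem sum_mul_left_le {p r : ℕ} (hr : 0 < r) (hM : p * r = M) {g : ZMod M → ℝ}
    (hg : ∀ ζ, 0 ≤ g ζ) :
    ∑ j, g ((r : ZMod M) * j) ≤ r * ∑ ζ, if (p : ZMod M) * ζ = 0 then g ζ else 0 := by
  have h0 : ∀ j : ZMod M, (p : ZMod M) * ((r : ZMod M) * j) = 0 := fun j => by
    rw [← mul_assoc, ← Nat.cast_mul, hM]; simp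
  have h1 : ∀ j : ZMod M, g ((r : ZMod M) * j) = ∑ ζ, if (r : ZMod M) * j = ζ then
      (if (p : ZMod M) * ζ = 0 then g ζ else 0) else 0 := fun j => by simp [h0]
  simp_rw [h1]
  rw [Finset.sum_comm, Finset.mul_sum]
  refine Finset.sum_le_sum fun ζ _ => ?_
  rw [← Finset.sum_filter, Finset.sum_const, nsmul_eq_mul]
  refine mul_le_mul_of_nonneg_right ?_ (by split_ifs <;> simp [hg])
  exact_mod_cast card_mul_eq_le hr ζ

/-- Averaging over translates by multiples of `p` is controlled by projections of modulations onto
`p`-periodic functions. -/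
theorem expect_normSq_expect_shift_le {κ : Type*} [Fintype κ] {p r : ℕ} (hp : 0 < p) (hr : 0 < r)
    (hM : p * r = M) {γ : κ → ZMod M} (hγ : ∀ k, ∃ t, γ k = (p : ZMod M) * t)
    (G : ZMod M → ℂ) :
    𝔼 y, ‖𝔼 k, G (y + γ k)‖ ^ 2 ≤ (p : ℝ)⁻¹ * ∑ ξ, ‖𝔼 k, chi (-(ξ * γ k))‖ ^ 2 *
      𝔼 y, ‖proj (p : ZMod M) (fun y => G y * chi (ξ * y)) y‖ ^ 2 := by
  set w : ZMod M → ℝ := fun ξ => ‖𝔼 k, chi (-(ξ * γ k))‖ ^ 2 with hw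
  have hM0 : (0 : ℝ) < M := by exact_mod_cast NeZero.pos M
  have h1 : 𝔼 y, ‖𝔼 k, G (y + γ k)‖ ^ 2 = ∑ ξ, w ξ * ‖dft G ξ‖ ^ 2 := by
    rw [← sum_normSq_dft]
    refine Finset.sum_congr rfl fun ξ _ => ?_
    rw [dft_expect]
    simp_rw [dft_shift, ← Finset.expect_mul]
    rw [norm_mul, mul_pow]
  -- The shifts are multiples of `p` and `r p = 0` in `ℤ/M`, so the multiplier is constant on cosets
  -- of the multiples of `r`. Averaging Parseval over such a coset assembles the energy of a
  -- modulation of `G` on frequencies killed by `p`, which is the energy of its projection.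
  have hwper : ∀ ξ j, w (ξ + (r : ZMod M) * j) = w ξ := fun ξ j => by
    simp only [hw]
    congr 2
    refine Finset.expect_congr rfl fun k _ => ?_
    obtain ⟨t, ht⟩ := hγ k
    congr 2
    have : (r : ZMod M) * p = 0 := by rw [← Nat.cast_mul, mul_comm, hM]; simp
    rw [ht]; linear_combination (j * t) * this
  have h2 : ∀ j : ZMod M, ∑ ξ, w ξ * ‖dft G ξ‖ ^ 2
      = ∑ ξ, w ξ * ‖dft G (ξ + (r : ZMod M) * j)‖ ^ 2 := fun j => by
    refine (Fintype.sum_equiv (Equiv.addRight ((r : ZMod M) * j)) _ _ fun ξ => ?_).symm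
    simp [hwper]
  have h3 : ∀ ξ, ∑ j, ‖dft G (ξ + (r : ZMod M) * j)‖ ^ 2 ≤ r *
      𝔼 y, ‖proj (p : ZMod M) (fun y => G y * chi (ξ * y)) y‖ ^ 2 := fun ξ => by
    refine (sum_mul_left_le hr hM (g := fun ζ => ‖dft G (ξ + ζ)‖ ^ 2)
      (fun ζ => by positivity)).trans (le_of_eq ?_)
    rw [← sum_normSq_dft]
    congr 1
    refine Finset.sum_congr rfl fun ζ _ => ?_
    rw [dft_proj, dft_mul_chi]
    split_ifs <;> simp
  have h4 : (M : ℝ) * ∑ ξ, w ξ * ‖dft G ξ‖ ^ 2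
      ≤ r * ∑ ξ, w ξ * 𝔼 y, ‖proj (p : ZMod M) (fun y => G y * chi (ξ * y)) y‖ ^ 2 := by
    have : (M : ℝ) * ∑ ξ, w ξ * ‖dft G ξ‖ ^ 2
        = ∑ j : ZMod M, ∑ ξ, w ξ * ‖dft G (ξ + (r : ZMod M) * j)‖ ^ 2 := by
      simp_rw [← h2]; simp
    rw [this, Finset.sum_comm, Finset.mul_sum]
    refine Finset.sum_le_sum fun ξ _ => ?_
    rw [← Finset.mul_sum, mul_left_comm]
    exact mul_le_mul_of_nonneg_left (h3 ξ) (by positivity)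
  rw [h1]
  have hp' : (0 : ℝ) < p := by exact_mod_cast hp
  have hr' : (0 : ℝ) < r := by exact_mod_cast hr
  have hMr : (M : ℝ) = p * r := by exact_mod_cast hM.symm
  rw [hMr] at h4
  rw [le_inv_mul_iff₀ hp']
  refine le_of_mul_le_mul_left ?_ hr'
  linarith

/-- Parseval for the uniform measure on the values of `γ`; injectivity leaves only the diagonal. It
gives the total weight when a frequency is pigeonholed in `exists_frequency`. -/
theorem sum_normSq_expect_chi {κ : Type*} [Fintype κ] {γ : κ → ZMod M}
    (hγ : Function.Injective γ) :
    ∑ ξ, ‖𝔼 k, chi (-(ξ * γ k))‖ ^ 2 = (M : ℝ) / Fintype.card κ := by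
  classical
  have h : ((∑ ξ, ‖𝔼 k, chi (-(ξ * γ k))‖ ^ 2 : ℝ) : ℂ) = ((M / Fintype.card κ : ℝ) : ℂ) := by
    rw [Complex.ofReal_sum]
    simp_rw [normSq_expect_eq, ← chi_neg, ← chi_add]
    rw [← Finset.expect_sum_comm]
    simp_rw [← Finset.expect_sum_comm]
    have : ∀ k k' (ξ : ZMod M), -(ξ * γ k) + -(-(ξ * γ k')) = ξ * (γ k' - γ k) :=
      fun k k' ξ => by ring
    simp_rw [this, sum_chi_mul, sub_eq_zero, hγ.eq_iff]
    by_cases hc : Fintype.card κ = 0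
    · have := Fintype.card_eq_zero_iff.mp hc
      simp
    · have : (Fintype.card κ : ℂ) ≠ 0 := by exact_mod_cast hc
      simp only [Fintype.expect_eq_sum_div_card]
      simp
      field_simp
  exact_mod_cast h

end Fourier

/-! ### The nonlinear Roth estimate over a prime field -/

section PrimeField

variable {p : ℕ} [Fact p.Prime]

theorem two_ne_zero_zmod (hp : p ≠ 2) : (2 : ZMod p) ≠ 0 := by
  have h : ((2 : ℕ) : ZMod p) ≠ 0 := by
    rw [Ne, ZMod.natCast_eq_zero_iff]
    intro h
    exact hp ((Nat.prime_dvd_prime_iff_eq Fact.out Nat.prime_two).mp h)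
  simpa using h

/-- Square-root cancellation in quadratic Gauss sums. -/
theorem normSq_gauss (hp : p ≠ 2) (u : ZMod p) {v : ZMod p} (hv : v ≠ 0) :
    ‖𝔼 h : ZMod p, chi (u * h + v * h ^ 2)‖ ^ 2 = (p : ℝ)⁻¹ := by
  have h2 := two_ne_zero_zmod hp
  have key : ((‖𝔼 h : ZMod p, chi (u * h + v * h ^ 2)‖ ^ 2 : ℝ) : ℂ) = ((p : ℝ)⁻¹ : ℝ) := by
    rw [normSq_expect_eq, Finset.expect_comm]
    have h1 : ∀ h' : ZMod p, 𝔼 h : ZMod p,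
        chi (u * h + v * h ^ 2) * conj (chi (u * h' + v * h' ^ 2)) =
        𝔼 k : ZMod p, chi (u * k + v * k ^ 2) * chi (h' * (2 * v * k)) := fun h' => by
      rw [← expect_add_right _ h']
      refine Finset.expect_congr rfl fun k _ => ?_
      rw [← chi_neg, ← chi_add, ← chi_add]
      congr 1; ring
    simp_rw [h1]
    rw [Finset.expect_comm]
    simp_rw [← Finset.mul_expect, expect_chi_mul]
    have h3 : ∀ k : ZMod p, 2 * v * k = 0 ↔ k = 0 := fun k => by simp [h2, hv]
    simp_rw [h3]
    rw [Fintype.expect_eq_sum_div_card]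
    simp
  exact_mod_cast key

theorem norm_gauss_le (hp : p ≠ 2) (u : ZMod p) {v : ZMod p} (hv : v ≠ 0) :
    ‖𝔼 h : ZMod p, chi (u * h + v * h ^ 2)‖ ≤ (√p)⁻¹ := by
  rw [← Real.sqrt_inv]
  exact Real.le_sqrt_of_sq_le (normSq_gauss hp u hv).le

theorem normSq_sum_eq {ι : Type*} [Fintype ι] (f : ι → ℂ) :
    ((‖∑ i, f i‖ ^ 2 : ℝ) : ℂ) = ∑ i, ∑ i', f i * conj (f i') := by
  rw [normSq_eq, map_sum, Finset.sum_mul_sum]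

theorem expect_normSq_sum_le {ι κ : Type*} [Fintype ι] [Fintype κ] (f : ι → κ → ℂ) :
    𝔼 h, ‖∑ i, f i h‖ ^ 2 ≤ ∑ i, ∑ i', ‖𝔼 h, f i h * conj (f i' h)‖ := by
  have h : ((𝔼 h, ‖∑ i, f i h‖ ^ 2 : ℝ) : ℂ) = ∑ i, ∑ i', 𝔼 h, f i h * conj (f i' h) := by
    simp_rw [ofReal_expect, normSq_sum_eq, Finset.expect_sum_comm]
  have h0 : 0 ≤ 𝔼 h, ‖∑ i, f i h‖ ^ 2 := expect_nonneg' fun _ => by positivity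
  rw [← Real.norm_of_nonneg h0, ← Complex.norm_real, h]
  exact (norm_sum_le _ _).trans (Finset.sum_le_sum fun i _ => norm_sum_le _ _)

theorem sum_autocorrelation_le {c : ZMod p → ℝ} (hc : ∑ σ, c σ ^ 2 ≤ 1)
    (τ : ZMod p) : ∑ σ, c (σ + τ) * c σ ≤ 1 := by
  have h1 : ∑ σ, c (σ + τ) ^ 2 = ∑ σ, c σ ^ 2 :=
    Fintype.sum_equiv (Equiv.addRight τ) _ _ fun _ => rfl
  have h2 : ∑ σ, c (σ + τ) * c σ ≤ ∑ σ, (c (σ + τ) ^ 2 + c σ ^ 2) / 2 :=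
    Finset.sum_le_sum fun σ _ => by nlinarith [sq_nonneg (c (σ + τ) - c σ)]
  rw [← Finset.sum_div, Finset.sum_add_distrib, h1] at h2
  linarith

/-- The inner average over `b` is a Gauss sum: one factor of size `p^(-1/2)` independent of `σ`,
times a quadratic phase in `h`. For different `σ` these phases are almost orthogonal, so
off-diagonal terms gain a further `p^(-1/2)`. -/
theorem sum_normSq_correlation_le (hp : p ≠ 2) {c : ZMod p → ℂ} (hc : ∑ σ, ‖c σ‖ ^ 2 ≤ 1)
    {g : ZMod p} (hg : g ≠ 0) {τ : ZMod p} (hτ : τ ≠ 0) :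
    𝔼 h : ZMod p, ‖∑ σ, c (σ + τ) * conj (c σ) *
      𝔼 b : ZMod p, chi ((σ + τ) * g * b ^ 2 + σ * h - σ * g * (b - h) ^ 2)‖ ^ 2
      ≤ (p : ℝ)⁻¹ * ((√p)⁻¹ + ∑ σ, ‖c (σ + τ)‖ ^ 2 * ‖c σ‖ ^ 2) := by
  have hp0 : (0 : ℝ) < p := by exact_mod_cast (Fact.out : p.Prime).pos
  set a : ZMod p → ℂ := fun σ => c (σ + τ) * conj (c σ) with ha
  -- Completing the square in `b`, whose leading coefficient is `g τ ≠ 0`, leaves `σ h + v σ h²`.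
  set v : ZMod p → ZMod p := fun σ => -(g * σ * (σ + τ) / τ) with hv
  set Γ : ℂ := 𝔼 b : ZMod p, chi (g * τ * b ^ 2) with hΓ
  have hK : ∀ σ h : ZMod p,
      𝔼 b : ZMod p, chi ((σ + τ) * g * b ^ 2 + σ * h - σ * g * (b - h) ^ 2)
        = Γ * chi (σ * h + v σ * h ^ 2) := fun σ h => by
    rw [← expect_sub_right _ (σ * h / τ), hΓ, Finset.expect_mul]
    refine Finset.expect_congr rfl fun b _ => ?_
    rw [← chi_add]
    congr 1
    simp only [hv]
    field_simp
    ring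
  have hΓ2 : ‖Γ‖ ^ 2 = (p : ℝ)⁻¹ := by
    have := normSq_gauss hp 0 (mul_ne_zero hg hτ)
    simpa [hΓ] using this
  have e1 : ∀ h : ZMod p, ‖∑ σ, c (σ + τ) * conj (c σ) *
      𝔼 b : ZMod p, chi ((σ + τ) * g * b ^ 2 + σ * h - σ * g * (b - h) ^ 2)‖ ^ 2
      = (p : ℝ)⁻¹ * ‖∑ σ, a σ * chi (σ * h + v σ * h ^ 2)‖ ^ 2 := fun h => by
    rw [← hΓ2, ← mul_pow, ← norm_mul, Finset.mul_sum]
    congr 2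
    refine Finset.sum_congr rfl fun σ _ => ?_
    rw [hK]; simp only [ha]; ring
  simp_rw [e1, ← Finset.mul_expect]
  refine mul_le_mul_of_nonneg_left ?_ (by positivity)
  refine (expect_normSq_sum_le _).trans ?_
  have hterm : ∀ σ σ' : ZMod p, ‖𝔼 h : ZMod p, a σ * chi (σ * h + v σ * h ^ 2) *
      conj (a σ' * chi (σ' * h + v σ' * h ^ 2))‖
      ≤ ‖a σ‖ * ‖a σ'‖ * ((√p)⁻¹ + if σ = σ' then 1 else 0) := fun σ σ' => by
    have : ∀ h : ZMod p, a σ * chi (σ * h + v σ * h ^ 2) *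
      conj (a σ' * chi (σ' * h + v σ' * h ^ 2)) = (a σ * conj (a σ')) *
        chi ((σ - σ') * h + (v σ - v σ') * h ^ 2) := fun h => by
      rw [map_mul, ← chi_neg]
      have : (σ - σ') * h + (v σ - v σ') * h ^ 2
        = (σ * h + v σ * h ^ 2) + -(σ' * h + v σ' * h ^ 2) := by ring
      rw [this, chi_add (σ * h + v σ * h ^ 2)]; ring
    simp_rw [this, ← Finset.mul_expect]
    rw [norm_mul, norm_mul, RCLike.norm_conj]
    refine mul_le_mul_of_nonneg_left ?_ (by positivity)
    split_ifs with hσ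
    · have : ‖𝔼 h : ZMod p, chi ((σ - σ') * h + (v σ - v σ') * h ^ 2)‖ ≤ 1 :=
        norm_expect_le_one fun _ => (norm_chi _).le
      have : 0 ≤ (√p)⁻¹ := by positivity
      linarith
    · rw [add_zero]
      -- If the quadratic coefficients agree, the linear ones differ and orthogonality is exact;
      -- otherwise the Gauss bound applies.
      by_cases hvv : v σ - v σ' = 0
      · simp_rw [hvv, zero_mul, add_zero]
        rw [expect_chi_mul', if_neg (sub_ne_zero.mpr hσ), norm_zero]
        positivity
      · exact norm_gauss_le hp _ hvv
  refine (Finset.sum_le_sum fun σ _ => Finset.sum_le_sum fun σ' _ => hterm σ σ').trans ?_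
  have e2 : ∑ σ, ∑ σ', ‖a σ‖ * ‖a σ'‖ * ((√p)⁻¹ + if σ = σ' then (1 : ℝ) else 0)
      = (∑ σ, ‖a σ‖) ^ 2 * (√p)⁻¹ + ∑ σ, ‖a σ‖ ^ 2 := by
    simp_rw [mul_add, Finset.sum_add_distrib, ← Finset.sum_mul, sq, Finset.sum_mul_sum]
    simp
  rw [e2]
  have h3 : ∑ σ, ‖a σ‖ ≤ 1 := by
    simp only [ha, norm_mul, RCLike.norm_conj]
    exact sum_autocorrelation_le (c := fun σ => ‖c σ‖) hc τ
  have h4 : (∑ σ, ‖a σ‖) ^ 2 ≤ 1 := pow_le_one₀ (Finset.sum_nonneg fun _ _ => norm_nonneg _) h3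
  have h5 : 0 ≤ (√p)⁻¹ := by positivity
  have h6 : ∑ σ, ‖a σ‖ ^ 2 = ∑ σ, ‖c (σ + τ)‖ ^ 2 * ‖c σ‖ ^ 2 :=
    Finset.sum_congr rfl fun σ _ => by simp only [ha, norm_mul, RCLike.norm_conj, mul_pow]
  rw [h6]
  nlinarith

/-- The case `τ = 0` is separate because the quadratic terms in `b` cancel. What remains is linear
in `b` with slope `2 σ g h`, so only `h = 0` survives once `σ = 0` is excluded by `c 0 = 0`. -/
theorem normSq_correlation_zero_le (hp : p ≠ 2) {c : ZMod p → ℂ} (hc : ∑ σ, ‖c σ‖ ^ 2 ≤ 1)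
    (hc0 : c 0 = 0) {g : ZMod p} (hg : g ≠ 0) :
    𝔼 h : ZMod p, ‖∑ σ, c σ * conj (c σ) *
      𝔼 b : ZMod p, chi (σ * g * b ^ 2 + σ * h - σ * g * (b - h) ^ 2)‖ ^ 2 ≤ (p : ℝ)⁻¹ := by
  have h2 := two_ne_zero_zmod hp
  have hterm : ∀ h : ZMod p, ‖∑ σ, c σ * conj (c σ) *
      𝔼 b : ZMod p, chi (σ * g * b ^ 2 + σ * h - σ * g * (b - h) ^ 2)‖ ^ 2
      ≤ if h = 0 then 1 else 0 := fun h => by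
    split_ifs with hh
    · refine pow_le_one₀ (norm_nonneg _) ((norm_sum_le _ _).trans
        ((Finset.sum_le_sum fun σ _ => ?_).trans hc))
      rw [norm_mul, norm_mul, RCLike.norm_conj, ← sq]
      exact mul_le_of_le_one_right (by positivity) (norm_expect_le_one fun _ => (norm_chi _).le)
    · rw [Finset.sum_eq_zero, norm_zero, zero_pow two_ne_zero]
      intro σ _
      by_cases hσ : σ = 0
      · simp [hσ, hc0]
      · have : ∀ b : ZMod p, chi (σ * g * b ^ 2 + σ * h - σ * g * (b - h) ^ 2)
            = chi (σ * h - σ * g * h ^ 2) * chi (b * (2 * σ * g * h)) := fun b => by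
          rw [← chi_add]; congr 1; ring
        simp_rw [this, ← Finset.mul_expect, expect_chi_mul]
        rw [if_neg (by simp [h2, hσ, hg, hh])]; simp
  refine (expect_mono hterm).trans (le_of_eq ?_)
  rw [Fintype.expect_eq_sum_div_card]
  simp

theorem expect_normSq_sum_chi (L : ZMod p → ℂ) :
    𝔼 a : ZMod p, ‖∑ τ, L τ * chi (-(τ * a))‖ ^ 2 = ∑ τ, ‖L τ‖ ^ 2 := by
  rw [← sum_normSq_dft]
  refine Finset.sum_congr rfl fun ξ _ => ?_
  congr 2
  simp only [dft, Finset.sum_mul]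
  rw [Finset.expect_sum_comm]
  have : ∀ τ a : ZMod p, L τ * chi (-(τ * a)) * chi (ξ * a) = L τ * chi (a * (ξ - τ)) :=
    fun τ a => by rw [mul_assoc, ← chi_add]; congr 2; ring
  simp_rw [this, ← Finset.mul_expect, expect_chi_mul, sub_eq_zero]
  simp

/-- The box norm of `(a, b) ↦ C (a - g (b - a)²)` is small for mean-zero `C`. -/
theorem box_quadratic_le (hp : p ≠ 2) {C : ZMod p → ℂ} (hC : ∑ σ, ‖dft C σ‖ ^ 2 ≤ 1)
    (hC0 : dft C 0 = 0) {g : ZMod p} (hg : g ≠ 0) :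
    𝔼 h : ZMod p, 𝔼 a : ZMod p,
      ‖𝔼 b : ZMod p, C (a - g * b ^ 2) * conj (C (a + h - g * (b - h) ^ 2))‖ ^ 2
      ≤ 3 * (√p)⁻¹ := by
  have hp0 : (0 : ℝ) < p := by exact_mod_cast (Fact.out : p.Prime).pos
  set c := dft C with hc
  set L : ZMod p → ZMod p → ℂ := fun h τ => ∑ σ, c (σ + τ) * conj (c σ) *
      𝔼 b : ZMod p, chi ((σ + τ) * g * b ^ 2 + σ * h - σ * g * (b - h) ^ 2) with hL
  have e1 : ∀ h a : ZMod p,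
      𝔼 b : ZMod p, C (a - g * b ^ 2) * conj (C (a + h - g * (b - h) ^ 2))
        = ∑ τ, L h τ * chi (-(τ * a)) := fun h a => by
    have : ∀ b : ZMod p, C (a - g * b ^ 2) * conj (C (a + h - g * (b - h) ^ 2))
        = ∑ τ, ∑ σ, c (σ + τ) * conj (c σ) *
          chi ((σ + τ) * g * b ^ 2 + σ * h - σ * g * (b - h) ^ 2) * chi (-(τ * a)) := fun b => by
      rw [dft_inversion C (a - g * b ^ 2), dft_inversion C (a + h - g * (b - h) ^ 2), map_sum,
        Finset.sum_mul_sum, Finset.sum_comm]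
      conv_rhs => rw [Finset.sum_comm]
      refine Finset.sum_congr rfl fun σ _ => ?_
      -- The two frequencies of the expansion are written as `ρ = σ + τ` and `σ`, so that `τ`
      -- becomes the frequency in `a` and Parseval in `a` separates the values of `τ`.
      refine Fintype.sum_equiv (Equiv.subRight σ) _ _ fun ρ => ?_
      simp only [Equiv.subRight_apply, add_sub_cancel, map_mul]
      rw [← chi_neg, mul_assoc (c ρ * conj (c σ)), ← chi_add, mul_mul_mul_comm, ← chi_add]
      congr 2
      ring
    simp_rw [this, Finset.expect_sum_comm, hL, Finset.sum_mul]
    simp_rw [← Finset.expect_mul, ← Finset.mul_expect]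
  simp_rw [e1, expect_normSq_sum_chi]
  rw [Finset.expect_sum_comm]
  have hbound : ∀ τ, 𝔼 h, ‖L h τ‖ ^ 2 ≤ (p : ℝ)⁻¹ * ((√p)⁻¹ +
      ∑ σ, ‖c (σ + τ)‖ ^ 2 * ‖c σ‖ ^ 2) + if τ = 0 then (p : ℝ)⁻¹ else 0 := fun τ => by
    split_ifs with hτ
    · subst hτ
      have := normSq_correlation_zero_le hp hC hC0 hg
      simp only [hL, add_zero]
      refine this.trans ?_
      have : 0 ≤ (p : ℝ)⁻¹ * ((√p)⁻¹ + ∑ σ, ‖c σ‖ ^ 2 * ‖c σ‖ ^ 2) := by positivity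
      linarith
    · rw [add_zero]
      exact sum_normSq_correlation_le hp hC hg hτ
  refine (Finset.sum_le_sum fun τ _ => hbound τ).trans ?_
  rw [Finset.sum_add_distrib, ← Finset.mul_sum, Finset.sum_add_distrib, Finset.sum_const,
    Finset.card_univ, ZMod.card, Finset.sum_comm]
  have e2 : ∑ σ, ∑ τ, ‖c (σ + τ)‖ ^ 2 * ‖c σ‖ ^ 2 = (∑ σ, ‖c σ‖ ^ 2) ^ 2 := by
    rw [sq, Finset.sum_mul_sum]
    refine Finset.sum_congr rfl fun σ _ => ?_
    refine Fintype.sum_equiv (Equiv.addLeft σ) _ _ fun τ => ?_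
    simp [mul_comm]
  have h1 : (∑ σ, ‖c σ‖ ^ 2) ^ 2 ≤ 1 :=
    pow_le_one₀ (Finset.sum_nonneg fun _ _ => by positivity) hC
  have h2 : (p : ℝ)⁻¹ ≤ (√p)⁻¹ := by
    have hp1 : (1 : ℝ) ≤ p := by exact_mod_cast (Fact.out : p.Prime).one_le
    refine inv_anti₀ (by positivity) ?_
    exact Real.sqrt_le_iff.mpr ⟨by linarith, by nlinarith⟩
  rw [e2, nsmul_eq_mul, Finset.sum_ite_eq' Finset.univ (0 : ZMod p), if_pos (Finset.mem_univ _),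
    mul_add, inv_mul_cancel_left₀ hp0.ne']
  have h3 : (p : ℝ)⁻¹ * (∑ σ, ‖c σ‖ ^ 2) ^ 2 ≤ (p : ℝ)⁻¹ :=
    mul_le_of_le_one_right (by positivity) h1
  linarith

/-- The nonlinear Roth configuration over a prime field. -/
theorem expect_normSq_quadratic_le (hp : p ≠ 2) {A B : ZMod p → ℂ} (hA : ∀ y, ‖A y‖ ≤ 1)
    (hB : ∀ y, ‖B y‖ ≤ 1) {β : ZMod p} (hβ : β ≠ 0) {t : ℝ} (ht : 0 ≤ t) (htp : 9 ≤ t ^ 8 * p) :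
    𝔼 y, ‖𝔼 u : ZMod p, A (y + u ^ 2) * B (y + (u + β) ^ 2)‖ ^ 2
      ≤ ‖𝔼 y, A y‖ * ‖𝔼 y, B y‖ + t := by
  have h2 := two_ne_zero_zmod hp
  have hp0 : (0 : ℝ) < p := by exact_mod_cast (Fact.out : p.Prime).pos
  set D : ZMod p → ℂ := fun y => 𝔼 u : ZMod p, A (y + u ^ 2) * B (y + (u + β) ^ 2) with hD
  have hD1 : ∀ y, ‖D y‖ ≤ 1 := fun y => norm_expect_le_one fun u => norm_mul_le_one' (hA _) (hB _)
  set C : ZMod p → ℂ := fun y => conj (D y) with hCdef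
  have hC1 : ∀ y, ‖C y‖ ≤ 1 := fun y => norm_conj_le_one (hD1 y)
  set c : ℂ := dft C 0 with hc
  have hc1 : ‖c‖ ≤ 1 := norm_dft_le_one hC1 0
  set C₀ : ZMod p → ℂ := fun y => C y - c with hC₀
  -- With `a = y + u²` and `b = a + 2βu` one has `u² = g (b - a)²`, so `y = a - g (b - a)²`.
  set g : ZMod p := (4 * β ^ 2)⁻¹ with hg
  have h4 : (4 : ZMod p) ≠ 0 := by
    have : (4 : ZMod p) = 2 * 2 := by norm_num
    rw [this]; exact mul_ne_zero h2 h2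
  have hg0 : g ≠ 0 := inv_ne_zero (mul_ne_zero h4 (pow_ne_zero _ hβ))
  have hdft : ∀ σ, dft C₀ σ = if σ = 0 then 0 else dft C σ := fun σ => by
    have : dft C₀ σ = dft C σ - c * 𝔼 y : ZMod p, chi (σ * y) := by
      simp only [dft, hC₀, sub_mul, Finset.expect_sub_distrib, Finset.mul_expect]
    rw [this, expect_chi_mul']
    split_ifs with h
    · rw [h, hc]; ring
    · ring
  have hC₀1 : ∑ σ, ‖dft C₀ σ‖ ^ 2 ≤ 1 := by
    refine le_trans (Finset.sum_le_sum fun σ _ => ?_) (sum_normSq_dft_le_one hC1)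
    rw [hdft]
    split_ifs <;> simp
  have hbox := box_quadratic_le hp hC₀1 (by simp [hdft]) hg0
  set B' : ZMod p → ℂ := fun b => B (b + β ^ 2) with hB'
  have e1 : ((𝔼 y, ‖D y‖ ^ 2 : ℝ) : ℂ)
      = 𝔼 a, 𝔼 b, A a * B' b * C (a - g * (b - a) ^ 2) := by
    rw [ofReal_expect]
    have : ∀ y, ((‖D y‖ ^ 2 : ℝ) : ℂ)
        = 𝔼 u : ZMod p, A (y + u ^ 2) * B (y + (u + β) ^ 2) * C y := fun y => by
      rw [normSq_eq, ← Finset.expect_mul]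
    simp_rw [this]
    rw [Finset.expect_comm]
    have : ∀ u : ZMod p, 𝔼 y, A (y + u ^ 2) * B (y + (u + β) ^ 2) * C y
        = 𝔼 y, A y * B' (y + 2 * β * u) * C (y - u ^ 2) := fun u => by
      rw [← expect_sub_right _ (u ^ 2)]
      refine Finset.expect_congr rfl fun y _ => ?_
      simp only [hB', sub_add_cancel]
      congr 3; ring
    simp_rw [this]
    rw [Finset.expect_comm]
    refine Finset.expect_congr rfl fun a _ => ?_
    refine Fintype.expect_equiv ((Equiv.mulLeft₀ (2 * β) (mul_ne_zero h2 hβ)).trans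
      (Equiv.addLeft a)) _ _ fun u => ?_
    simp only [Equiv.trans_apply, Equiv.mulLeft₀_apply, Equiv.coe_addLeft, hg]
    congr 2
    field_simp
    ring
  -- The mean of `C` gives the main term; the mean-zero remainder is bounded by its box norm, which
  -- eliminates `A` and `B'`.
  have e2 : 𝔼 a, 𝔼 b, A a * B' b * C (a - g * (b - a) ^ 2)
      = (𝔼 a, A a) * (𝔼 b, B b) * c + 𝔼 a, 𝔼 b, C₀ (a - g * (b - a) ^ 2) * A a * B' b := by
    have hb : 𝔼 b, B b = 𝔼 b, B' b := (expect_add_right B (β ^ 2)).symm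
    rw [hb, Finset.expect_mul_expect, Finset.expect_mul, ← Finset.expect_add_distrib]
    refine Finset.expect_congr rfl fun a _ => ?_
    rw [Finset.expect_mul, ← Finset.expect_add_distrib]
    refine Finset.expect_congr rfl fun b _ => ?_
    simp only [hC₀]; ring
  have hT : ‖𝔼 a, 𝔼 b, C₀ (a - g * (b - a) ^ 2) * A a * B' b‖ ^ 4 ≤ 3 * (√p)⁻¹ := by
    refine (box_two hA (fun b => hB _) (fun a b => C₀ (a - g * (b - a) ^ 2))).trans
      ((le_of_eq ?_).trans hbox)
    conv_rhs => rw [Finset.expect_comm]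
    refine Finset.expect_congr rfl fun a _ => ?_
    rw [← expect_add_right _ a]
    refine Finset.expect_congr rfl fun h _ => ?_
    rw [← expect_add_right _ a]
    congr 2
    refine Finset.expect_congr rfl fun b _ => ?_
    rw [add_sub_cancel_right, add_comm h a, show b + a - (a + h) = b - h by ring]
  have hT' : ‖𝔼 a, 𝔼 b, C₀ (a - g * (b - a) ^ 2) * A a * B' b‖ ≤ t := by
    -- The hypothesis `9 ≤ t ^ 8 * p` is the square of this bound.
    have hs : 3 * (√p)⁻¹ ≤ t ^ 4 := by
      rw [← div_eq_mul_inv, div_le_iff₀ (Real.sqrt_pos.mpr hp0)]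
      refine abs_le_of_sq_le_sq' ?_ (by positivity) |>.2
      rw [mul_pow, Real.sq_sqrt hp0.le]; nlinarith
    exact le_of_pow_le_pow_left₀ four_ne_zero ht (hT.trans hs)
  have h0 : 0 ≤ 𝔼 y, ‖D y‖ ^ 2 := expect_nonneg' fun _ => by positivity
  rw [← Real.norm_of_nonneg h0, ← Complex.norm_real, e1, e2]
  refine (norm_add_le _ _).trans (add_le_add ?_ hT')
  rw [norm_mul, norm_mul]
  exact mul_le_of_le_one_right (by positivity) hc1

end PrimeField

/-! ### The counting operator on `ℤ/M`, and its control when the last function is `p`-periodic -/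

section Operator

variable {M : ℕ} [NeZero M]

/-- The difference `u - x + s` modulo `M`. -/
def disp (M : ℕ) (s : ℤ) (x u : ℕ) : ZMod M := (u : ZMod M) - x + s

variable {N : ℕ}

/-- The counting operator on `ℤ/Mℤ` in the second variable, with `x` and `u = x + d` ranging over
intervals of length `N`. -/
def cnt (s : ℤ) (f₀ f₁ P : Fin N → ZMod M → ℂ) : ℂ :=
  𝔼 x, 𝔼 u, 𝔼 y, f₀ x y * f₁ u y * P x (y + disp M s x u ^ 2)

theorem expect_comp_castHom {p : ℕ} [NeZero p] (hp : p ∣ M) {E : Type*} [AddCommMonoid E]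
    [Module ℚ≥0 E] (f : ZMod p → E) :
    𝔼 y : ZMod M, f (ZMod.castHom hp (ZMod p) y) = 𝔼 a, f a := by
  have h : ∀ a : ZMod p, 𝔼 y : ZMod M, f (ZMod.castHom hp (ZMod p) y)
      = 𝔼 y : ZMod M, f (a + ZMod.castHom hp (ZMod p) y) := fun a => by
    obtain ⟨b, rfl⟩ := ZMod.castHom_surjective hp a
    rw [← expect_add_right (M := M) _ b]
    simp_rw [map_add, add_comm]
  calc 𝔼 y : ZMod M, f (ZMod.castHom hp (ZMod p) y)
      = 𝔼 a : ZMod p, 𝔼 y : ZMod M, f (a + ZMod.castHom hp (ZMod p) y) := by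
        simp_rw [← h]; simp
    _ = 𝔼 a, f a := by
        rw [Finset.expect_comm]
        simp_rw [expect_add_right f]
        simp

theorem sum_range_natCast {p : ℕ} [NeZero p] (m : ℕ) (g : ZMod p → ℂ) :
    ∑ v ∈ Finset.range (m * p), g (v : ZMod p) = m * ∑ a, g a := by
  induction m with
  | zero => simp
  | succ m ih =>
    rw [Nat.succ_mul, Finset.sum_range_add, ih]
    have : ∑ v ∈ Finset.range p, g ((m * p + v : ℕ) : ZMod p) = ∑ a, g a := by
      refine Finset.sum_bij' (fun v _ => (v : ZMod p)) (fun a _ => a.val) ?_ ?_ ?_ ?_ ?_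
      · simp
      · intro a _; simpa using ZMod.val_lt a
      · intro v hv; exact ZMod.val_cast_of_lt (Finset.mem_range.mp hv)
      · intro a _; simp
      · intro v hv; simp
    rw [this]; push_cast; ring

theorem expect_fin_natCast {p : ℕ} [NeZero p] {m : ℕ} (hm : 0 < m) (g : ZMod p → ℂ) :
    𝔼 v : Fin (m * p), g ((v : ℕ) : ZMod p) = 𝔼 a, g a := by
  have hp0 : (p : ℂ) ≠ 0 := by exact_mod_cast NeZero.ne p
  have hm0 : (m : ℂ) ≠ 0 := by exact_mod_cast hm.ne'
  rw [Fintype.expect_eq_sum_div_card, Fintype.expect_eq_sum_div_card, Fintype.card_fin, ZMod.card,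
    Fin.sum_univ_eq_sum_range (fun v => g (v : ZMod p)), sum_range_natCast]
  push_cast
  field_simp

theorem exists_descent {p : ℕ} [NeZero p] (hp : p ∣ M) {c : ZMod M → ℂ}
    (hc : ∀ y t, c (y + (p : ZMod M) * t) = c y) :
    ∃ c' : ZMod p → ℂ, ∀ y, c y = c' (ZMod.castHom hp (ZMod p) y) := by
  refine ⟨fun a => c ((a.val : ℕ) : ZMod M), fun y => ?_⟩
  have hy : y = ((y.val : ℕ) : ZMod M) := by simp
  have h1 : ZMod.castHom hp (ZMod p) y = ((y.val : ℕ) : ZMod p) := by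
    conv_lhs => rw [hy]
    simp
  rw [h1]
  beta_reduce
  rw [ZMod.val_natCast]
  conv_lhs => rw [hy, ← Nat.mod_add_div y.val p]
  push_cast
  rw [hc]

/-- A residue class meets the interval in at most `N / p + 1` points, and `p ≤ N`. This bounds the
pairs with `x - x' = 0` modulo `p`, for which the prime field estimate says nothing. -/
theorem card_congruent_le {p : ℕ} (hp : 0 < p) (hpN : p ≤ N) (x : Fin N) :
    𝔼 x' : Fin N, (if ((x : ℕ) : ZMod p) = ((x' : ℕ) : ZMod p) then (1 : ℝ) else 0)
      ≤ 2 / p := by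
  have hp' : (0 : ℝ) < p := by exact_mod_cast hp
  have hN' : (0 : ℝ) < N := by exact_mod_cast hp.trans_le hpN
  rw [Fintype.expect_eq_sum_div_card, Fintype.card_fin, div_le_div_iff₀ hN' hp']
  have h1 : ∑ x' : Fin N, (if ((x : ℕ) : ZMod p) = ((x' : ℕ) : ZMod p) then (1 : ℝ) else 0)
      = Nat.count (fun k => k ≡ (x : ℕ) [MOD p]) N := by
    rw [Fin.sum_univ_eq_sum_range (fun v => if ((x : ℕ) : ZMod p) = ((v : ℕ) : ZMod p)
      then (1 : ℝ) else 0) N, Nat.count_eq_card_filter_range, Finset.card_filter]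
    push_cast
    refine Finset.sum_congr rfl fun v _ => ?_
    simp only [ZMod.natCast_eq_natCast_iff, Nat.ModEq.comm]
  have h2 : Nat.count (fun k => k ≡ (x : ℕ) [MOD p]) N ≤ N / p + 1 := by
    rw [Nat.count_modEq_card _ hp]
    split_ifs <;> omega
  rw [h1]
  have h3 : ((N / p : ℕ) : ℝ) ≤ N / p := Nat.cast_div_le
  have h4 : (Nat.count (fun k => k ≡ (x : ℕ) [MOD p]) N : ℝ) ≤ N / p + 1 := by
    have : (Nat.count (fun k => k ≡ (x : ℕ) [MOD p]) N : ℝ) ≤ ((N / p + 1 : ℕ) : ℝ) := by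
      exact_mod_cast h2
    push_cast at this; linarith
  have h5 : (p : ℝ) ≤ N := by exact_mod_cast hpN
  calc _ ≤ (N / p + 1 : ℝ) * p := mul_le_mul_of_nonneg_right h4 hp'.le
    _ = N + p := by field_simp
    _ ≤ 2 * N := by linarith

/-- If the last function is invariant under multiples of `p`, the count is controlled by its
averages. -/
theorem norm_cnt_periodic_le {p : ℕ} [Fact p.Prime] (hp2 : p ≠ 2) (hpM : p ∣ M) (hpN : p ≤ N)
    {f₀ f₁ c : Fin N → ZMod M → ℂ} (h₀ : ∀ x y, ‖f₀ x y‖ ≤ 1) (h₁ : ∀ x y, ‖f₁ x y‖ ≤ 1)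
    (hc1 : ∀ x y, ‖c x y‖ ≤ 1) (hc : ∀ x y t, c x (y + (p : ZMod M) * t) = c x y) (s : ℤ)
    {t : ℝ} (ht : 0 ≤ t) (ht1 : t ≤ 1) (htp : 9 ≤ t ^ 8 * p) :
    ‖cnt s f₀ f₁ c‖ ^ 4 ≤ 4 * (𝔼 x, ‖𝔼 y, c x y‖ + 2 * t) := by
  have hp0 : 0 < p := (Fact.out : p.Prime).pos
  have hp' : (0 : ℝ) < p := by exact_mod_cast hp0
  have hN0 : 0 < N := hp0.trans_le hpN
  have hN' : (0 : ℝ) < N := by exact_mod_cast hN0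
  have : Nonempty (Fin N) := ⟨⟨0, hN0⟩⟩
  choose c' hc' using fun x => exists_descent hpM (hc x)
  set π := ZMod.castHom hpM (ZMod p) with hπ
  -- The range of `u` is enlarged to `m p ≤ 2 N` points, so that `u` is exactly uniform modulo `p`.
  -- Positivity of `Φ` makes this cost only a factor `2`.
  set m := N / p + 1 with hm
  have : NeZero (m * p) := ⟨by positivity⟩
  have hmN : N ≤ m * p := (Nat.lt_div_mul_add hp0 (a := N)).le.trans (by rw [hm]; ring_nf; omega)
  have hm2 : m * p ≤ 2 * N := by
    have := Nat.div_mul_le_self N p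
    rw [hm, add_mul]; omega
  set Φ : ℕ → ℝ := fun v => 𝔼 y, ‖𝔼 x, f₀ x y * c x (y + disp M s x v ^ 2)‖ ^ 2 with hΦ
  have hΦ0 : ∀ v, 0 ≤ Φ v := fun v => expect_nonneg' fun _ => by positivity
  have i1 : ‖cnt s f₀ f₁ c‖ ^ 2 ≤ 𝔼 u : Fin N, Φ u := by
    have e : cnt s f₀ f₁ c
        = 𝔼 u, 𝔼 y, f₁ u y * 𝔼 x, f₀ x y * c x (y + disp M s x u ^ 2) := by
      rw [cnt, Finset.expect_comm]
      refine Finset.expect_congr rfl fun u _ => ?_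
      rw [Finset.expect_comm]
      refine Finset.expect_congr rfl fun y _ => ?_
      rw [Finset.mul_expect]
      exact Finset.expect_congr rfl fun x _ => by ring
    rw [e]
    exact (normSq_expect_le _).trans (expect_mono fun u => normSq_expect_mul_le (h₁ u) _)
  have i2 : 𝔼 u : Fin N, Φ u ≤ 2 * 𝔼 v : Fin (m * p), Φ v := by
    rw [Fintype.expect_eq_sum_div_card, Fintype.expect_eq_sum_div_card, Fintype.card_fin,
      Fintype.card_fin, Fin.sum_univ_eq_sum_range Φ, Fin.sum_univ_eq_sum_range Φ]
    have h1 : ∑ v ∈ Finset.range N, Φ v ≤ ∑ v ∈ Finset.range (m * p), Φ v :=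
      Finset.sum_le_sum_of_subset_of_nonneg (Finset.range_mono hmN) fun v _ _ => hΦ0 v
    have h2 : 0 ≤ ∑ v ∈ Finset.range (m * p), Φ v := Finset.sum_nonneg fun v _ => hΦ0 v
    have h3 : (0 : ℝ) < ((m * p : ℕ) : ℝ) := by exact_mod_cast hN0.trans_le hmN
    have h4 : ((m * p : ℕ) : ℝ) ≤ 2 * N := by exact_mod_cast hm2
    rw [← mul_div_assoc, div_le_div_iff₀ hN' h3]
    calc _ ≤ (∑ v ∈ Finset.range (m * p), Φ v) * ((m * p : ℕ) : ℝ) := by gcongr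
      _ ≤ (∑ v ∈ Finset.range (m * p), Φ v) * (2 * N) := by gcongr
      _ = _ := by ring
  -- Expanding the square over `x, x'` removes `f₀` and leaves the nonlinear Roth configuration on
  -- `ℤ/p` with parameter `x - x'`.
  set E : Fin N → Fin N → ℝ := fun x x' => 𝔼 y : ZMod p, ‖𝔼 a : ZMod p,
    c' x (y + a ^ 2) * conj (c' x' (y + (a + ((x : ℕ) - (x' : ℕ) : ZMod p)) ^ 2))‖ with hE
  have i3 : 𝔼 v : Fin (m * p), Φ v ≤ 𝔼 x, 𝔼 x', E x x' := by
    have e : ((𝔼 v : Fin (m * p), Φ v : ℝ) : ℂ) = 𝔼 x, 𝔼 x', 𝔼 y, (f₀ x y * conj (f₀ x' y)) *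
        𝔼 v : Fin (m * p), c x (y + disp M s x v ^ 2) * conj (c x' (y + disp M s x' v ^ 2)) := by
      simp only [ofReal_expect, hΦ, normSq_expect_eq, Finset.mul_expect]
      rw [Finset.expect_comm]
      have : ∀ g : ZMod M → Fin (m * p) → Fin N → Fin N → ℂ, 𝔼 y, 𝔼 v, 𝔼 x, 𝔼 x', g y v x x'
          = 𝔼 x, 𝔼 x', 𝔼 y, 𝔼 v, g y v x x' := fun g => by
        calc _ = 𝔼 y, 𝔼 x, 𝔼 v, 𝔼 x', g y v x x' :=
              Finset.expect_congr rfl fun y _ => Finset.expect_comm _ _ _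
          _ = 𝔼 x, 𝔼 y, 𝔼 v, 𝔼 x', g y v x x' := Finset.expect_comm _ _ _
          _ = 𝔼 x, 𝔼 y, 𝔼 x', 𝔼 v, g y v x x' :=
              Finset.expect_congr rfl fun x _ => Finset.expect_congr rfl fun y _ =>
                Finset.expect_comm _ _ _
          _ = _ := Finset.expect_congr rfl fun x _ => Finset.expect_comm _ _ _
      rw [this]
      refine Finset.expect_congr rfl fun x _ => Finset.expect_congr rfl fun x' _ =>
        Finset.expect_congr rfl fun y _ => Finset.expect_congr rfl fun v _ => ?_
      simp only [map_mul]; ring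
    have h0 : 0 ≤ 𝔼 v : Fin (m * p), Φ v := expect_nonneg' fun v => hΦ0 v
    rw [← Real.norm_of_nonneg h0, ← Complex.norm_real, e]
    refine (norm_expect_le _ _).trans (expect_mono fun x => (norm_expect_le _ _).trans
      (expect_mono fun x' => (norm_expect_mul_le
        (fun y => norm_mul_conj_le_one (h₀ x y) (h₀ x' y)) _).trans (le_of_eq ?_)))
    simp only [hE]
    rw [← expect_comp_castHom hpM]
    refine Finset.expect_congr rfl fun y _ => ?_
    congr 1
    have h1 : ∀ (x : Fin N) (v : ℕ), c x (y + disp M s x v ^ 2)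
        = c' x (π y + ((v : ZMod p) - (x : ℕ) + s) ^ 2) := fun x v => by
      rw [hc', map_add, map_pow, disp, map_add, map_sub, map_natCast, map_natCast, map_intCast]
    simp_rw [h1]
    rw [expect_fin_natCast (Nat.succ_pos _) (fun a : ZMod p => c' x (π y + (a - (x : ℕ) + s) ^ 2) *
      conj (c' x' (π y + (a - (x' : ℕ) + s) ^ 2)))]
    rw [← expect_add_right _ ((x : ℕ) - s : ZMod p)]
    refine Finset.expect_congr rfl fun a _ => ?_
    congr 3
    · ring
    · rw [hπ]; ring
  have i4 : ∀ x x', E x x' ^ 2 ≤ ‖𝔼 y, c x y‖ + t +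
      if ((x : ℕ) : ZMod p) = ((x' : ℕ) : ZMod p) then 1 else 0 := fun x x' => by
    have hc'1 : ∀ x a, ‖c' x a‖ ≤ 1 := fun x a => by
      obtain ⟨b, rfl⟩ := ZMod.castHom_surjective hpM a
      rw [← hc']; exact hc1 x b
    split_ifs with hx
    · have : E x x' ≤ 1 := expect_le_of_forall fun y => norm_expect_le_one fun a =>
        norm_mul_conj_le_one (hc'1 _ _) (hc'1 _ _)
      have h0 : 0 ≤ E x x' := expect_nonneg' fun _ => norm_nonneg _
      have := pow_le_one₀ (n := 2) h0 this
      have : 0 ≤ ‖𝔼 y, c x y‖ := norm_nonneg _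
      linarith
    · rw [add_zero]
      refine (pow_expect_le (fun _ => norm_nonneg _) 2).trans ?_
      refine (expect_normSq_quadratic_le hp2 (hc'1 x) (fun y => norm_conj_le_one (hc'1 x' y))
        (sub_ne_zero.mpr hx) ht htp).trans ?_
      have e1 : 𝔼 y, c x y = 𝔼 a, c' x a := by
        rw [← expect_comp_castHom hpM]
        exact Finset.expect_congr rfl fun y _ => hc' x y
      rw [e1]
      have : ‖𝔼 y, conj (c' x' y)‖ ≤ 1 := norm_expect_le_one fun y => norm_conj_le_one (hc'1 x' y)
      have := mul_le_of_le_one_right (norm_nonneg (𝔼 a, c' x a)) this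
      linarith
  have i5 : (𝔼 x, 𝔼 x', E x x') ^ 2 ≤ 𝔼 x, ‖𝔼 y, c x y‖ + 2 * t := by
    refine (pow_expect_le (fun x => expect_nonneg' fun x' => expect_nonneg' fun _ =>
      norm_nonneg _) 2).trans ?_
    have : ∀ x, (𝔼 x', E x x') ^ 2 ≤ ‖𝔼 y, c x y‖ + 2 * t := fun x => by
      refine (pow_expect_le (fun x' => expect_nonneg' fun _ => norm_nonneg _) 2).trans
        ((expect_mono (i4 x)).trans ?_)
      rw [Finset.expect_add_distrib, Finset.expect_const Finset.univ_nonempty]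
      have h1 := card_congruent_le hp0 hpN x
      -- From `t ≤ 1` one gets `9 ≤ t ^ 8 * p ≤ t * p`, so the diagonal contribution is absorbed in
      -- the second `t`.
      have h2 : 2 / (p : ℝ) ≤ t := by
        rw [div_le_iff₀ hp']
        have : t ^ 8 ≤ t := by
          calc t ^ 8 ≤ t ^ 1 := pow_le_pow_of_le_one ht ht1 (by norm_num)
            _ = t := pow_one t
        nlinarith
      linarith
    refine (expect_mono this).trans (le_of_eq ?_)
    rw [Finset.expect_add_distrib, Finset.expect_const Finset.univ_nonempty]
  have h0 : 0 ≤ 𝔼 x, 𝔼 x', E x x' := expect_nonneg' fun x => expect_nonneg' fun x' =>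
    expect_nonneg' fun _ => norm_nonneg _
  have i6 : ‖cnt s f₀ f₁ c‖ ^ 2 ≤ 2 * 𝔼 x, 𝔼 x', E x x' := by linarith
  calc ‖cnt s f₀ f₁ c‖ ^ 4 = (‖cnt s f₀ f₁ c‖ ^ 2) ^ 2 := by ring
    _ ≤ (2 * 𝔼 x, 𝔼 x', E x x') ^ 2 := pow_le_pow_left₀ (by positivity) i6 2
    _ = 4 * (𝔼 x, 𝔼 x', E x x') ^ 2 := by ring
    _ ≤ _ := by linarith

end Operator

/-! ### Dual functions, directional box norms and degree lowering -/

section Lowering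

variable {M : ℕ} [NeZero M] {N : ℕ} {ι κ τ : Type*} [Fintype ι] [Fintype κ] [Fintype τ]

/-- The contribution of the pair `(x, u)` to the dual function. -/
def dualTerm (s : ℤ) (f₀ f₁ : Fin N → ZMod M → ℂ) (x u : Fin N) (y : ZMod M) : ℂ :=
  f₀ x (y - disp M s x u ^ 2) * f₁ u (y - disp M s x u ^ 2)

/-- The dual function of the counting operator. -/
def dual (s : ℤ) (f₀ f₁ : Fin N → ZMod M → ℂ) (x : Fin N) (y : ZMod M) : ℂ :=
  𝔼 u, dualTerm s f₀ f₁ x u y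

theorem cnt_eq_expect_dualTerm (s : ℤ) (f₀ f₁ P : Fin N → ZMod M → ℂ) :
    cnt s f₀ f₁ P = 𝔼 x, 𝔼 u, 𝔼 y, dualTerm s f₀ f₁ x u y * P x y := by
  refine Finset.expect_congr rfl fun x _ => Finset.expect_congr rfl fun u _ => ?_
  rw [← expect_sub_right _ (disp M s x u ^ 2)]
  refine Finset.expect_congr rfl fun y _ => ?_
  rw [sub_add_cancel, dualTerm]

theorem cnt_eq_expect_dual (s : ℤ) (f₀ f₁ P : Fin N → ZMod M → ℂ) :
    cnt s f₀ f₁ P = 𝔼 x, 𝔼 y, dual s f₀ f₁ x y * P x y := by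
  rw [cnt_eq_expect_dualTerm]
  refine Finset.expect_congr rfl fun x _ => ?_
  rw [Finset.expect_comm]
  refine Finset.expect_congr rfl fun y _ => ?_
  rw [dual, Finset.expect_mul]

theorem norm_dualTerm_le {s : ℤ} {f₀ f₁ : Fin N → ZMod M → ℂ} (h₀ : ∀ x y, ‖f₀ x y‖ ≤ 1)
    (h₁ : ∀ x y, ‖f₁ x y‖ ≤ 1) (x u : Fin N) (y : ZMod M) : ‖dualTerm s f₀ f₁ x u y‖ ≤ 1 :=
  norm_mul_le_one' (h₀ _ _) (h₁ _ _)

theorem norm_dual_le {s : ℤ} {f₀ f₁ : Fin N → ZMod M → ℂ} (h₀ : ∀ x y, ‖f₀ x y‖ ≤ 1)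
    (h₁ : ∀ x y, ‖f₁ x y‖ ≤ 1) (x : Fin N) (y : ZMod M) : ‖dual s f₀ f₁ x y‖ ≤ 1 := by
  have : Nonempty (Fin N) := ⟨x⟩
  exact norm_expect_le_one fun u => norm_dualTerm_le h₀ h₁ x u y

/-- The multiplicative difference of `F` along a pair of shifts. -/
def der (a a' : ZMod M) (F : ZMod M → ℂ) (y : ZMod M) : ℂ := F (y + a) * conj (F (y + a'))

theorem norm_der_le {a a' : ZMod M} {F : ZMod M → ℂ} (hF : ∀ y, ‖F y‖ ≤ 1) (y : ZMod M) :
    ‖der a a' F y‖ ≤ 1 := norm_mul_conj_le_one (hF _) (hF _)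

/-- The directional box norm of `F` along three families of shifts. -/
def boxNorm (α : ι → ZMod M) (β : κ → ZMod M) (γ : τ → ZMod M) (F : ZMod M → ℂ) : ℝ :=
  𝔼 i, 𝔼 i', 𝔼 j, 𝔼 j', 𝔼 y,
    ‖𝔼 k, der (α i) (α i') (der (β j) (β j') F) (y + γ k)‖ ^ 2

/-- When one direction is the whole group, the base point `y` is absorbed by translating `a` and
`a'`. The resulting form is the one produced by squaring out the average over `y`. -/
theorem boxNorm_id_eq (α : ι → ZMod M) (β : κ → ZMod M) (F : ZMod M → ℂ) :
    boxNorm id α β F = 𝔼 a : ZMod M, 𝔼 a' : ZMod M, 𝔼 i, 𝔼 i',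
      ‖𝔼 j, F (a + α i + β j) * conj (F (a' + α i + β j)) *
        conj (F (a + α i' + β j) * conj (F (a' + α i' + β j)))‖ ^ 2 := by
  have h1 : boxNorm id α β F = 𝔼 y : ZMod M, 𝔼 a : ZMod M, 𝔼 a' : ZMod M, 𝔼 i, 𝔼 i',
      ‖𝔼 j, der a a' (der (α i) (α i') F) (y + β j)‖ ^ 2 := by
    unfold boxNorm
    simp_rw [id]
    calc _ = 𝔼 a : ZMod M, 𝔼 a' : ZMod M, 𝔼 i, 𝔼 y : ZMod M, 𝔼 i',
          ‖𝔼 j, der a a' (der (α i) (α i') F) (y + β j)‖ ^ 2 :=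
          Finset.expect_congr rfl fun _ _ => Finset.expect_congr rfl fun _ _ =>
            Finset.expect_congr rfl fun _ _ => Finset.expect_comm _ _ _
      _ = 𝔼 a : ZMod M, 𝔼 a' : ZMod M, 𝔼 y : ZMod M, 𝔼 i, 𝔼 i',
          ‖𝔼 j, der a a' (der (α i) (α i') F) (y + β j)‖ ^ 2 :=
          Finset.expect_congr rfl fun _ _ => Finset.expect_congr rfl fun _ _ =>
            Finset.expect_comm _ _ _
      _ = 𝔼 a : ZMod M, 𝔼 y : ZMod M, 𝔼 a' : ZMod M, 𝔼 i, 𝔼 i',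
          ‖𝔼 j, der a a' (der (α i) (α i') F) (y + β j)‖ ^ 2 :=
          Finset.expect_congr rfl fun _ _ => Finset.expect_comm _ _ _
      _ = _ := Finset.expect_comm _ _ _
  rw [h1]
  have h2 : ∀ y : ZMod M, 𝔼 a : ZMod M, 𝔼 a' : ZMod M, 𝔼 i, 𝔼 i',
      ‖𝔼 j, der a a' (der (α i) (α i') F) (y + β j)‖ ^ 2 =
      𝔼 a : ZMod M, 𝔼 a' : ZMod M, 𝔼 i, 𝔼 i',
      ‖𝔼 j, F (a + α i + β j) * conj (F (a' + α i + β j)) *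
        conj (F (a + α i' + β j) * conj (F (a' + α i' + β j)))‖ ^ 2 := fun y => by
    rw [← expect_sub_right _ y]
    refine Finset.expect_congr rfl fun a _ => ?_
    rw [← expect_sub_right _ y]
    refine Finset.expect_congr rfl fun a' _ => Finset.expect_congr rfl fun i _ =>
      Finset.expect_congr rfl fun i' _ => ?_
    congr 2
    refine Finset.expect_congr rfl fun j _ => ?_
    have e1 : ∀ (b : ZMod M) (i : ι), y + β j + (b - y) + α i = b + α i + β j :=
      fun b i => by ring
    simp only [der, e1, map_mul, Complex.conj_conj]
    ring
  simp_rw [h2]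
  simp

/-- Pigeonholing a weighted sum. -/
theorem exists_le_of_le_weighted_sum {σ : Type*} [Fintype σ] {w A : σ → ℝ} (hw : ∀ i, 0 ≤ w i)
    {W a : ℝ} (hW : ∑ i, w i = W) (hWpos : 0 < W) (h : a ≤ ∑ i, w i * A i) :
    ∃ i, a / W ≤ A i := by
  by_contra hcon
  push Not at hcon
  have hex : ∃ i, 0 < w i := by
    by_contra hno
    push Not at hno
    have : ∑ i, w i ≤ 0 := Finset.sum_nonpos fun i _ => hno i
    linarith
  obtain ⟨i₀, hi₀⟩ := hex
  have : ∑ i, w i * A i < ∑ i, w i * (a / W) :=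
    Finset.sum_lt_sum (fun i _ => mul_le_mul_of_nonneg_left (hcon i).le (hw i))
      ⟨i₀, Finset.mem_univ _, mul_lt_mul_of_pos_left (hcon i₀) hi₀⟩
  rw [← Finset.sum_mul, hW, mul_div_cancel₀ _ hWpos.ne'] at this
  linarith

/-- Replacing a family of shifts by multiples of `p` by a twisted projection. -/
theorem exists_frequency {X : Type*} [Fintype X] [Nonempty τ] {p r : ℕ} (hp : 0 < p) (hr : 0 < r)
    (hM : p * r = M) {γ : τ → ZMod M} (hγ : Function.Injective γ)
    (hγp : ∀ k, ∃ t, γ k = (p : ZMod M) * t) (G : X → ZMod M → ℂ) {η : ℝ}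
    (h : η ≤ 𝔼 q, 𝔼 y, ‖𝔼 k, G q (y + γ k)‖ ^ 2) :
    ∃ ξ : ZMod M, η * Fintype.card τ / r ≤
      𝔼 q, 𝔼 y, ‖proj (p : ZMod M) (fun y => G q y * chi (ξ * y)) y‖ ^ 2 := by
  have hp' : (0 : ℝ) < p := by exact_mod_cast hp
  have hr' : (0 : ℝ) < r := by exact_mod_cast hr
  have hT : (0 : ℝ) < Fintype.card τ := by exact_mod_cast Fintype.card_pos
  have hM' : (M : ℝ) = p * r := by exact_mod_cast hM.symm
  have h1 : η * p ≤ ∑ ξ, ‖𝔼 k, chi (-(ξ * γ k))‖ ^ 2 *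
      𝔼 q, 𝔼 y, ‖proj (p : ZMod M) (fun y => G q y * chi (ξ * y)) y‖ ^ 2 := by
    have := h.trans (expect_mono fun q => expect_normSq_expect_shift_le hp hr hM hγp (G q))
    rw [← Finset.mul_expect, Finset.expect_sum_comm] at this
    simp_rw [← Finset.mul_expect] at this
    rw [le_inv_mul_iff₀ hp'] at this
    linarith
  obtain ⟨ξ, hξ⟩ := exists_le_of_le_weighted_sum (fun ξ => by positivity)
    (sum_normSq_expect_chi hγ) (by rw [hM']; positivity) h1
  refine ⟨ξ, le_trans (le_of_eq ?_) hξ⟩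
  rw [hM']
  field_simp

/-- If the projections `c` correlate with the dual function then their fourfold products have large
average. -/
theorem dual_correlation_le {p : ℕ} [Fact p.Prime] [Nonempty ι] [Nonempty κ] (hp2 : p ≠ 2)
    (hpM : p ∣ M) (hpN : p ≤ N) {f₀ f₁ : Fin N → ZMod M → ℂ} (h₀ : ∀ x y, ‖f₀ x y‖ ≤ 1)
    (h₁ : ∀ x y, ‖f₁ x y‖ ≤ 1) (s : ℤ) {t : ℝ} (ht : 0 ≤ t) (ht1 : t ≤ 1)
    (htp : 9 ≤ t ^ 8 * p) (α : ι → ZMod M) (β : κ → ZMod M)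
    {c : Fin N → ι → κ → ZMod M → ℂ} (hc1 : ∀ x i j y, ‖c x i j y‖ ≤ 1)
    (hc : ∀ x i j y t, c x i j (y + (p : ZMod M) * t) = c x i j y)
    {A : Fin N → ι → ZMod M → ℂ} {B : Fin N → κ → ZMod M → ℂ} (hA : ∀ x i y, ‖A x i y‖ ≤ 1)
    (hB : ∀ x j y, ‖B x j y‖ ≤ 1) {η : ℝ} (hη : 0 ≤ η)
    (h : η ≤ ‖𝔼 x, 𝔼 y, 𝔼 i, 𝔼 j,
      dual s f₀ f₁ x (y + α i + β j) * c x i j y * A x i y * B x j y‖) :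
    η ^ 16 ≤ 4 * (𝔼 i, 𝔼 i', 𝔼 j, 𝔼 j', 𝔼 x, ‖𝔼 y, c x i j y * conj (c x i' j y) *
      conj (c x i j' y * conj (c x i' j' y))‖ + 2 * t) := by
  have hN0 : 0 < N := (Fact.out : p.Prime).pos.trans_le hpN
  have : Nonempty (Fin N) := ⟨⟨0, hN0⟩⟩
  set g : Fin N → Fin N → ZMod M → ι → κ → ℂ := fun x u y i j =>
    dualTerm s f₀ f₁ x u (y + α i + β j) * c x i j y with hg
  have h1 : η ≤ 𝔼 x, 𝔼 u, 𝔼 y, ‖𝔼 i, 𝔼 j, g x u y i j * A x i y * B x j y‖ := by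
    refine h.trans ?_
    have e : 𝔼 x, 𝔼 y, 𝔼 i, 𝔼 j,
        dual s f₀ f₁ x (y + α i + β j) * c x i j y * A x i y * B x j y
        = 𝔼 x, 𝔼 u, 𝔼 y, 𝔼 i, 𝔼 j, g x u y i j * A x i y * B x j y := by
      refine Finset.expect_congr rfl fun x _ => ?_
      conv_rhs => rw [Finset.expect_comm]
      refine Finset.expect_congr rfl fun y _ => ?_
      conv_rhs => rw [Finset.expect_comm]
      refine Finset.expect_congr rfl fun i _ => ?_
      conv_rhs => rw [Finset.expect_comm]
      refine Finset.expect_congr rfl fun j _ => ?_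
      simp only [hg, dual, Finset.expect_mul]
    rw [e]
    exact (norm_expect_le _ _).trans (expect_mono fun x => (norm_expect_le _ _).trans
      (expect_mono fun u => norm_expect_le _ _))
  set Q : ι → ι → κ → κ → ℂ := fun i i' j j' => 𝔼 x, 𝔼 u, 𝔼 y,
    g x u y i j * conj (g x u y i' j) * conj (g x u y i j' * conj (g x u y i' j')) with hQ
  have h2 : η ^ 4 ≤ 𝔼 i, 𝔼 i', 𝔼 j, 𝔼 j', ‖Q i i' j j'‖ := by
    -- For fixed `x, u, y` the weights depend on `i` alone and on `j` alone, so the two-variable box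
    -- inequality removes them.
    have i1 : η ^ 4 ≤ 𝔼 x, 𝔼 u, 𝔼 y, 𝔼 i, 𝔼 i', ‖𝔼 j, g x u y i j * conj (g x u y i' j)‖ ^ 2 := by
      refine (pow_le_expect_pow (fun x => expect_nonneg' fun u => expect_nonneg' fun y =>
        norm_nonneg _) hη h1 4).trans (expect_mono fun x => ?_)
      refine (pow_expect_le (fun u => expect_nonneg' fun y => norm_nonneg _) 4).trans
        (expect_mono fun u => ?_)
      refine (pow_expect_le (fun y => norm_nonneg _) 4).trans (expect_mono fun y => ?_)
      exact box_two (fun i => hA x i y) (fun j => hB x j y) _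
    have e : ((𝔼 x, 𝔼 u, 𝔼 y, 𝔼 i, 𝔼 i', ‖𝔼 j, g x u y i j * conj (g x u y i' j)‖ ^ 2 : ℝ) : ℂ)
        = 𝔼 i, 𝔼 i', 𝔼 j, 𝔼 j', Q i i' j j' := by
      simp_rw [ofReal_expect, normSq_expect_eq, hQ]
      have pull : ∀ {σ : Type _} [Fintype σ] (f : Fin N → Fin N → ZMod M → σ → ℂ),
          𝔼 x, 𝔼 u, 𝔼 y, 𝔼 i, f x u y i = 𝔼 i, 𝔼 x, 𝔼 u, 𝔼 y, f x u y i := fun f => by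
        calc _ = 𝔼 x, 𝔼 u, 𝔼 i, 𝔼 y, f x u y i :=
              Finset.expect_congr rfl fun _ _ => Finset.expect_congr rfl fun _ _ =>
                Finset.expect_comm _ _ _
          _ = 𝔼 x, 𝔼 i, 𝔼 u, 𝔼 y, f x u y i :=
              Finset.expect_congr rfl fun _ _ => Finset.expect_comm _ _ _
          _ = _ := Finset.expect_comm _ _ _
      rw [pull]
      refine Finset.expect_congr rfl fun i _ => ?_
      rw [pull]
      refine Finset.expect_congr rfl fun i' _ => ?_
      have pull' : ∀ (f : Fin N → Fin N → ZMod M → κ → ℂ),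
          𝔼 x, 𝔼 u, 𝔼 y, 𝔼 i, f x u y i = 𝔼 i, 𝔼 x, 𝔼 u, 𝔼 y, f x u y i := fun f => by
        calc _ = 𝔼 x, 𝔼 u, 𝔼 i, 𝔼 y, f x u y i :=
              Finset.expect_congr rfl fun _ _ => Finset.expect_congr rfl fun _ _ =>
                Finset.expect_comm _ _ _
          _ = 𝔼 x, 𝔼 i, 𝔼 u, 𝔼 y, f x u y i :=
              Finset.expect_congr rfl fun _ _ => Finset.expect_comm _ _ _
          _ = _ := Finset.expect_comm _ _ _
      rw [pull']
      refine Finset.expect_congr rfl fun j _ => ?_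
      rw [pull']
    have h0 : 0 ≤ 𝔼 x, 𝔼 u, 𝔼 y, 𝔼 i, 𝔼 i',
        ‖𝔼 j, g x u y i j * conj (g x u y i' j)‖ ^ 2 :=
      expect_nonneg' fun x => expect_nonneg' fun u => expect_nonneg' fun y =>
        expect_nonneg' fun i => expect_nonneg' fun i' => by positivity
    rw [← Real.norm_of_nonneg h0, ← Complex.norm_real, e] at i1
    refine i1.trans ?_
    exact (norm_expect_le _ _).trans (expect_mono fun i => (norm_expect_le _ _).trans
      (expect_mono fun i' => (norm_expect_le _ _).trans (expect_mono fun j =>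
        norm_expect_le _ _)))
  -- Translation in `y` commutes with the configuration, so `Q` is again a counting operator, for
  -- fourfold products of `f₀`, `f₁` and `c`. Its last function is `p`-periodic, so the prime field
  -- bound applies.
  have h3 : ∀ i i' j j', ‖Q i i' j j'‖ ^ 4 ≤ 4 * (𝔼 x, ‖𝔼 y, c x i j y * conj (c x i' j y) *
      conj (c x i j' y * conj (c x i' j' y))‖ + 2 * t) := fun i i' j j' => by
    set quad : (Fin N → ZMod M → ℂ) → Fin N → ZMod M → ℂ := fun f x y =>
      f x (y + α i + β j) * conj (f x (y + α i' + β j)) *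
        conj (f x (y + α i + β j') * conj (f x (y + α i' + β j'))) with hquad
    have hquad1 : ∀ f : Fin N → ZMod M → ℂ, (∀ x y, ‖f x y‖ ≤ 1) → ∀ x y, ‖quad f x y‖ ≤ 1 :=
      fun f hf x y => norm_mul_conj_le_one (norm_mul_conj_le_one (hf _ _) (hf _ _))
        (norm_mul_conj_le_one (hf _ _) (hf _ _))
    have hQe : Q i i' j j' = cnt s (quad f₀) (quad f₁) (fun x y => c x i j y * conj (c x i' j y) *
      conj (c x i j' y * conj (c x i' j' y))) := by
      rw [cnt_eq_expect_dualTerm]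
      refine Finset.expect_congr rfl fun x _ => Finset.expect_congr rfl fun u _ =>
        Finset.expect_congr rfl fun y _ => ?_
      have e1 : ∀ a b : ZMod M, y + a + b - disp M s x u ^ 2 = y - disp M s x u ^ 2 + a + b :=
        fun a b => by ring
      simp only [hg, dualTerm, hquad, e1, map_mul, Complex.conj_conj]
      ring
    rw [hQe]
    refine norm_cnt_periodic_le hp2 hpM hpN (hquad1 _ h₀) (hquad1 _ h₁) (fun x y =>
      norm_mul_conj_le_one (norm_mul_conj_le_one (hc1 _ _ _ _) (hc1 _ _ _ _))
        (norm_mul_conj_le_one (hc1 _ _ _ _) (hc1 _ _ _ _))) (fun x y t => ?_) s ht ht1 htp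
    simp_rw [hc]
  calc η ^ 16 = (η ^ 4) ^ 4 := by ring
    _ ≤ 𝔼 i, 𝔼 i', 𝔼 j, 𝔼 j', ‖Q i i' j j'‖ ^ 4 := by
      refine (pow_le_expect_pow (fun i => expect_nonneg' fun i' => expect_nonneg' fun j =>
        expect_nonneg' fun j' => norm_nonneg _) (by positivity) h2 4).trans
        (expect_mono fun i => ?_)
      refine (pow_expect_le (fun i' => expect_nonneg' fun j =>
        expect_nonneg' fun j' => norm_nonneg _) 4).trans (expect_mono fun i' => ?_)
      refine (pow_expect_le (fun j => expect_nonneg' fun j' => norm_nonneg _) 4).trans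
        (expect_mono fun j => ?_)
      exact pow_expect_le (fun j' => norm_nonneg _) 4
    _ ≤ 𝔼 i, 𝔼 i', 𝔼 j, 𝔼 j', 4 * (𝔼 x, ‖𝔼 y, c x i j y * conj (c x i' j y) *
      conj (c x i j' y * conj (c x i' j' y))‖ + 2 * t) :=
      expect_mono fun i => expect_mono fun i' => expect_mono fun j => expect_mono fun j' =>
        h3 i i' j j'
    _ = _ := by
      simp_rw [← Finset.mul_expect, Finset.expect_add_distrib,
        Finset.expect_const Finset.univ_nonempty]

/-- Passing from correlations with products of one-parameter weights to a box norm. -/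
theorem pow_le_boxNorm_id [Nonempty ι] [Nonempty κ] [Nonempty (Fin N)] (α : ι → ZMod M)
    (β : κ → ZMod M) (F : Fin N → ZMod M → ℂ) {A : Fin N → ι → ZMod M → ℂ}
    {B : Fin N → κ → ZMod M → ℂ} (hA : ∀ x i y, ‖A x i y‖ ≤ 1) (hB : ∀ x j y, ‖B x j y‖ ≤ 1)
    {η : ℝ} (hη : 0 ≤ η)
    (h : η ≤ 𝔼 x, 𝔼 i, 𝔼 j, ‖𝔼 y, F x (y + α i + β j) * A x i y * B x j y‖) :
    η ^ 8 ≤ 𝔼 x, boxNorm id α β (F x) := by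
  have h1 : η ^ 2 ≤ 𝔼 x, 𝔼 i, 𝔼 j, ‖𝔼 y, F x (y + α i + β j) * A x i y * B x j y‖ ^ 2 := by
    refine (pow_le_expect_pow (fun x => expect_nonneg' fun i => expect_nonneg' fun j =>
        norm_nonneg _) hη h 2).trans (expect_mono fun x => ?_)
    refine (pow_expect_le (fun i => expect_nonneg' fun j => norm_nonneg _) 2).trans
      (expect_mono fun i => ?_)
    exact pow_expect_le (fun j => norm_nonneg _) 2
  have h2 : ∀ x, (𝔼 i, 𝔼 j, ‖𝔼 y, F x (y + α i + β j) * A x i y * B x j y‖ ^ 2) ^ 4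
      ≤ boxNorm id α β (F x) := fun x => by
    have e : ((𝔼 i, 𝔼 j, ‖𝔼 y, F x (y + α i + β j) * A x i y * B x j y‖ ^ 2 : ℝ) : ℂ)
        = 𝔼 a, 𝔼 a', 𝔼 i, 𝔼 j, (F x (a + α i + β j) * conj (F x (a' + α i + β j))) *
          (A x i a * conj (A x i a')) * (B x j a * conj (B x j a')) := by
      simp_rw [ofReal_expect, normSq_expect_eq]
      calc _ = 𝔼 i, 𝔼 a, 𝔼 j, 𝔼 a', F x (a + α i + β j) * A x i a * B x j a *
            conj (F x (a' + α i + β j) * A x i a' * B x j a') :=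
            Finset.expect_congr rfl fun _ _ => Finset.expect_comm _ _ _
        _ = 𝔼 a, 𝔼 i, 𝔼 j, 𝔼 a', F x (a + α i + β j) * A x i a * B x j a *
            conj (F x (a' + α i + β j) * A x i a' * B x j a') := Finset.expect_comm _ _ _
        _ = 𝔼 a, 𝔼 i, 𝔼 a', 𝔼 j, F x (a + α i + β j) * A x i a * B x j a *
            conj (F x (a' + α i + β j) * A x i a' * B x j a') :=
            Finset.expect_congr rfl fun _ _ => Finset.expect_congr rfl fun _ _ =>
              Finset.expect_comm _ _ _
        _ = 𝔼 a, 𝔼 a', 𝔼 i, 𝔼 j, F x (a + α i + β j) * A x i a * B x j a *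
            conj (F x (a' + α i + β j) * A x i a' * B x j a') :=
            Finset.expect_congr rfl fun _ _ => Finset.expect_comm _ _ _
        _ = _ := Finset.expect_congr rfl fun _ _ => Finset.expect_congr rfl fun _ _ =>
            Finset.expect_congr rfl fun _ _ => Finset.expect_congr rfl fun _ _ => by
              simp only [map_mul]; ring
    have h0 : 0 ≤ 𝔼 i, 𝔼 j, ‖𝔼 y, F x (y + α i + β j) * A x i y * B x j y‖ ^ 2 :=
      expect_nonneg' fun i => expect_nonneg' fun j => by positivity
    rw [← Real.norm_of_nonneg h0, ← Complex.norm_real, e, boxNorm_id_eq]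
    refine (pow_le_pow_left₀ (norm_nonneg _) (norm_expect_le _ _) 4).trans
      ((pow_expect_le (fun _ => norm_nonneg _) 4).trans (expect_mono fun a => ?_))
    refine (pow_le_pow_left₀ (norm_nonneg _) (norm_expect_le _ _) 4).trans
      ((pow_expect_le (fun _ => norm_nonneg _) 4).trans (expect_mono fun a' => ?_))
    exact box_two (fun i => norm_mul_conj_le_one (hA _ _ _) (hA _ _ _))
      (fun j => norm_mul_conj_le_one (hB _ _ _) (hB _ _ _)) _
  calc η ^ 8 = (η ^ 2) ^ 4 := by ring
    _ ≤ _ := (pow_le_expect_pow (fun x => expect_nonneg' fun i => expect_nonneg' fun j => by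
        positivity) (by positivity) h1 4).trans (expect_mono h2)

/-- Degree lowering: a box norm of a dual function along multiples of `p` is controlled by one in
which the last family of shifts is replaced by all of `ℤ/Mℤ`. -/
theorem boxNorm_lowering {p r : ℕ} [Fact p.Prime] [Nonempty ι] [Nonempty κ] [Nonempty τ]
    (hp2 : p ≠ 2) (hr : 0 < r) (hM : p * r = M) (hpN : p ≤ N) {f₀ f₁ : Fin N → ZMod M → ℂ}
    (h₀ : ∀ x y, ‖f₀ x y‖ ≤ 1) (h₁ : ∀ x y, ‖f₁ x y‖ ≤ 1) (s : ℤ) (α : ι → ZMod M)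
    (β : κ → ZMod M) {γ : τ → ZMod M} (hγ : Function.Injective γ)
    (hγp : ∀ k, ∃ t, γ k = (p : ZMod M) * t) {η : ℝ}
    (h : η ≤ 𝔼 x, boxNorm α β γ (dual s f₀ f₁ x)) {ω t : ℝ} (hω : 0 ≤ ω)
    (hω' : ω ≤ η * Fintype.card τ / r) (ht : 0 ≤ t) (ht1 : t ≤ 1) (htp : 9 ≤ t ^ 8 * p)
    (htω : 16 * t ≤ ω ^ 16) :
    (ω ^ 16 / 8) ^ 8 ≤ 𝔼 x, boxNorm id α β (dual s f₀ f₁ x) := by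
  have hp0 : 0 < p := (Fact.out : p.Prime).pos
  have hN0 : 0 < N := hp0.trans_le hpN
  have hne : Nonempty (Fin N) := ⟨⟨0, hN0⟩⟩
  have hpM : p ∣ M := ⟨r, hM.symm⟩
  set F := dual s f₀ f₁ with hF
  have hF1 : ∀ x y, ‖F x y‖ ≤ 1 := norm_dual_le h₀ h₁
  -- fixing the second copy of the first two parameters
  obtain ⟨i₀, j₀, hij⟩ : ∃ i₀ j₀, η ≤ 𝔼 q : Fin N × ι × κ, 𝔼 y,
      ‖𝔼 k, der (α q.2.1) (α i₀) (der (β q.2.2) (β j₀) (F q.1)) (y + γ k)‖ ^ 2 := by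
    set G : Fin N → ι → ι → κ → κ → ℝ := fun x i i' j j' => 𝔼 y,
      ‖𝔼 k, der (α i) (α i') (der (β j) (β j') (F x)) (y + γ k)‖ ^ 2
    have e : 𝔼 x, boxNorm α β γ (F x) = 𝔼 i', 𝔼 j', 𝔼 x, 𝔼 i, 𝔼 j, G x i i' j j' := by
      calc _ = 𝔼 x, 𝔼 i, 𝔼 i', 𝔼 j, 𝔼 j', G x i i' j j' := rfl
        _ = 𝔼 x, 𝔼 i', 𝔼 i, 𝔼 j, 𝔼 j', G x i i' j j' :=
            Finset.expect_congr rfl fun _ _ => Finset.expect_comm _ _ _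
        _ = 𝔼 i', 𝔼 x, 𝔼 i, 𝔼 j, 𝔼 j', G x i i' j j' := Finset.expect_comm _ _ _
        _ = 𝔼 i', 𝔼 x, 𝔼 i, 𝔼 j', 𝔼 j, G x i i' j j' :=
            Finset.expect_congr rfl fun _ _ => Finset.expect_congr rfl fun _ _ =>
              Finset.expect_congr rfl fun _ _ => Finset.expect_comm _ _ _
        _ = 𝔼 i', 𝔼 x, 𝔼 j', 𝔼 i, 𝔼 j, G x i i' j j' :=
            Finset.expect_congr rfl fun _ _ => Finset.expect_congr rfl fun _ _ =>
              Finset.expect_comm _ _ _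
        _ = _ := Finset.expect_congr rfl fun _ _ => Finset.expect_comm _ _ _
    rw [e] at h
    obtain ⟨i₀, h⟩ := exists_le_of_le_expect' h
    obtain ⟨j₀, h⟩ := exists_le_of_le_expect' h
    refine ⟨i₀, j₀, h.trans (le_of_eq ?_)⟩
    rw [← Finset.univ_product_univ, Finset.expect_product]
    refine Finset.expect_congr rfl fun x _ => ?_
    rw [← Finset.univ_product_univ, Finset.expect_product]
  -- The frequency is common to all `(x, i, j)`. This matters: the factor `chi (ξ * y)` can then be
  -- absorbed into the weight `A`, which must not depend on `j`.
  obtain ⟨ξ, hξ⟩ := exists_frequency hp0 hr hM hγ hγp _ hij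
  set c : Fin N → ι → κ → ZMod M → ℂ := fun x i j => proj (p : ZMod M)
    (fun y => der (α i) (α i₀) (der (β j) (β j₀) (F x)) y * chi (ξ * y)) with hc
  have hg1 : ∀ x i j y, ‖der (α i) (α i₀) (der (β j) (β j₀) (F x)) y * chi (ξ * y)‖ ≤ 1 :=
    fun x i j y => norm_mul_le_one' (norm_der_le (fun y => norm_der_le (hF1 x) y) y)
      (norm_chi _).le
  have hc1 : ∀ x i j y, ‖c x i j y‖ ≤ 1 := fun x i j y => norm_proj_le_one _ (hg1 x i j) y
  have hcp : ∀ x i j y t, c x i j (y + (p : ZMod M) * t) = c x i j y :=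
    fun x i j y t => proj_periodic _ _ _ _
  set A : Fin N → ι → ZMod M → ℂ := fun x i y =>
    conj (F x (y + α i + β j₀)) * (F x (y + α i₀ + β j₀) * chi (ξ * y)) with hAdef
  set B : Fin N → κ → ZMod M → ℂ := fun x j y => conj (F x (y + α i₀ + β j)) with hBdef
  have hA : ∀ x i y, ‖A x i y‖ ≤ 1 := fun x i y =>
    norm_mul_le_one' (norm_conj_le_one (hF1 _ _)) (norm_mul_le_one' (hF1 _ _) (norm_chi _).le)
  have hB : ∀ x j y, ‖B x j y‖ ≤ 1 := fun x j y => norm_conj_le_one (hF1 _ _)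
  have hfac : ∀ x i j y, der (α i) (α i₀) (der (β j) (β j₀) (F x)) y * chi (ξ * y)
      = F x (y + α i + β j) * A x i y * B x j y := fun x i j y => by
    simp only [der, hAdef, hBdef, map_mul, Complex.conj_conj]; ring
  -- The energy of `c` equals its correlation with the unprojected function, in which `F x (y + α i
  -- + β j)` is the only factor depending on both `i` and `j`.
  have h1 : ω ≤ ‖𝔼 x, 𝔼 y, 𝔼 i, 𝔼 j,
      F x (y + α i + β j) * conj (c x i j y) * A x i y * B x j y‖ := by
    refine hω'.trans (hξ.trans ?_)
    have e : ((𝔼 q : Fin N × ι × κ, 𝔼 y, ‖c q.1 q.2.1 q.2.2 y‖ ^ 2 : ℝ) : ℂ) =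
        𝔼 x, 𝔼 y, 𝔼 i, 𝔼 j, F x (y + α i + β j) * conj (c x i j y) * A x i y * B x j y := by
      have e1 : ∀ x i j, ((𝔼 y, ‖c x i j y‖ ^ 2 : ℝ) : ℂ)
          = 𝔼 y, F x (y + α i + β j) * conj (c x i j y) * A x i y * B x j y := fun x i j => by
        simp_rw [ofReal_expect, normSq_eq]
        have := expect_proj_mul (p : ZMod M)
          (fun y => der (α i) (α i₀) (der (β j) (β j₀) (F x)) y * chi (ξ * y))
          (v := fun y => conj (c x i j y)) (fun y s => by simp_rw [hcp])
        rw [show 𝔼 y, c x i j y * conj (c x i j y) = 𝔼 y, proj (p : ZMod M)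
          (fun y => der (α i) (α i₀) (der (β j) (β j₀) (F x)) y * chi (ξ * y)) y *
            conj (c x i j y) from rfl, this]
        refine Finset.expect_congr rfl fun y _ => ?_
        rw [hfac]; ring
      rw [ofReal_expect]
      simp_rw [e1]
      rw [← Finset.univ_product_univ, Finset.expect_product]
      refine Finset.expect_congr rfl fun x _ => ?_
      rw [← Finset.univ_product_univ, Finset.expect_product]
      conv_rhs => rw [Finset.expect_comm]
      refine Finset.expect_congr rfl fun i _ => ?_
      rw [Finset.expect_comm]
    rw [← e, Complex.norm_real]
    exact Real.le_norm_self _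
  have h2 := dual_correlation_le hp2 hpM hpN h₀ h₁ s ht ht1 htp α β
    (c := fun x i j y => conj (c x i j y)) (fun x i j y => norm_conj_le_one (hc1 _ _ _ _))
    (fun x i j y t => by simp_rw [hcp]) hA hB hω h1
  -- fixing the second copy of the parameters again
  obtain ⟨i₁, j₁, h3⟩ : ∃ i₁ j₁, ω ^ 16 / 8 ≤ 𝔼 x, 𝔼 i, 𝔼 j,
      ‖𝔼 y, c x i j y * (conj (c x i j₁ y) * c x i₁ j₁ y * conj (c x i₁ j y))‖ := by
    set W : Fin N → ι → ι → κ → κ → ℝ := fun x i i' j j' =>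
      ‖𝔼 y, c x i j y * (conj (c x i j' y) * c x i' j' y * conj (c x i' j y))‖ with hW
    have e : ∀ i i' j j' x, ‖𝔼 y, conj (c x i j y) * conj (conj (c x i' j y)) *
      conj (conj (c x i j' y) * conj (conj (c x i' j' y)))‖ = W x i i' j j' :=
      fun i i' j j' x => by
        rw [← RCLike.norm_conj, conj_expect]
        simp only [hW, map_mul, Complex.conj_conj]
        congr 1
        exact Finset.expect_congr rfl fun y _ => by ring
    simp_rw [e] at h2
    have h2' : ω ^ 16 / 8 ≤ 𝔼 i, 𝔼 i', 𝔼 j, 𝔼 j', 𝔼 x, W x i i' j j' := by linarith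
    have e2 : 𝔼 i, 𝔼 i', 𝔼 j, 𝔼 j', 𝔼 x, W x i i' j j'
        = 𝔼 i', 𝔼 j', 𝔼 x, 𝔼 i, 𝔼 j, W x i i' j j' := by
      calc _ = 𝔼 i', 𝔼 i, 𝔼 j, 𝔼 j', 𝔼 x, W x i i' j j' := Finset.expect_comm _ _ _
        _ = 𝔼 i', 𝔼 i, 𝔼 j', 𝔼 j, 𝔼 x, W x i i' j j' :=
            Finset.expect_congr rfl fun _ _ => Finset.expect_congr rfl fun _ _ =>
              Finset.expect_comm _ _ _
        _ = 𝔼 i', 𝔼 j', 𝔼 i, 𝔼 j, 𝔼 x, W x i i' j j' :=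
            Finset.expect_congr rfl fun _ _ => Finset.expect_comm _ _ _
        _ = 𝔼 i', 𝔼 j', 𝔼 i, 𝔼 x, 𝔼 j, W x i i' j j' :=
            Finset.expect_congr rfl fun _ _ => Finset.expect_congr rfl fun _ _ =>
              Finset.expect_congr rfl fun _ _ => Finset.expect_comm _ _ _
        _ = _ := Finset.expect_congr rfl fun _ _ => Finset.expect_congr rfl fun _ _ =>
              Finset.expect_comm _ _ _
    rw [e2] at h2'
    obtain ⟨i₁, h2'⟩ := exists_le_of_le_expect' h2'
    obtain ⟨j₁, h2'⟩ := exists_le_of_le_expect' h2'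
    exact ⟨i₁, j₁, h2'⟩
  -- The other three copies of `c` are `p`-periodic, so the first may be replaced by the function it
  -- is the projection of. After `i₁, j₁` are fixed, the copies depend on `(i, y)` or on `(j, y)`
  -- only and join the weights `A` and `B`.
  have e3 : ∀ x i j, 𝔼 y, c x i j y * (conj (c x i j₁ y) * c x i₁ j₁ y * conj (c x i₁ j y))
      = 𝔼 y, F x (y + α i + β j) * (A x i y * (conj (c x i j₁ y) * c x i₁ j₁ y)) *
        (B x j y * conj (c x i₁ j y)) := fun x i j => by
    have := expect_proj_mul (p : ZMod M)
      (fun y => der (α i) (α i₀) (der (β j) (β j₀) (F x)) y * chi (ξ * y))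
      (v := fun y => conj (c x i j₁ y) * c x i₁ j₁ y * conj (c x i₁ j y))
      (fun y s => by simp_rw [hcp])
    refine this.trans (Finset.expect_congr rfl fun y _ => ?_)
    rw [hfac]; ring
  simp_rw [e3] at h3
  exact pow_le_boxNorm_id α β F
    (A := fun x i y => A x i y * (conj (c x i j₁ y) * c x i₁ j₁ y))
    (B := fun x j y => B x j y * conj (c x i₁ j y))
    (fun x i y => norm_mul_le_one' (hA _ _ _) (norm_mul_le_one' (norm_conj_le_one (hc1 _ _ _ _))
      (hc1 _ _ _ _)))
    (fun x j y => norm_mul_le_one' (hB _ _ _) (norm_conj_le_one (hc1 _ _ _ _))) (by positivity) h3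

end Lowering

/-! ### Van der Corput's inequality with restricted shifts -/

section Differencing

theorem sum_fin_eq_sum_Ico {E : Type*} [AddCommMonoid E] (N : ℕ) (φ : ℤ → E) :
    ∑ x : Fin N, φ (x : ℕ) = ∑ n ∈ Finset.Ico (0 : ℤ) N, φ n := by
  rw [Fin.sum_univ_eq_sum_range (fun k : ℕ => φ (k : ℤ))]
  refine Finset.sum_bij' (fun k _ => (k : ℤ)) (fun n _ => n.toNat) ?_ ?_ ?_ ?_ ?_
  · intro k hk; simp at hk ⊢; exact hk
  · intro n hn; simp at hn ⊢; omega
  · intro k _; simp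
  · intro n hn; simp at hn ⊢; omega
  · intro k _; rfl

theorem sum_Ico_add {E : Type*} [AddCommMonoid E] (φ : ℤ → E) (A B t : ℤ) :
    ∑ u ∈ Finset.Ico A B, φ (u + t) = ∑ u ∈ Finset.Ico (A + t) (B + t), φ u := by
  rw [← Finset.map_add_right_Ico, Finset.sum_map]
  rfl

theorem norm_sum_shift_sub_le {φ : ℤ → ℂ} (hφ : ∀ u, ‖φ u‖ ≤ 1) (A B : ℤ) {t : ℤ} (ht : 0 ≤ t) :
    ‖∑ u ∈ Finset.Ico A B, φ u - ∑ u ∈ Finset.Ico A B, φ (u + t)‖ ≤ 2 * t := by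
  rw [sum_Ico_add, ← Finset.sum_sdiff_sub_sum_sdiff]
  have h : ∀ C D E F : ℤ, Finset.Ico C D \ Finset.Ico E F ⊆ Finset.Ico A (A + t) ∨
      Finset.Ico C D \ Finset.Ico E F ⊆ Finset.Ico B (B + t) →
      ‖∑ u ∈ Finset.Ico C D \ Finset.Ico E F, φ u‖ ≤ t := fun C D E F h => by
    have hc : (Finset.Ico C D \ Finset.Ico E F).card ≤ t.toNat := by
      rcases h with h | h <;> refine (Finset.card_le_card h).trans ?_ <;> simp
    refine (norm_sum_le _ _).trans ((Finset.sum_le_card_nsmul _ _ 1 fun u _ => hφ u).trans ?_)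
    rw [nsmul_eq_mul, mul_one]
    have : (((Finset.Ico C D \ Finset.Ico E F).card : ℤ) : ℝ) ≤ t := by
      exact_mod_cast (by omega : ((Finset.Ico C D \ Finset.Ico E F).card : ℤ) ≤ t)
    simpa using this
  refine (norm_sub_le _ _).trans ?_
  have h1 := h A B (A + t) (B + t) (Or.inl fun u hu => by
    simp only [Finset.mem_sdiff, Finset.mem_Ico] at hu ⊢; omega)
  have h2 := h (A + t) (B + t) A B (Or.inr fun u hu => by
    simp only [Finset.mem_sdiff, Finset.mem_Ico] at hu ⊢; omega)
  linarith

/-- For each `j` at most one `j'` has the prescribed difference, so a forbidden shift carries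
proportion at most `1 / J`. -/
theorem card_pairs_le {J : ℕ} (e : ℤ) :
    𝔼 j : Fin J, 𝔼 j' : Fin J, (if ((j' : ℕ) : ℤ) - (j : ℕ) = e then (1 : ℝ) else 0) ≤ 1 / J := by
  rcases Nat.eq_zero_or_pos J with rfl | hJ
  · simp
  have : Nonempty (Fin J) := ⟨⟨0, hJ⟩⟩
  refine expect_le_of_forall fun j => ?_
  rw [Fintype.expect_eq_sum_div_card, Fintype.card_fin]
  gcongr
  rw [Finset.sum_boole]
  have : (Finset.univ.filter fun j' : Fin J => ((j' : ℕ) : ℤ) - (j : ℕ) = e).card ≤ 1 :=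
    Finset.card_le_one.mpr fun a ha b hb => by
      simp only [Finset.mem_filter, Finset.mem_univ, true_and] at ha hb
      ext; omega
  exact_mod_cast this

/-- The van der Corput inequality with shifts restricted to multiples of `D`, avoiding the shifts
`0` and `D e₀`. -/
theorem exists_correlation {Z : Type*} [Fintype Z] [Nonempty Z] {N D J : ℕ} (hN : 0 < N)
    (hDJ : D * J ≤ N) {g : Z → ℤ → ℂ} (hg : ∀ z n, ‖g z n‖ ≤ 1)
    (hg0 : ∀ z n, n ∉ Finset.Ico (0 : ℤ) N → g z n = 0) (e₀ : ℤ) {η : ℝ} (hη : 0 < η)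
    (hJ : 8 ≤ η * J) (h : η * N ^ 2 ≤ 𝔼 z, ‖∑ n ∈ Finset.Ico (0 : ℤ) N, g z n‖ ^ 2) :
    ∃ e : ℤ, e ≠ 0 ∧ e ≠ e₀ ∧ |e| < J ∧
      η * N / 8 ≤ ‖𝔼 z, ∑ n ∈ Finset.Ico (0 : ℤ) N, g z n * conj (g z (n + D * e))‖ := by
  have hN' : (0 : ℝ) < N := by exact_mod_cast hN
  have hJ0 : 0 < J := by
    rcases Nat.eq_zero_or_pos J with rfl | h
    · norm_num at hJ
    · exact h
  have hJ' : (0 : ℝ) < J := by exact_mod_cast hJ0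
  have : Nonempty (Fin J) := ⟨⟨0, hJ0⟩⟩
  set Cor : ℤ → ℂ := fun e => 𝔼 z, ∑ n ∈ Finset.Ico (0 : ℤ) N, g z n * conj (g z (n + D * e))
    with hCor
  -- This window contains every translate of the support by a shift `-D j`, `j < J`. Its size is at
  -- most `2 N` because `D J ≤ N`.
  set W : Finset ℤ := Finset.Ico (-(D * J : ℤ)) N with hW
  have hWc : (W.card : ℝ) ≤ 2 * N := by
    have : W.card ≤ 2 * N := by
      simp only [hW, Int.card_Ico]
      have : (D * J : ℤ) ≤ N := by exact_mod_cast hDJ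
      omega
    exact_mod_cast this
  have hDle : ∀ j : Fin J, (0 : ℤ) ≤ D * (j : ℕ) ∧ (D * (j : ℕ) : ℤ) ≤ D * J := fun j => by
    refine ⟨by positivity, ?_⟩
    have : D * (j : ℕ) ≤ D * J := Nat.mul_le_mul_left _ j.2.le
    exact_mod_cast this
  have shift : ∀ (f : ℤ → ℂ), (∀ n, n ∉ Finset.Ico (0 : ℤ) N → f n = 0) → ∀ j : Fin J,
      ∑ x ∈ W, f (x + D * (j : ℕ)) = ∑ n ∈ Finset.Ico (0 : ℤ) N, f n := fun f hf j => by
    rw [hW, sum_Ico_add]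
    symm
    refine Finset.sum_subset ?_ fun n _ hn => hf n hn
    intro n hn
    have := hDle j
    simp only [Finset.mem_Ico] at hn ⊢
    omega
  have h1 : ∀ z, ‖∑ n ∈ Finset.Ico (0 : ℤ) N, g z n‖ ^ 2
      ≤ 2 * N * ∑ x ∈ W, ‖𝔼 j : Fin J, g z (x + D * (j : ℕ))‖ ^ 2 := fun z => by
    have e1 : ∑ n ∈ Finset.Ico (0 : ℤ) N, g z n = ∑ x ∈ W, 𝔼 j : Fin J, g z (x + D * (j : ℕ)) := by
      rw [← Finset.expect_sum_comm]
      simp_rw [shift (g z) (hg0 z)]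
      simp
    rw [e1]
    refine (pow_le_pow_left₀ (norm_nonneg _) (norm_sum_le _ _) 2).trans ?_
    refine (sq_sum_le_card_mul_sum_sq (s := W)).trans ?_
    exact mul_le_mul_of_nonneg_right hWc (Finset.sum_nonneg fun _ _ => by positivity)
  have h2 : 𝔼 z, ∑ x ∈ W, ‖𝔼 j : Fin J, g z (x + D * (j : ℕ))‖ ^ 2
      ≤ 𝔼 j : Fin J, 𝔼 j' : Fin J, ‖Cor (((j' : ℕ) : ℤ) - (j : ℕ))‖ := by
    have e1 : ((𝔼 z, ∑ x ∈ W, ‖𝔼 j : Fin J, g z (x + D * (j : ℕ))‖ ^ 2 : ℝ) : ℂ)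
        = 𝔼 j : Fin J, 𝔼 j' : Fin J, Cor (((j' : ℕ) : ℤ) - (j : ℕ)) := by
      rw [ofReal_expect]
      simp_rw [Complex.ofReal_sum, normSq_expect_eq, ← Finset.expect_sum_comm]
      rw [Finset.expect_comm]
      refine Finset.expect_congr rfl fun j _ => ?_
      rw [Finset.expect_comm]
      refine Finset.expect_congr rfl fun j' _ => ?_
      refine Finset.expect_congr rfl fun z _ => ?_
      rw [← shift (fun n => g z n * conj (g z (n + D * (((j' : ℕ) : ℤ) - (j : ℕ)))))
        (fun n hn => by rw [hg0 z n hn, zero_mul]) j]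
      refine Finset.sum_congr rfl fun x _ => ?_
      congr 3; ring
    have h0 : 0 ≤ 𝔼 z, ∑ x ∈ W, ‖𝔼 j : Fin J, g z (x + D * (j : ℕ))‖ ^ 2 :=
      expect_nonneg' fun z => Finset.sum_nonneg fun _ _ => by positivity
    rw [← Real.norm_of_nonneg h0, ← Complex.norm_real, e1]
    exact (norm_expect_le _ _).trans (expect_mono fun j => norm_expect_le _ _)
  have hCorN : ∀ e, ‖Cor e‖ ≤ N := fun e => by
    refine (norm_expect_le _ _).trans (expect_le_of_forall fun z => (norm_sum_le _ _).trans ?_)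
    refine (Finset.sum_le_card_nsmul _ _ 1 fun n _ =>
      norm_mul_conj_le_one (hg _ _) (hg _ _)).trans ?_
    simp
  by_contra hcon
  push Not at hcon
  have h3 : ∀ j j' : Fin J, ‖Cor (((j' : ℕ) : ℤ) - (j : ℕ))‖ ≤ N *
      (if ((j' : ℕ) : ℤ) - (j : ℕ) = 0 then 1 else 0) +
      N * (if ((j' : ℕ) : ℤ) - (j : ℕ) = e₀ then 1 else 0) + η * N / 8 := fun j j' => by
    have hpos : 0 ≤ η * N / 8 := by positivity
    by_cases ha : ((j' : ℕ) : ℤ) - (j : ℕ) = 0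
    · rw [if_pos ha]
      have := hCorN (((j' : ℕ) : ℤ) - (j : ℕ))
      split_ifs <;> linarith
    · by_cases hb : ((j' : ℕ) : ℤ) - (j : ℕ) = e₀
      · rw [if_pos hb]
        have := hCorN (((j' : ℕ) : ℤ) - (j : ℕ))
        split_ifs <;> linarith
      · rw [if_neg ha, if_neg hb]
        have := hcon _ ha hb (by rw [abs_lt]; have := j.2; have := j'.2; constructor <;> omega)
        simp only [hCor]
        linarith
  have h4 : 𝔼 j : Fin J, 𝔼 j' : Fin J, ‖Cor (((j' : ℕ) : ℤ) - (j : ℕ))‖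
      ≤ N * (1 / J) + N * (1 / J) + η * N / 8 := by
    refine (expect_mono fun j => expect_mono fun j' => h3 j j').trans ?_
    simp_rw [Finset.expect_add_distrib, ← Finset.mul_expect,
      Finset.expect_const Finset.univ_nonempty]
    have := card_pairs_le (J := J) 0
    have := card_pairs_le (J := J) e₀
    gcongr
  -- Each of the two forbidden shifts costs `N / J ≤ η N / 8`, so the right side is at most `(3 / 4)
  -- η N²`, a contradiction.
  have h5 : η * N ^ 2 ≤ 2 * N * (N * (1 / J) + N * (1 / J) + η * N / 8) := by
    refine h.trans ((expect_mono h1).trans ?_)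
    rw [← Finset.mul_expect]
    exact mul_le_mul_of_nonneg_left (h2.trans h4) (by positivity)
  have h6 : (1 : ℝ) / J ≤ η / 8 := by
    rw [div_le_div_iff₀ hJ' (by norm_num)]; linarith
  have h7 : N * (1 / (J : ℝ)) ≤ N * (η / 8) := mul_le_mul_of_nonneg_left h6 hN'.le
  have h8 : 0 < η * N ^ 2 := by positivity
  have h9 : 2 * N * (N * (1 / (J : ℝ)) + N * (1 / J) + η * N / 8) ≤ 2 * N * (3 * (η * N / 8)) :=
    mul_le_mul_of_nonneg_left (by linarith) (by positivity)
  nlinarith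

end Differencing

/-! ### Linearising the squares: from the count to a box norm -/

section PET

variable {M : ℕ} [NeZero M] {N : ℕ}

/-- The arithmetic progression of shifts with difference `-a`. -/
def prog (T : ℕ) (a : ZMod M) (t : Fin T) : ZMod M := -(a * ((t : ℕ) : ZMod M))

/-- Replace `u` by `u + i + j + k` with `i, j, k < T`, and `y` by `y - s₁ i - s₂ j - s₃ k`. Then the
argument of `h₁` no longer involves `i`, that of `h₂` no longer involves `j`, and that of `h₃` no
longer involves `k`, so `box_three` eliminates all three and leaves the box norm of `F`. -/
theorem pow_le_boxNorm_linear {X : Type*} [Fintype X] [Nonempty X] (hN : 0 < N) {T : ℕ}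
    (hT : 0 < T) {F h₁ h₂ h₃ : X → ZMod M → ℂ} (hF : ∀ x y, ‖F x y‖ ≤ 1)
    (hh₁ : ∀ x y, ‖h₁ x y‖ ≤ 1) (hh₂ : ∀ x y, ‖h₂ x y‖ ≤ 1) (hh₃ : ∀ x y, ‖h₃ x y‖ ≤ 1)
    (s₁ s₂ s₃ : ZMod M) (c : X → ZMod M) {A B : ℤ} (hA : 0 ≤ A) (hB : B ≤ N) {ρ : ℝ} (hρ : 0 ≤ ρ)
    (hTρ : 12 * T ≤ ρ * N)
    (h : ρ * N ≤ ‖𝔼 x, 𝔼 y, ∑ u ∈ Finset.Ico A B, F x y * h₁ x (y + s₁ * (u + c x)) *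
      h₂ x (y + s₂ * (u + c x)) * h₃ x (y + s₃ * (u + c x))‖) :
    (ρ / 2) ^ 8 ≤ 𝔼 x, boxNorm (prog T s₁) (prog T s₂) (prog T s₃) (F x) := by
  have hN' : (0 : ℝ) < N := by exact_mod_cast hN
  have : Nonempty (Fin T) := ⟨⟨0, hT⟩⟩
  have : Nonempty (Fin N) := ⟨⟨0, hN⟩⟩
  set φ : X → ZMod M → ℤ → ℂ := fun x y u => F x y * h₁ x (y + s₁ * (u + c x)) *
      h₂ x (y + s₂ * (u + c x)) * h₃ x (y + s₃ * (u + c x)) with hφ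
  have hφ1 : ∀ x y u, ‖φ x y u‖ ≤ 1 := fun x y u => norm_mul_le_one' (norm_mul_le_one'
    (norm_mul_le_one' (hF _ _) (hh₁ _ _)) (hh₂ _ _)) (hh₃ _ _)
  set S : Fin T → Fin T → Fin T → ℤ := fun i j k => ((i : ℕ) + (j : ℕ) + (k : ℕ) : ℕ) with hS
  have hS0 : ∀ i j k, 0 ≤ S i j k := fun i j k => by positivity
  have hST : ∀ i j k, (S i j k : ℝ) ≤ 3 * T := fun i j k => by
    have : S i j k ≤ 3 * T := by
      simp only [hS]; have := i.2; have := j.2; have := k.2; push_cast; omega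
    exact_mod_cast this
  -- averaging over short shifts
  have h2 : ρ * N / 2 ≤
      ‖𝔼 x, 𝔼 y, ∑ u ∈ Finset.Ico A B, 𝔼 i, 𝔼 j, 𝔼 k, φ x y (u + S i j k)‖ := by
    -- A shift by less than `3 T` changes a sum over an interval by at most `6 T`, which is at most
    -- half of `ρ N`.
    have hd : ‖𝔼 x, 𝔼 y, ∑ u ∈ Finset.Ico A B, φ x y u -
        𝔼 x, 𝔼 y, ∑ u ∈ Finset.Ico A B, 𝔼 i, 𝔼 j, 𝔼 k, φ x y (u + S i j k)‖ ≤ 6 * T := by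
      rw [← Finset.expect_sub_distrib]
      simp_rw [← Finset.expect_sub_distrib]
      refine (norm_expect_le _ _).trans (expect_le_of_forall fun x =>
        (norm_expect_le _ _).trans (expect_le_of_forall fun y => ?_))
      have e : ∑ u ∈ Finset.Ico A B, φ x y u -
          ∑ u ∈ Finset.Ico A B, 𝔼 i, 𝔼 j, 𝔼 k, φ x y (u + S i j k)
          = 𝔼 i, 𝔼 j, 𝔼 k, (∑ u ∈ Finset.Ico A B, φ x y u -
            ∑ u ∈ Finset.Ico A B, φ x y (u + S i j k)) := by
        simp_rw [Finset.expect_sub_distrib, Finset.expect_const Finset.univ_nonempty,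
          Finset.expect_sum_comm]
      rw [e]
      refine (norm_expect_le _ _).trans (expect_le_of_forall fun i =>
        (norm_expect_le _ _).trans (expect_le_of_forall fun j =>
        (norm_expect_le _ _).trans (expect_le_of_forall fun k => ?_)))
      have := norm_sum_shift_sub_le (hφ1 x y) A B (hS0 i j k)
      have := hST i j k
      linarith
    have := norm_sub_norm_le (𝔼 x, 𝔼 y, ∑ u ∈ Finset.Ico A B, φ x y u)
      (𝔼 x, 𝔼 y, ∑ u ∈ Finset.Ico A B, 𝔼 i, 𝔼 j, 𝔼 k, φ x y (u + S i j k))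
    linarith
  set ψ : X → ℤ → ZMod M → Fin T → Fin T → Fin T → ℂ := fun x u y i j k =>
    F x (y + -(s₁ * (i : ℕ)) + -(s₂ * (j : ℕ)) + -(s₃ * (k : ℕ))) *
      h₁ x (y + s₁ * (u + c x) + (s₁ - s₂) * (j : ℕ) + (s₁ - s₃) * (k : ℕ)) *
      h₂ x (y + s₂ * (u + c x) + (s₂ - s₁) * (i : ℕ) + (s₂ - s₃) * (k : ℕ)) *
      h₃ x (y + s₃ * (u + c x) + (s₃ - s₁) * (i : ℕ) + (s₃ - s₂) * (j : ℕ)) with hψ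
  have h3 : ρ / 2 ≤ 𝔼 x, 𝔼 u : Fin N, 𝔼 y, ‖𝔼 i, 𝔼 j, 𝔼 k, ψ x (u : ℕ) y i j k‖ := by
    have e : ∀ x, 𝔼 y, ∑ u ∈ Finset.Ico A B, 𝔼 i, 𝔼 j, 𝔼 k, φ x y (u + S i j k)
        = ∑ u ∈ Finset.Ico A B, 𝔼 y, 𝔼 i, 𝔼 j, 𝔼 k, ψ x u y i j k := fun x => by
      rw [Finset.expect_sum_comm]
      refine Finset.sum_congr rfl fun u _ => ?_
      have pull : ∀ f : ZMod M → Fin T → Fin T → Fin T → ℂ, 𝔼 y, 𝔼 i, 𝔼 j, 𝔼 k, f y i j k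
          = 𝔼 i, 𝔼 j, 𝔼 k, 𝔼 y, f y i j k := fun f => by
        calc _ = 𝔼 i, 𝔼 y, 𝔼 j, 𝔼 k, f y i j k := Finset.expect_comm _ _ _
          _ = 𝔼 i, 𝔼 j, 𝔼 y, 𝔼 k, f y i j k :=
              Finset.expect_congr rfl fun _ _ => Finset.expect_comm _ _ _
          _ = _ := Finset.expect_congr rfl fun _ _ => Finset.expect_congr rfl fun _ _ =>
              Finset.expect_comm _ _ _
      rw [pull, pull]
      refine Finset.expect_congr rfl fun i _ => Finset.expect_congr rfl fun j _ =>
        Finset.expect_congr rfl fun k _ => ?_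
      rw [← expect_sub_right _ (s₁ * ((i : ℕ) : ZMod M) + s₂ * ((j : ℕ) : ZMod M) +
        s₃ * ((k : ℕ) : ZMod M))]
      refine Finset.expect_congr rfl fun y _ => ?_
      simp only [hφ, hψ, hS]
      push_cast
      refine congrArg₂ (· * ·) (congrArg₂ (· * ·) (congrArg₂ (· * ·) (congrArg _ ?_)
        (congrArg _ ?_)) (congrArg _ ?_)) (congrArg _ ?_) <;> ring
    simp_rw [e] at h2
    have h4 : ρ * N / 2 ≤ 𝔼 x, ∑ u ∈ Finset.Ico (0 : ℤ) N, 𝔼 y,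
        ‖𝔼 i, 𝔼 j, 𝔼 k, ψ x u y i j k‖ := by
      refine h2.trans ((norm_expect_le _ _).trans (expect_mono fun x =>
        (norm_sum_le _ _).trans ?_))
      refine (Finset.sum_le_sum fun u _ => norm_expect_le _ _).trans ?_
      exact Finset.sum_le_sum_of_subset_of_nonneg (Finset.Ico_subset_Ico hA hB)
        fun u _ _ => expect_nonneg' fun _ => norm_nonneg _
    simp_rw [← sum_fin_eq_sum_Ico N (fun u => 𝔼 y, ‖𝔼 i, 𝔼 j, 𝔼 k, ψ _ u y i j k‖)] at h4
    simp_rw [Fintype.expect_eq_sum_div_card (ι := Fin N), Fintype.card_fin, ← Finset.expect_div]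
    rw [le_div_iff₀ hN']
    linarith
  refine (pow_le_expect_pow (fun x => expect_nonneg' fun u => expect_nonneg' fun y =>
    norm_nonneg _) (by positivity) h3 8).trans (expect_mono fun x => ?_)
  have h5 : ∀ u : Fin N, (𝔼 y, ‖𝔼 i, 𝔼 j, 𝔼 k, ψ x (u : ℕ) y i j k‖) ^ 8 ≤
      boxNorm (prog T s₁) (prog T s₂) (prog T s₃) (F x) := fun u => by
    refine (pow_expect_le (fun _ => norm_nonneg _) 8).trans ?_
    refine (expect_mono fun y => box_three
      (φ₁ := fun j k : Fin T => h₁ x (y + s₁ * (((u : ℕ) : ℤ) + c x) + (s₁ - s₂) * (j : ℕ) +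
        (s₁ - s₃) * (k : ℕ)))
      (φ₂ := fun i k : Fin T => h₂ x (y + s₂ * (((u : ℕ) : ℤ) + c x) + (s₂ - s₁) * (i : ℕ) +
        (s₂ - s₃) * (k : ℕ)))
      (φ₃ := fun i j : Fin T => h₃ x (y + s₃ * (((u : ℕ) : ℤ) + c x) + (s₃ - s₁) * (i : ℕ) +
        (s₃ - s₂) * (j : ℕ)))
      (fun _ _ => hh₁ _ _) (fun _ _ => hh₂ _ _) (fun _ _ => hh₃ _ _) _).trans (le_of_eq ?_)
    unfold boxNorm
    rw [Finset.expect_comm]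
    refine Finset.expect_congr rfl fun i _ => ?_
    rw [Finset.expect_comm]
    refine Finset.expect_congr rfl fun i' _ => ?_
    rw [Finset.expect_comm]
    refine Finset.expect_congr rfl fun j _ => ?_
    rw [Finset.expect_comm]
    refine Finset.expect_congr rfl fun j' _ => Finset.expect_congr rfl fun y _ => ?_
    congr 2
    refine Finset.expect_congr rfl fun k _ => ?_
    have e1 : ∀ a b d : ZMod M, y + a + b + d = y + d + a + b := fun a b d => by ring
    simp only [der, prog, e1, map_mul, Complex.conj_conj]
    ring
  exact (pow_expect_le (fun u => expect_nonneg' fun y => norm_nonneg _) 8).trans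
    (expect_le_of_forall h5)

/-- Extension by zero to all integers. -/
def ext (f : Fin N → ZMod M → ℂ) (n : ℤ) (y : ZMod M) : ℂ :=
  if h : 0 ≤ n ∧ n < N then f ⟨n.toNat, by omega⟩ y else 0

omit [NeZero M] in
theorem ext_coe (f : Fin N → ZMod M → ℂ) (x : Fin N) (y : ZMod M) :
    ext f ((x : ℕ) : ℤ) y = f x y := by
  have : (0 : ℤ) ≤ ((x : ℕ) : ℤ) ∧ ((x : ℕ) : ℤ) < N := ⟨by positivity, by exact_mod_cast x.2⟩
  simp [ext, this]

omit [NeZero M] in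
theorem norm_ext_le {f : Fin N → ZMod M → ℂ} (hf : ∀ x y, ‖f x y‖ ≤ 1) (n : ℤ) (y : ZMod M) :
    ‖ext f n y‖ ≤ 1 := by
  unfold ext
  split_ifs
  · exact hf _ _
  · simp

omit [NeZero M] in
theorem ext_eq_zero (f : Fin N → ZMod M → ℂ) {n : ℤ} (hn : n ∉ Finset.Ico (0 : ℤ) N)
    (y : ZMod M) : ext f n y = 0 := by
  rw [Finset.mem_Ico] at hn
  simp [ext, hn]

/-- Two differencing steps bound the counting operator by a box norm of the last function along
multiples of `D`. -/
theorem exists_boxNorm_ge {D J T : ℕ} (hN : 0 < N) (hT : 0 < T) (hDJ : D * J ≤ N)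
    {f₀ f₁ f₂ : Fin N → ZMod M → ℂ} (h₀ : ∀ x y, ‖f₀ x y‖ ≤ 1) (h₁ : ∀ x y, ‖f₁ x y‖ ≤ 1)
    (h₂ : ∀ x y, ‖f₂ x y‖ ≤ 1) (s : ℤ) {δ ε : ℝ} (hδ : 0 < δ) (hδ1 : δ ≤ 1)
    (hε : ε = δ ^ 4 / 512) (hJ : 1 ≤ ε * J) (hTε : 12 * T ≤ ε * N)
    (h : δ ≤ ‖cnt s f₀ f₁ f₂‖) :
    ∃ e e' : ℤ, e ≠ 0 ∧ e' ≠ 0 ∧ e' ≠ e ∧ |e| < J ∧ |e'| < J ∧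
      (ε / 2) ^ 8 ≤ 𝔼 x, boxNorm (prog T ((2 * D * e' : ℤ) : ZMod M))
        (prog T ((2 * D * (-e) : ℤ) : ZMod M)) (prog T ((2 * D * (e' - e) : ℤ) : ZMod M))
        (f₂ x) := by
  have hN' : (0 : ℝ) < N := by exact_mod_cast hN
  have : Nonempty (Fin N) := ⟨⟨0, hN⟩⟩
  have hJ0 : (0 : ℝ) ≤ J := by positivity
  have hδ4 : δ ^ 4 ≤ δ ^ 2 := pow_le_pow_of_le_one hδ.le hδ1 (by norm_num)
  -- differencing in `x`
  set g : Fin N × ZMod M → ℤ → ℂ := fun z n => ext f₀ n z.2 *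
    ext f₂ n (z.2 + (((z.1 : ℕ) : ℤ) - n + s : ℤ) ^ 2) with hg
  have hg1 : δ ^ 2 * N ^ 2 ≤ 𝔼 z, ‖∑ n ∈ Finset.Ico (0 : ℤ) N, g z n‖ ^ 2 := by
    have e : cnt s f₀ f₁ f₂ = 𝔼 z : Fin N × ZMod M, f₁ z.1 z.2 * 𝔼 x : Fin N, g z (x : ℕ) := by
      rw [cnt, Finset.expect_comm, ← Finset.univ_product_univ, Finset.expect_product]
      refine Finset.expect_congr rfl fun u _ => ?_
      rw [Finset.expect_comm]
      refine Finset.expect_congr rfl fun y _ => ?_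
      rw [Finset.mul_expect]
      refine Finset.expect_congr rfl fun x _ => ?_
      simp only [hg, ext_coe, disp]
      push_cast; ring
    have h1 : δ ^ 2 ≤ 𝔼 z, ‖𝔼 x : Fin N, g z (x : ℕ)‖ ^ 2 := by
      rw [e] at h
      exact (pow_le_pow_left₀ hδ.le h 2).trans (normSq_expect_mul_le (fun z => h₁ _ _) _)
    have h2 : ∀ z, ‖∑ n ∈ Finset.Ico (0 : ℤ) N, g z n‖ ^ 2
        = ‖𝔼 x : Fin N, g z (x : ℕ)‖ ^ 2 * N ^ 2 := fun z => by
      rw [← sum_fin_eq_sum_Ico N (g z), Fintype.expect_eq_sum_div_card, Fintype.card_fin, norm_div,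
        Complex.norm_natCast, div_pow]
      field_simp
    simp_rw [h2, ← Finset.expect_mul]
    exact mul_le_mul_of_nonneg_right h1 (by positivity)
  -- Only the shift `0` has to be avoided here, so the second forbidden shift is also taken to be
  -- `0`. Cauchy-Schwarz in `(u, y)` has already removed `f₁`.
  obtain ⟨e, he0, -, heJ, hcor⟩ := exists_correlation hN hDJ (g := g)
    (fun z n => norm_mul_le_one' (norm_ext_le h₀ _ _) (norm_ext_le h₂ _ _))
    (fun z n hn => by simp only [hg]; rw [ext_eq_zero f₀ hn, zero_mul]) 0
    (η := δ ^ 2) (by positivity) (by nlinarith) hg1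
  -- differencing in `u`
  set G : Fin N × ZMod M → ℤ → ℂ := fun z u => if u ∈ Finset.Ico (0 : ℤ) N then
    f₂ z.1 (z.2 + (u - (z.1 : ℕ) + s : ℤ) ^ 2) *
      conj (ext f₂ ((z.1 : ℕ) + D * e) (z.2 + (u - ((z.1 : ℕ) + D * e) + s : ℤ) ^ 2)) else 0 with hG
  have hG1 : (δ ^ 2 / 8) ^ 2 * N ^ 2 ≤ 𝔼 z, ‖∑ n ∈ Finset.Ico (0 : ℤ) N, G z n‖ ^ 2 := by
    have hrw : 𝔼 z, ∑ n ∈ Finset.Ico (0 : ℤ) N, g z n * conj (g z (n + D * e))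
        = 𝔼 z : Fin N × ZMod M, (f₀ z.1 z.2 * conj (ext f₀ ((z.1 : ℕ) + D * e) z.2)) *
          ∑ u ∈ Finset.Ico (0 : ℤ) N, G z u := by
      have cardN : ∀ f : ℤ → ℂ, ∑ n ∈ Finset.Ico (0 : ℤ) N, f n
          = N * 𝔼 x : Fin N, f (x : ℕ) := fun f => by
        rw [← sum_fin_eq_sum_Ico, ← Fintype.card_mul_expect, Fintype.card_fin]
      have prodN : ∀ f : Fin N × ZMod M → ℂ, 𝔼 z, f z = 𝔼 x, 𝔼 y, f (x, y) := fun f => by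
        rw [← Finset.univ_product_univ, Finset.expect_product]
      simp_rw [cardN, prodN]
      simp_rw [mul_left_comm _ (N : ℂ), ← Finset.mul_expect]
      congr 1
      simp_rw [Finset.mul_expect]
      calc _ = 𝔼 u : Fin N, 𝔼 x : Fin N, 𝔼 y,
            g (u, y) (x : ℕ) * conj (g (u, y) ((x : ℕ) + D * e)) :=
            Finset.expect_congr rfl fun _ _ => Finset.expect_comm _ _ _
        _ = 𝔼 x : Fin N, 𝔼 u : Fin N, 𝔼 y,
            g (u, y) (x : ℕ) * conj (g (u, y) ((x : ℕ) + D * e)) := Finset.expect_comm _ _ _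
        _ = _ := ?_
      refine Finset.expect_congr rfl fun x _ => ?_
      rw [Finset.expect_comm]
      refine Finset.expect_congr rfl fun y _ => Finset.expect_congr rfl fun u _ => ?_
      have hu : ((u : ℕ) : ℤ) ∈ Finset.Ico (0 : ℤ) N := by
        simp
      simp only [hg, hG, ext_coe, if_pos hu, map_mul]
      ring
    rw [hrw] at hcor
    have h1 := normSq_expect_mul_le (a := fun z : Fin N × ZMod M =>
      f₀ z.1 z.2 * conj (ext f₀ ((z.1 : ℕ) + D * e) z.2))
      (fun z => norm_mul_conj_le_one (h₀ _ _) (norm_ext_le h₀ _ _))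
      (fun z => ∑ u ∈ Finset.Ico (0 : ℤ) N, G z u)
    refine le_trans ?_ h1
    rw [← mul_pow]
    refine pow_le_pow_left₀ (by positivity) ?_ 2
    refine le_trans (le_of_eq ?_) hcor
    ring
  -- Forbidding `e` keeps the third slope `2 D (e' - e)` nonzero.
  obtain ⟨e', he'0, hee', he'J, hcor'⟩ := exists_correlation hN hDJ (g := G)
    (fun z n => by
      simp only [hG]
      split_ifs
      · exact norm_mul_conj_le_one (h₂ _ _) (norm_ext_le h₂ _ _)
      · simp)
    (fun z n hn => by simp only [hG]; rw [if_neg hn]) e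
    (η := (δ ^ 2 / 8) ^ 2) (by positivity) (by rw [hε] at hJ; nlinarith) hG1
  refine ⟨e, e', he0, he'0, hee', heJ, he'J, ?_⟩
  set a : ℤ := D * e' with ha
  set b : ℤ := D * e with hb
  -- Only four copies of `f₂` remain, at `y` plus the squares of `v`, `v + a`, `v - b`, `v + a - b`
  -- with `v = u - x + s`. Subtracting `v²` from `y` leaves slopes `2a`, `-2b`, `2(a - b)` in `v`.
  -- The bounds `max 0 (-a)` and `min N (N - a)` restrict to `u` with both `u` and `u + a` in `[0,
  -- N)`.
  refine pow_le_boxNorm_linear hN hT (F := f₂)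
    (h₁ := fun x y => conj (f₂ x (y + (a : ZMod M) ^ 2)))
    (h₂ := fun x y => conj (ext f₂ ((x : ℕ) + b) (y + (b : ZMod M) ^ 2)))
    (h₃ := fun x y => ext f₂ ((x : ℕ) + b) (y + ((a - b : ℤ) : ZMod M) ^ 2))
    h₂ (fun x y => norm_conj_le_one (h₂ _ _)) (fun x y => norm_conj_le_one (norm_ext_le h₂ _ _))
    (fun x y => norm_ext_le h₂ _ _) ((2 * D * e' : ℤ) : ZMod M) ((2 * D * (-e) : ℤ) : ZMod M)
    ((2 * D * (e' - e) : ℤ) : ZMod M) (fun x => ((s - (x : ℕ) : ℤ) : ZMod M))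
    (A := max 0 (-a)) (B := min N (N - a)) (le_max_left _ _) (min_le_left _ _)
    (by rw [hε]; positivity) hTε ?_
  refine le_trans (le_of_eq (by rw [hε]; ring)) (hcor'.trans (le_of_eq ?_))
  congr 1
  rw [← Finset.univ_product_univ, Finset.expect_product]
  refine Finset.expect_congr rfl fun x _ => ?_
  rw [Finset.expect_sum_comm, Finset.expect_sum_comm]
  refine (Finset.sum_subset (Finset.Ico_subset_Ico (le_max_left 0 (-a))
    (min_le_left (N : ℤ) (N - a))) fun u hu hu' => ?_).symm.trans
    (Finset.sum_congr rfl fun u hu => ?_)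
  · have : u + a ∉ Finset.Ico (0 : ℤ) N := by
      simp only [Finset.mem_Ico, sup_le_iff, lt_inf_iff] at hu hu' ⊢
      omega
    refine Finset.expect_eq_zero fun y _ => ?_
    simp only [hG]
    rw [if_neg this, map_zero, mul_zero]
  · have hu1 : u ∈ Finset.Ico (0 : ℤ) N := by
      simp only [Finset.mem_Ico, sup_le_iff, lt_inf_iff] at hu ⊢
      omega
    have hu2 : u + a ∈ Finset.Ico (0 : ℤ) N := by
      simp only [Finset.mem_Ico, sup_le_iff, lt_inf_iff] at hu ⊢
      omega
    rw [← expect_sub_right _ (((u - (x : ℕ) + s : ℤ) : ZMod M) ^ 2)]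
    refine Finset.expect_congr rfl fun y _ => ?_
    simp only [hG, if_pos hu1, if_pos hu2, map_mul, Complex.conj_conj, sub_add_cancel]
    have e1 : y - ((u - (x : ℕ) + s : ℤ) : ZMod M) ^ 2 + ((u + a - (x : ℕ) + s : ℤ) : ZMod M) ^ 2
        = y + ((2 * D * e' : ℤ) : ZMod M) * (u + ((s - (x : ℕ) : ℤ) : ZMod M)) +
          (a : ZMod M) ^ 2 := by rw [ha]; push_cast; ring
    have e2 : y - ((u - (x : ℕ) + s : ℤ) : ZMod M) ^ 2 +
        ((u - ((x : ℕ) + b) + s : ℤ) : ZMod M) ^ 2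
        = y + ((2 * D * (-e) : ℤ) : ZMod M) * (u + ((s - (x : ℕ) : ℤ) : ZMod M)) +
          (b : ZMod M) ^ 2 := by rw [hb]; push_cast; ring
    have e3 : y - ((u - (x : ℕ) + s : ℤ) : ZMod M) ^ 2 +
        ((u + a - ((x : ℕ) + b) + s : ℤ) : ZMod M) ^ 2
        = y + ((2 * D * (e' - e) : ℤ) : ZMod M) * (u + ((s - (x : ℕ) : ℤ) : ZMod M)) +
          ((a - b : ℤ) : ZMod M) ^ 2 := by rw [ha, hb]; push_cast; ring
    rw [e1, e2, e3]
    ring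

end PET

/-! ### Exponentials on the circle and a Vinogradov-type lemma -/

section Circle

theorem exists_real_rep (θ : UnitAddCircle) : ∃ x : ℝ, (x : UnitAddCircle) = θ ∧ |x| = ‖θ‖ := by
  obtain ⟨y, rfl⟩ := QuotientAddGroup.mk_surjective θ
  refine ⟨y - round y, ?_, ?_⟩
  · simp
  · exact (UnitAddCircle.norm_eq).symm

theorem norm_coe_of_le {x : ℝ} (hx : |x| ≤ 1 / 2) : ‖(x : UnitAddCircle)‖ = |x| := by
  exact (AddCircle.norm_coe_eq_abs_iff (p := 1) one_ne_zero).mpr (by simpa using hx)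

theorem norm_e_sub_one (θ : UnitAddCircle) : 4 * ‖θ‖ ≤ ‖e θ - 1‖ ∧ ‖e θ - 1‖ ≤ 7 * ‖θ‖ := by
  obtain ⟨x, rfl, hx⟩ := exists_real_rep θ
  have hx2 : |x| ≤ 1 / 2 := by
    rw [hx]; simpa using AddCircle.norm_le_half_period 1 one_ne_zero (x := (x : UnitAddCircle))
  have h : ‖e (x : UnitAddCircle) - 1‖ = 2 * |Real.sin (Real.pi * x)| := by
    rw [e_coe]
    have := Complex.norm_exp_I_mul_ofReal_sub_one (2 * Real.pi * x)
    rw [show 2 * (Real.pi : ℂ) * Complex.I * x = Complex.I * ((2 * Real.pi * x : ℝ) : ℂ) by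
      push_cast; ring, this, norm_mul, Real.norm_eq_abs, Real.norm_eq_abs, abs_two]
    congr 3; ring
  have hs : |Real.sin (Real.pi * x)| = Real.sin (Real.pi * |x|) := by
    have hpi := Real.pi_pos
    rcases abs_cases x with ⟨h1, h2⟩ | ⟨h1, h2⟩
    · rw [h1, abs_of_nonneg]
      exact Real.sin_nonneg_of_nonneg_of_le_pi (by positivity) (by nlinarith)
    · rw [h1, mul_neg, Real.sin_neg, abs_of_nonpos]
      exact Real.sin_nonpos_of_nonpos_of_neg_pi_le (by nlinarith) (by nlinarith)
  rw [h, hs, ← hx]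
  have hpi := Real.pi_pos
  constructor
  · have := Real.mul_le_sin (x := Real.pi * |x|) (by positivity) (by nlinarith)
    have e1 : 2 / Real.pi * (Real.pi * |x|) = 2 * |x| := by field_simp
    linarith
  · have := Real.sin_le (x := Real.pi * |x|) (by positivity)
    have := Real.pi_lt_d2
    nlinarith [abs_nonneg x]

theorem e_zsmul_add_one (θ : UnitAddCircle) (u : ℤ) : e ((u + 1) • θ) = e (u • θ) * e θ := by
  rw [add_smul, one_smul, e_add]

/-- The standard bound for geometric sums of characters. -/
theorem norm_geom_sum_mul_le (θ : UnitAddCircle) (A B : ℤ) :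
    ‖∑ u ∈ Finset.Ico A B, e (u • θ)‖ * (2 * ‖θ‖) ≤ 1 := by
  have h1 : (∑ u ∈ Finset.Ico A B, e (u • θ)) * (e θ - 1)
      = ∑ u ∈ Finset.Ico A B, e ((u + 1) • θ) - ∑ u ∈ Finset.Ico A B, e (u • θ) := by
    rw [mul_sub, mul_one, Finset.sum_mul]
    simp_rw [e_zsmul_add_one]
  have h2 := norm_sum_shift_sub_le (φ := fun u => e (u • θ)) (fun u => (norm_e _).le) A B
    (t := 1) zero_le_one
  rw [norm_sub_rev, ← h1, norm_mul] at h2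
  have h3 := (norm_e_sub_one θ).1
  have h4 := mul_le_mul_of_nonneg_left h3 (norm_nonneg (∑ u ∈ Finset.Ico A B, e (u • θ)))
  push_cast at h2
  linarith

theorem norm_zsmul_le' (n : ℤ) (θ : UnitAddCircle) : ‖n • θ‖ ≤ |(n : ℝ)| * ‖θ‖ := by
  have := norm_zsmul_le (n := n) (a := θ)
  rwa [Int.norm_eq_abs] at this

/-- Two elements of a set of integers which agree modulo `q` and are close, but not too close. -/
theorem exists_close_pair {N q ℓ c : ℕ} (hq : 0 < q) (hℓ : 0 < ℓ) {S : Finset ℤ}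
    (hS : S ⊆ Finset.Icc (-(N : ℤ)) N) (hc : c * (q * (2 * (N / ℓ) + 2)) < S.card) :
    ∃ n ∈ S, ∃ n' ∈ S, ∃ t : ℤ, n - n' = q * t ∧ (c : ℤ) ≤ t ∧ (q * t : ℤ) < ℓ := by
  classical
  -- Cells are residue classes modulo `q` within blocks of length `ℓ`. A cell with more than `c`
  -- points has extreme points that are congruent, at distance less than `ℓ`, and at least `c` steps
  -- of `q` apart.
  set f : ℤ → ℤ × ℤ := fun n => (n % q, n / ℓ) with hf
  set C : Finset (ℤ × ℤ) := Finset.Ico (0 : ℤ) q ×ˢ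
    Finset.Icc (-((N / ℓ : ℕ) : ℤ) - 1) ((N / ℓ : ℕ) : ℤ) with hC
  have hq' : (0 : ℤ) < q := by exact_mod_cast hq
  have hℓ' : (0 : ℤ) < ℓ := by exact_mod_cast hℓ
  have hmaps : ∀ n ∈ S, f n ∈ C := fun n hn => by
    have hn' := Finset.mem_Icc.mp (hS hn)
    simp only [hf, hC, Finset.mem_product, Finset.mem_Ico, Finset.mem_Icc]
    have hd : ((N / ℓ : ℕ) : ℤ) = (N : ℤ) / ℓ := by push_cast; rfl
    have h1 : n / ℓ ≤ (N : ℤ) / ℓ := Int.ediv_le_ediv hℓ' hn'.2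
    have h2 : -((N : ℤ) / ℓ) - 1 ≤ n / ℓ := by
      rw [Int.le_ediv_iff_mul_le hℓ']
      have := Int.lt_ediv_add_one_mul_self (N : ℤ) hℓ'
      nlinarith
    exact ⟨⟨Int.emod_nonneg _ hq'.ne', Int.emod_lt_of_pos _ hq'⟩, by rw [hd]; exact h2,
      by rw [hd]; exact h1⟩
  have hCc : C.card = q * (2 * (N / ℓ) + 2) := by
    rw [hC, Finset.card_product, Int.card_Ico, Int.card_Icc]
    congr 1
    omega
  obtain ⟨y, -, hy⟩ := Finset.exists_lt_card_fiber_of_mul_lt_card_of_maps_to hmaps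
    (n := c) (by rw [hCc, mul_comm]; exact hc)
  set A := S.filter fun x => f x = y with hA
  have hAne : A.Nonempty := Finset.card_pos.mp (by omega)
  have hfmem : ∀ n ∈ A, n ∈ S ∧ n % q = y.1 ∧ n / ℓ = y.2 := fun n hn => by
    have := Finset.mem_filter.mp hn
    exact ⟨this.1, congrArg Prod.fst this.2, congrArg Prod.snd this.2⟩
  have hmax := hfmem _ (A.max'_mem hAne)
  have hmin := hfmem _ (A.min'_mem hAne)
  set n := A.max' hAne
  set n' := A.min' hAne
  have hdvd : ∀ m ∈ A, (q : ℤ) ∣ m - n' := fun m hm =>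
    Int.ModEq.dvd (show n' % q = m % q by rw [hmin.2.1, (hfmem m hm).2.1])
  obtain ⟨t, ht⟩ := hdvd n (A.max'_mem hAne)
  refine ⟨n, hmax.1, n', hmin.1, t, ht, ?_, ?_⟩
  · have hle : A.card ≤ (Finset.Icc (0 : ℤ) t).card := by
      refine Finset.card_le_card_of_injOn (fun m => (m - n') / q) ?_ ?_
      · intro m hm
        have h1 := A.min'_le m hm
        have h2 := A.le_max' m hm
        simp only [Finset.coe_Icc, Set.mem_Icc]
        constructor
        · exact Int.ediv_nonneg (by change n' ≤ m at h1; linarith) hq'.le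
        · refine Int.ediv_le_of_le_mul hq' ?_
          change m ≤ n at h2
          linarith
      · intro m hm m' hm' h
        have := Int.ediv_mul_cancel (hdvd m hm)
        have := Int.ediv_mul_cancel (hdvd m' hm')
        simp only at h
        rw [h] at *
        linarith
    rw [Int.card_Icc] at hle
    omega
  · rw [← ht]
    have h1 := Int.ediv_mul_le n' hℓ'.ne'
    have h2 := Int.lt_ediv_add_one_mul_self n hℓ'
    rw [hmax.2.2] at h2
    rw [hmin.2.2] at h1
    linarith

/-- A Vinogradov-type lemma: if `n θ` is very close to an integer for many `n`, then `θ` is close to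
a rational with small denominator. -/
theorem exists_denominator {K N : ℕ} (hK : 1 ≤ K) (hN : 145 * K ^ 3 ≤ N) (θ : UnitAddCircle)
    {S : Finset ℤ} (hS : S ⊆ Finset.Icc (-(N : ℤ)) N) (hSc : N ≤ K * S.card)
    (hθ : ∀ n ∈ S, ‖n • θ‖ ≤ K / N) :
    ∃ q : ℕ, 1 ≤ q ∧ q ≤ 8 * K ∧ ‖q • θ‖ ≤ 580 * K ^ 4 / N ^ 2 := by
  have hK3 : K ≤ K ^ 3 := Nat.le_self_pow (by norm_num) K
  have hN0 : 0 < N := by omega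
  have hN' : (0 : ℝ) < N := by exact_mod_cast hN0
  have hK' : (0 : ℝ) < K := by exact_mod_cast hK
  have hdiff : ∀ n ∈ S, ∀ n' ∈ S, ‖(n - n') • θ‖ ≤ 2 * K / N := fun n hn n' hn' => by
    rw [sub_smul]
    have := norm_sub_le (n • θ) (n' • θ)
    have := hθ n hn
    have := hθ n' hn'
    rw [mul_div_assoc]; linarith
  -- The density `1 / K` of `S` forces two points at distance less than `8 K`; their difference is
  -- the denominator, so far only with `‖q θ‖ ≤ 2K / N`.
  obtain ⟨n, hn, n', hn', q₀, hq, hq1, hq2⟩ := exists_close_pair (q := 1) (ℓ := 8 * K) (c := 1)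
    one_pos (by omega) hS (by
      have h1 : N / (8 * K) * (8 * K) ≤ N := Nat.div_mul_le_self _ _
      by_contra hcon
      push Not at hcon
      have h2 : K * S.card ≤ K * (1 * (1 * (2 * (N / (8 * K)) + 2))) := Nat.mul_le_mul_left _ hcon
      nlinarith)
  obtain ⟨q, rfl⟩ := Int.eq_ofNat_of_zero_le (show (0 : ℤ) ≤ q₀ by push_cast at hq1; omega)
  have hq1' : 1 ≤ q := by exact_mod_cast hq1
  have hq2' : q < 8 * K := by
    have : (q : ℤ) < (8 * K : ℕ) := by simpa using hq2
    exact_mod_cast this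
  have hqθ : ‖q • θ‖ ≤ 2 * K / N := by
    have := hdiff n hn n' hn'
    rw [hq] at this
    simpa using this
  refine ⟨q, hq1', hq2'.le, ?_⟩
  set ℓ := N / (4 * K) with hℓ
  set c := N / (145 * K ^ 3) with hc
  have hc1 : 1 ≤ c := (Nat.one_le_div_iff (by positivity)).mpr hN
  have hℓ1 : 1 ≤ ℓ := (Nat.one_le_div_iff (by positivity)).mpr (by omega)
  have hNℓ : N / ℓ ≤ 8 * K := by
    have h1 : N < (ℓ + 1) * (4 * K) := by
      rw [hℓ]; exact Nat.lt_mul_of_div_lt (Nat.lt_succ_self _) (by positivity)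
    refine Nat.div_le_of_le_mul ?_
    nlinarith
  -- A second pair, with difference `q t`, `t` of order at least `N / K³` but below `N / (4K)`,
  -- improves the approximation by a factor `t`.
  obtain ⟨m, hm, m', hm', t, ht, htc, htℓ⟩ := exists_close_pair (q := q) (ℓ := ℓ) (c := c) hq1' hℓ1
    hS (by
      have h1 : c * (145 * K ^ 3) ≤ N := Nat.div_mul_le_self _ _
      have h2 : q * (2 * (N / ℓ) + 2) ≤ 8 * K * (18 * K) :=
        Nat.mul_le_mul hq2'.le (by omega)
      by_contra hcon
      push Not at hcon
      have h3 : K * S.card ≤ K * (c * (8 * K * (18 * K))) :=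
        Nat.mul_le_mul_left _ (hcon.trans (Nat.mul_le_mul_left _ h2))
      have h4 : 0 < c * K ^ 3 := by positivity
      nlinarith)
  obtain ⟨x, hx, hxn⟩ := exists_real_rep (q • θ)
  have hcr : (N : ℝ) / (290 * K ^ 3) ≤ c := by
    have h1 : N < (c + 1) * (145 * K ^ 3) := by
      rw [hc]; exact Nat.lt_mul_of_div_lt (Nat.lt_succ_self _) (by positivity)
    have h2 : N ≤ c * (290 * K ^ 3) := by nlinarith [Nat.one_le_pow 3 K hK]
    rw [div_le_iff₀ (by positivity)]
    exact_mod_cast h2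
  have hcpos : (0 : ℝ) < c := by exact_mod_cast hc1
  have htr : (c : ℝ) ≤ t := by exact_mod_cast htc
  have htN : (t : ℝ) * (4 * K) ≤ N := by
    have h1 : (t : ℤ) ≤ q * t := by
      have : (1 : ℤ) ≤ q := by exact_mod_cast hq1'
      nlinarith
    have h2 : (t : ℤ) * (4 * K) ≤ N := by
      have h3 : (ℓ : ℤ) * (4 * K) ≤ N := by
        have : ℓ * (4 * K) ≤ N := Nat.div_mul_le_self _ _
        exact_mod_cast this
      nlinarith
    exact_mod_cast h2
  -- There is no wraparound, so `‖t q θ‖ = t ‖q θ‖` and the bound `2K / N` can be divided by `t`.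
  have htx : |t * x| ≤ 1 / 2 := by
    rw [abs_mul, abs_of_nonneg (hcpos.le.trans htr), hxn]
    calc (t : ℝ) * ‖q • θ‖ ≤ t * (2 * K / N) := by
          exact mul_le_mul_of_nonneg_left hqθ (hcpos.le.trans htr)
      _ = (t * (4 * K)) / N / 2 := by ring
      _ ≤ 1 / 2 := by
        have : (t : ℝ) * (4 * K) / N ≤ 1 := (div_le_one hN').mpr htN
        linarith
  have hfin : (t : ℝ) * ‖q • θ‖ ≤ 2 * K / N := by
    have h1 := hdiff m hm m' hm'
    have h2 : (m - m') • θ = ((t * x : ℝ) : UnitAddCircle) := by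
      rw [ht, mul_comm, mul_smul, natCast_zsmul, ← hx, ← zsmul_eq_mul]
      rfl
    rw [h2, norm_coe_of_le htx, abs_mul, abs_of_nonneg (hcpos.le.trans htr), hxn] at h1
    exact h1
  have h3 : (N : ℝ) / (290 * K ^ 3) * ‖q • θ‖ ≤ 2 * K / N :=
    (mul_le_mul_of_nonneg_right (hcr.trans htr) (norm_nonneg _)).trans hfin
  rw [div_mul_eq_mul_div, div_le_div_iff₀ (by positivity) hN'] at h3
  rw [le_div_iff₀ (by positivity)]
  linarith

end Circle

/-! ### Counting frequencies close to rationals -/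

section Counting

variable {M : ℕ} [NeZero M]

theorem norm_toAddCircle (ξ : ZMod M) :
    ‖ZMod.toAddCircle ξ‖ = |(ξ.valMinAbs : ℝ)| / M := by
  have hM : (0 : ℝ) < M := by exact_mod_cast NeZero.pos M
  conv_lhs => rw [← ZMod.coe_valMinAbs ξ]
  rw [ZMod.toAddCircle_intCast, norm_coe_of_le, abs_div, abs_of_pos hM]
  rw [abs_div, abs_of_pos hM, div_le_div_iff₀ hM two_pos]
  have h := ZMod.natAbs_valMinAbs_le ξ
  have : (2 * ξ.valMinAbs.natAbs : ℤ) ≤ M := by omega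
  have h2 : |(ξ.valMinAbs : ℝ)| * 2 ≤ M := by
    rw [← Int.cast_abs, Int.abs_eq_natAbs]
    have : ((2 * ξ.valMinAbs.natAbs : ℤ) : ℝ) ≤ (M : ℤ) := by exact_mod_cast this
    push_cast at this ⊢
    linarith
  linarith

theorem card_norm_le (c : ℝ) :
    ((Finset.univ.filter fun ξ : ZMod M => ‖ZMod.toAddCircle ξ‖ ≤ c).card : ℝ)
      ≤ 2 * |c| * M + 1 := by
  have hM : (0 : ℝ) < M := by exact_mod_cast NeZero.pos M
  set n : ℕ := ⌊|c| * M⌋₊ with hn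
  have h1 : (Finset.univ.filter fun ξ : ZMod M => ‖ZMod.toAddCircle ξ‖ ≤ c).card
      ≤ (Finset.Icc (-(n : ℤ)) n).card := by
    refine Finset.card_le_card_of_injOn (fun ξ => ξ.valMinAbs) ?_
      (fun a _ b _ h => ZMod.injective_valMinAbs h)
    intro ξ hξ
    simp only [Finset.coe_filter, Finset.mem_univ, true_and, Set.mem_ofPred_eq] at hξ
    rw [norm_toAddCircle, div_le_iff₀ hM] at hξ
    have h2 : |(ξ.valMinAbs : ℝ)| ≤ |c| * M :=
      hξ.trans (mul_le_mul_of_nonneg_right (le_abs_self c) hM.le)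
    have h3 : ξ.valMinAbs.natAbs ≤ n := by
      refine Nat.le_floor ?_
      rwa [← Int.cast_abs, Int.abs_eq_natAbs, Int.cast_natCast] at h2
    simp only [Finset.coe_Icc, Set.mem_Icc]
    omega
  rw [Int.card_Icc] at h1
  have h4 : (n : ℝ) ≤ |c| * M := Nat.floor_le (by positivity)
  have h5 : (Finset.univ.filter fun ξ : ZMod M => ‖ZMod.toAddCircle ξ‖ ≤ c).card ≤ 2 * n + 1 := by
    omega
  have h6 : ((Finset.univ.filter fun ξ : ZMod M => ‖ZMod.toAddCircle ξ‖ ≤ c).card : ℝ)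
      ≤ 2 * n + 1 := by exact_mod_cast h5
  linarith

/-- Multiplication by `q` maps these frequencies into those within `c` of an integer, with fibres of
size at most `q`. -/
theorem card_norm_nsmul_le {q : ℕ} (hq : 0 < q) (c : ℝ) :
    ((Finset.univ.filter fun ξ : ZMod M => ‖q • ZMod.toAddCircle ξ‖ ≤ c).card : ℝ)
      ≤ q * (2 * |c| * M + 1) := by
  classical
  set B := Finset.univ.filter fun ζ : ZMod M => ‖ZMod.toAddCircle ζ‖ ≤ c with hB
  have h1 : (Finset.univ.filter fun ξ : ZMod M => ‖q • ZMod.toAddCircle ξ‖ ≤ c).card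
      ≤ q * B.card := by
    refine Finset.card_le_mul_card_image_of_maps_to (f := fun ξ => (q : ZMod M) * ξ) ?_ q ?_
    · intro ξ hξ
      simp only [Finset.mem_filter, Finset.mem_univ, true_and, hB] at hξ ⊢
      rwa [← nsmul_eq_mul, map_nsmul]
    · intro ζ _
      refine le_trans (Finset.card_le_card ?_) (card_mul_eq_le hq ζ)
      intro ξ hξ
      simp only [Finset.mem_filter, Finset.mem_univ, true_and] at hξ ⊢
      exact hξ.2
  have h2 := card_norm_le (M := M) c
  calc _ ≤ ((q * B.card : ℕ) : ℝ) := by exact_mod_cast h1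
    _ = q * (B.card : ℝ) := by push_cast; ring
    _ ≤ _ := mul_le_mul_of_nonneg_left h2 (by positivity)

end Counting

/-! ### Weyl's inequality in inverse form for quadratic phases -/

section Weyl

/-- A quadratic phase. -/
def quadPhase (κ lam : UnitAddCircle) (c u : ℤ) : ℂ := e ((u + c) ^ 2 • κ + (u + c) • lam)

theorem norm_quadPhase (κ lam : UnitAddCircle) (c u : ℤ) : ‖quadPhase κ lam c u‖ = 1 := norm_e _

theorem quadPhase_add (κ lam : UnitAddCircle) (c u h : ℤ) :
    quadPhase κ lam c (u + h) = quadPhase κ lam c u *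
      (e ((2 * (u + c) * h + h ^ 2) • κ) * e (h • lam)) := by
  simp only [quadPhase, ← e_add]
  congr 1
  rw [show (u + h + c) ^ 2 = (u + c) ^ 2 + (2 * (u + c) * h + h ^ 2) by ring,
    show u + h + c = (u + c) + h by ring, add_smul, add_smul (u + c) h]
  abel

theorem normSq_sum_Ico_le {N : ℕ} (φ : ℤ → ℂ) :
    ‖∑ u ∈ Finset.Ico (0 : ℤ) N, φ u‖ ^ 2 ≤ ∑ h ∈ Finset.Ioo (-(N : ℤ)) N,
      ‖∑ u ∈ Finset.Ico (max 0 (-h)) (min (N : ℤ) (N - h)), φ (u + h) * conj (φ u)‖ := by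
  have h1 : ((‖∑ u ∈ Finset.Ico (0 : ℤ) N, φ u‖ ^ 2 : ℝ) : ℂ) = ∑ h ∈ Finset.Ioo (-(N : ℤ)) N,
      ∑ u ∈ Finset.Ico (max 0 (-h)) (min (N : ℤ) (N - h)), φ (u + h) * conj (φ u) := by
    rw [normSq_eq, map_sum, Finset.sum_mul_sum, Finset.sum_comm, ← Finset.sum_product',
      Finset.sum_sigma']
    refine Finset.sum_bij' (fun (q : ℤ × ℤ) _ => (⟨q.2 - q.1, q.1⟩ : Σ _ : ℤ, ℤ))
      (fun (r : Σ _ : ℤ, ℤ) _ => (r.2, r.2 + r.1)) ?_ ?_ ?_ ?_ ?_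
    · rintro ⟨a, b⟩ h
      simp only [Finset.mem_product, Finset.mem_Ico, Finset.mem_sigma, Finset.mem_Ioo, sup_le_iff,
        lt_inf_iff] at h ⊢
      omega
    · rintro ⟨a, b⟩ h
      simp only [Finset.mem_product, Finset.mem_Ico, Finset.mem_sigma, Finset.mem_Ioo, sup_le_iff,
        lt_inf_iff] at h ⊢
      omega
    · rintro ⟨a, b⟩ _; simp
    · rintro ⟨a, b⟩ _; simp
    · rintro ⟨a, b⟩ _; simp
  have h0 : 0 ≤ ‖∑ u ∈ Finset.Ico (0 : ℤ) N, φ u‖ ^ 2 := by positivity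
  rw [← Real.norm_of_nonneg h0, ← Complex.norm_real, h1]
  exact norm_sum_le _ _

/-- Weyl's inequality for quadratic phases, in inverse form. -/
theorem exists_denominator_of_quadPhase {N R : ℕ} (hR : 1 ≤ R) (hN : 145 * (2 * R ^ 2) ^ 3 ≤ N)
    (κ lam : UnitAddCircle) (c : ℤ)
    (h : (N : ℝ) ≤ R * ‖∑ u ∈ Finset.Ico (0 : ℤ) N, quadPhase κ lam c u‖) :
    ∃ q : ℕ, 1 ≤ q ∧ q ≤ 32 * R ^ 2 ∧ ‖q • κ‖ ≤ 9280 * R ^ 8 / N ^ 2 := by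
  have hN0 : 0 < N := lt_of_lt_of_le (by positivity) hN
  have hN' : (0 : ℝ) < N := by exact_mod_cast hN0
  have hR' : (0 : ℝ) < R := by exact_mod_cast hR
  -- Differencing by `h` leaves, up to a unimodular constant, a geometric sum with frequency `2 h
  -- κ`.
  set G : ℤ → ℂ := fun h => ∑ u ∈ Finset.Ico (max 0 (-h)) (min (N : ℤ) (N - h)),
    e (u • (h • (2 • κ))) with hG
  have h1 : (N : ℝ) ^ 2 ≤ R ^ 2 * ∑ h ∈ Finset.Ioo (-(N : ℤ)) N, ‖G h‖ := by
    have h2 := normSq_sum_Ico_le (N := N) (quadPhase κ lam c)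
    have h3 : ∀ h, ‖∑ u ∈ Finset.Ico (max 0 (-h)) (min (N : ℤ) (N - h)),
        quadPhase κ lam c (u + h) * conj (quadPhase κ lam c u)‖ = ‖G h‖ := fun h => by
      have : ∀ u, quadPhase κ lam c (u + h) * conj (quadPhase κ lam c u)
          = e ((2 * c * h + h ^ 2) • κ + h • lam) * e (u • (h • (2 • κ))) := fun u => by
        simp only [quadPhase, ← e_neg, ← e_add]
        congr 1
        rw [← natCast_zsmul κ 2, smul_smul, smul_smul]
        push_cast
        rw [show (u + h + c) ^ 2 = (u + c) ^ 2 + ((2 * c * h + h ^ 2) + u * h * 2) by ring,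
          show u + h + c = (u + c) + h by ring]
        simp only [add_smul]
        abel
      simp_rw [this, ← Finset.mul_sum, norm_mul, norm_e, one_mul, hG]
    simp_rw [h3] at h2
    calc (N : ℝ) ^ 2 ≤ (R * ‖∑ u ∈ Finset.Ico (0 : ℤ) N, quadPhase κ lam c u‖) ^ 2 :=
          pow_le_pow_left₀ hN'.le h 2
      _ = R ^ 2 * ‖∑ u ∈ Finset.Ico (0 : ℤ) N, quadPhase κ lam c u‖ ^ 2 := by ring
      _ ≤ _ := mul_le_mul_of_nonneg_left h2 (by positivity)
  have hGN : ∀ h, ‖G h‖ ≤ N := fun h => by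
    refine (norm_sum_le _ _).trans ((Finset.sum_le_card_nsmul _ _ 1 fun u _ =>
      (norm_e _).le).trans ?_)
    rw [nsmul_eq_mul, mul_one, Int.card_Ico]
    have : (min (N : ℤ) (N - h) - max 0 (-h)).toNat ≤ N := by omega
    exact_mod_cast this
  -- By the second moment these `h` have density at least `1 / (2R²)`, and the geometric sum bound
  -- puts `2 h κ` within `2R² / N` of an integer. Vinogradov's lemma with `K = 2R²` applied to `2κ`
  -- gives the constants `32 = 2 · 8 · 2` and `9280 = 580 · 2⁴`.
  set S := (Finset.Ioo (-(N : ℤ)) N).filter fun h => (N : ℝ) ≤ 4 * R ^ 2 * ‖G h‖ with hS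
  have hSsub : S ⊆ Finset.Icc (-(N : ℤ)) N :=
    (Finset.filter_subset _ _).trans Finset.Ioo_subset_Icc_self
  have hSc : N ≤ 2 * R ^ 2 * S.card := by
    have h2 : ∑ h ∈ Finset.Ioo (-(N : ℤ)) N, ‖G h‖ ≤ S.card * N + 2 * N * (N / (4 * R ^ 2)) := by
      have hb : ∀ h ∈ Finset.Ioo (-(N : ℤ)) N, ‖G h‖ ≤
          (if (N : ℝ) ≤ 4 * R ^ 2 * ‖G h‖ then (N : ℝ) else 0) + N / (4 * R ^ 2) := fun h _ => by
        split_ifs with hh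
        · have := hGN h
          have : (0 : ℝ) ≤ N / (4 * R ^ 2) := by positivity
          linarith
        · rw [zero_add, le_div_iff₀ (by positivity)]
          push Not at hh
          linarith
      refine (Finset.sum_le_sum hb).trans ?_
      rw [Finset.sum_add_distrib, ← Finset.sum_filter, Finset.sum_const, Finset.sum_const,
        nsmul_eq_mul, nsmul_eq_mul]
      refine add_le_add le_rfl (mul_le_mul_of_nonneg_right ?_ (by positivity))
      rw [Int.card_Ioo]
      have : ((N : ℤ) - -(N : ℤ) - 1).toNat ≤ 2 * N := by omega
      exact_mod_cast this
    have h3 : (N : ℝ) ^ 2 ≤ R ^ 2 * (S.card * N + 2 * N * (N / (4 * R ^ 2))) :=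
      h1.trans (mul_le_mul_of_nonneg_left h2 (by positivity))
    have h4 : (R : ℝ) ^ 2 * (S.card * N + 2 * N * (N / (4 * R ^ 2)))
        = N * (R ^ 2 * S.card + N / 2) := by field_simp; ring
    rw [h4, sq] at h3
    have h5 := le_of_mul_le_mul_left h3 hN'
    have h6 : (N : ℝ) ≤ 2 * R ^ 2 * S.card := by linarith
    exact_mod_cast h6
  have hθ : ∀ h ∈ S, ‖h • (2 • κ)‖ ≤ (2 * R ^ 2 : ℕ) / N := fun h hh => by
    have h2 := (Finset.mem_filter.mp hh).2
    have h3 := norm_geom_sum_mul_le (h • (2 • κ)) (max 0 (-h)) (min (N : ℤ) (N - h))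
    change ‖G h‖ * _ ≤ 1 at h3
    rw [le_div_iff₀ hN']
    push_cast
    have h4 : ‖h • (2 • κ)‖ * N ≤ ‖h • (2 • κ)‖ * (4 * R ^ 2 * ‖G h‖) :=
      mul_le_mul_of_nonneg_left h2 (norm_nonneg _)
    have h5 : (0 : ℝ) ≤ R ^ 2 := by positivity
    nlinarith
  obtain ⟨q, hq1, hq2, hq3⟩ := exists_denominator (K := 2 * R ^ 2) (by nlinarith) hN (2 • κ) hSsub
    hSc hθ
  refine ⟨q * 2, by omega, by omega, ?_⟩
  rw [mul_smul]
  refine hq3.trans (le_of_eq ?_)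
  push_cast; ring

/-- Once the quadratic coefficient is close to a rational, the linear one is too. -/
theorem norm_linear_le_of_quadPhase {N R Q q : ℕ} (hR : 1 ≤ R) (hq1 : 1 ≤ q) (hqQ : q ≤ Q)
    (hN : 102 * R * Q ≤ N) (κ lam : UnitAddCircle) {c : ℤ} (hc : |c| ≤ 2 * N)
    (hκ : ‖q • κ‖ ≤ Q / N ^ 2)
    (h : (N : ℝ) ≤ R * ‖∑ u ∈ Finset.Ico (0 : ℤ) N, quadPhase κ lam c u‖) :
    ‖q • lam‖ ≤ 204 * R ^ 2 * Q / N := by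
  have hQ1 : 1 ≤ Q := hq1.trans hqQ
  set E := 102 * R * Q with hE
  have hE0 : 0 < E := by positivity
  have hN0 : 0 < N := hE0.trans_le hN
  have hN' : (0 : ℝ) < N := by exact_mod_cast hN0
  have hR' : (1 : ℝ) ≤ R := by exact_mod_cast hR
  have hQ' : (1 : ℝ) ≤ Q := by exact_mod_cast hQ1
  have hqQ' : (q : ℝ) ≤ Q := by exact_mod_cast hqQ
  have hE' : (E : ℝ) = 102 * R * Q := by rw [hE]; push_cast; ring
  set T := N / E with hT
  have hT1 : 1 ≤ T := (Nat.one_le_div_iff hE0).mpr hN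
  have hT' : (1 : ℝ) ≤ T := by exact_mod_cast hT1
  have hTE : (T : ℝ) * E ≤ N := by exact_mod_cast Nat.div_mul_le_self N E
  have hTE2 : (N : ℝ) ≤ 2 * T * E := by
    have h1 : N < (T + 1) * E := by
      rw [hT]; exact Nat.lt_mul_of_div_lt (Nat.lt_succ_self _) hE0
    have h2 : N ≤ 2 * T * E := by nlinarith
    exact_mod_cast h2
  have : Nonempty (Fin T) := ⟨⟨0, hT1⟩⟩
  set φ := quadPhase κ lam c with hφ
  -- Translating by `q t` with `t < T` changes the quadratic part only through multiples of `q κ`,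
  -- which is tiny. The linear part contributes `A`, which must therefore be at least `1 / (2R)`;
  -- the geometric sum bound then controls `q λ`.
  set A : ℂ := 𝔼 t : Fin T, e (((t : ℕ) : ℤ) • (q • lam)) with hA
  set err : ℝ := 7 * ((6 * N * T + q * T ^ 2) * (Q / N ^ 2)) with herr
  have h1 : ∀ u ∈ Finset.Ico (0 : ℤ) N,
      ‖𝔼 t : Fin T, φ (u + q * ((t : ℕ) : ℤ))‖ ≤ ‖A‖ + err := fun u hu => by
    rw [Finset.mem_Ico] at hu
    have e1 : ∀ t : Fin T, φ (u + q * ((t : ℕ) : ℤ)) = φ u * (e (((t : ℕ) : ℤ) • (q • lam)) +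
        e (((t : ℕ) : ℤ) • (q • lam)) *
        (e ((2 * (u + c) * (t : ℕ) + q * (t : ℕ) ^ 2 : ℤ) • (q • κ)) - 1)) := fun t => by
      rw [hφ, quadPhase_add]
      have e2 : (2 * (u + c) * (q * (t : ℕ)) + (q * (t : ℕ)) ^ 2 : ℤ) • κ
          = (2 * (u + c) * (t : ℕ) + q * (t : ℕ) ^ 2 : ℤ) • (q • κ) := by
        rw [← natCast_zsmul κ q, smul_smul]; congr 1; ring
      have e3 : (q * (t : ℕ) : ℤ) • lam = ((t : ℕ) : ℤ) • (q • lam) := by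
        rw [← natCast_zsmul lam q, smul_smul]; congr 1; ring
      rw [e2, e3]; ring
    simp_rw [e1, ← Finset.mul_expect]
    rw [norm_mul, hφ, norm_quadPhase, one_mul, Finset.expect_add_distrib]
    refine (norm_add_le _ _).trans (add_le_add le_rfl ?_)
    refine (norm_expect_mul_le (fun t => (norm_e _).le) _).trans (expect_le_of_forall fun t => ?_)
    refine (norm_e_sub_one _).2.trans ?_
    rw [herr]
    refine mul_le_mul_of_nonneg_left ?_ (by norm_num)
    refine (norm_zsmul_le' _ _).trans (mul_le_mul ?_ hκ (norm_nonneg _) (by positivity))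
    have ht : ((t : ℕ) : ℝ) ≤ T := by exact_mod_cast t.2.le
    have ht0 : (0 : ℝ) ≤ ((t : ℕ) : ℝ) := by positivity
    have hv : |((u + c : ℤ) : ℝ)| ≤ 3 * N := by
      have : |u + c| ≤ 3 * (N : ℤ) := by
        rw [abs_le] at hc ⊢; constructor <;> omega
      exact_mod_cast this
    push_cast at hv ⊢
    refine (abs_add_le _ _).trans (add_le_add ?_ ?_)
    · rw [abs_mul, abs_mul, abs_two, abs_of_nonneg ht0]
      calc 2 * |(u : ℝ) + c| * (t : ℕ) ≤ 2 * (3 * N) * T := by gcongr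
        _ = _ := by ring
    · rw [abs_of_nonneg (by positivity)]
      gcongr
  have h2 : ‖∑ u ∈ Finset.Ico (0 : ℤ) N, φ u‖ ≤ N * (‖A‖ + err) + 2 * (q * T) := by
    have h3 : ‖∑ u ∈ Finset.Ico (0 : ℤ) N, φ u -
        ∑ u ∈ Finset.Ico (0 : ℤ) N, 𝔼 t : Fin T, φ (u + q * ((t : ℕ) : ℤ))‖ ≤ 2 * (q * T) := by
      have e1 : ∑ u ∈ Finset.Ico (0 : ℤ) N, φ u -
        ∑ u ∈ Finset.Ico (0 : ℤ) N, 𝔼 t : Fin T, φ (u + q * ((t : ℕ) : ℤ))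
        = 𝔼 t : Fin T, (∑ u ∈ Finset.Ico (0 : ℤ) N, φ u -
          ∑ u ∈ Finset.Ico (0 : ℤ) N, φ (u + q * ((t : ℕ) : ℤ))) := by
        rw [Finset.expect_sub_distrib, Finset.expect_const Finset.univ_nonempty,
          Finset.expect_sum_comm]
      rw [e1]
      refine (norm_expect_le _ _).trans (expect_le_of_forall fun t => ?_)
      refine (norm_sum_shift_sub_le (fun u => (norm_quadPhase _ _ _ _).le) 0 N
        (by positivity)).trans ?_
      have ht : ((t : ℕ) : ℝ) ≤ T := by exact_mod_cast t.2.le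
      push_cast
      gcongr
    have h4 : ‖∑ u ∈ Finset.Ico (0 : ℤ) N, 𝔼 t : Fin T, φ (u + q * ((t : ℕ) : ℤ))‖
        ≤ N * (‖A‖ + err) := by
      refine (norm_sum_le _ _).trans ((Finset.sum_le_card_nsmul _ _ _ h1).trans ?_)
      rw [nsmul_eq_mul, Int.card_Ico, sub_zero, Int.toNat_natCast]
    have := norm_sub_norm_le (∑ u ∈ Finset.Ico (0 : ℤ) N, φ u)
      (∑ u ∈ Finset.Ico (0 : ℤ) N, 𝔼 t : Fin T, φ (u + q * ((t : ℕ) : ℤ)))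
    linarith
  have h3 : 2 * R * (N * err + 2 * (q * T)) ≤ N := by
    have e1 : N * err = 42 * (T * Q) + 7 * (q * T * (T * Q / N)) := by
      rw [herr]; field_simp; ring
    have hTQ : 102 * R * (T * Q) ≤ (N : ℝ) := by rw [hE'] at hTE; linarith
    have h5 : (T : ℝ) * Q / N ≤ 1 := by
      rw [div_le_one hN']
      nlinarith [mul_nonneg (by positivity : (0 : ℝ) ≤ T) (by positivity : (0 : ℝ) ≤ Q)]
    have h6 : (q : ℝ) * T ≤ T * Q := by nlinarith
    have h7 : (q : ℝ) * T * (T * Q / N) ≤ T * Q :=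
      (mul_le_of_le_one_right (by positivity) h5).trans h6
    rw [e1]
    calc 2 * (R : ℝ) * (42 * (T * Q) + 7 * (q * T * (T * Q / N)) + 2 * (q * T))
        ≤ 2 * R * (51 * (T * Q)) := mul_le_mul_of_nonneg_left (by linarith) (by positivity)
      _ = 102 * R * (T * Q) := by ring
      _ ≤ N := hTQ
  have h4 : 1 ≤ 2 * R * ‖A‖ := by
    have h5 : (N : ℝ) ≤ R * (N * (‖A‖ + err) + 2 * (q * T)) :=
      h.trans (mul_le_mul_of_nonneg_left h2 (by positivity))
    have h6 : (N : ℝ) * 1 ≤ N * (2 * R * ‖A‖) := by nlinarith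
    exact le_of_mul_le_mul_left h6 hN'
  have h5 : ‖A‖ * T * (2 * ‖q • lam‖) ≤ 1 := by
    have := norm_geom_sum_mul_le (q • lam) 0 T
    rw [← sum_fin_eq_sum_Ico T (fun u => e (u • (q • lam)))] at this
    have e1 : ‖A‖ * T = ‖∑ t : Fin T, e (((t : ℕ) : ℤ) • (q • lam))‖ := by
      rw [hA, Fintype.expect_eq_sum_div_card, Fintype.card_fin, norm_div, Complex.norm_natCast,
        div_mul_cancel₀ _ (by positivity)]
    rwa [e1]
  have h6 : (T : ℝ) * ‖q • lam‖ ≤ R := by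
    have h7 : 0 ≤ (T : ℝ) * ‖q • lam‖ := by positivity
    nlinarith [mul_le_mul_of_nonneg_right h4 h7]
  rw [le_div_iff₀ hN']
  calc ‖q • lam‖ * N ≤ ‖q • lam‖ * (2 * T * E) :=
        mul_le_mul_of_nonneg_left hTE2 (norm_nonneg _)
    _ = 2 * E * (T * ‖q • lam‖) := by ring
    _ ≤ 2 * E * R := mul_le_mul_of_nonneg_left h6 (by positivity)
    _ = 204 * R ^ 2 * Q := by rw [hE']; ring

/-- The bound for denominators and approximation quality in `exists_major_of_phase_average`. -/
def majorBound (R : ℕ) : ℕ := 580 * (204 * R ^ 2 * (9280 * R ^ 8)) ^ 4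

/-- With `v = u - x + s` the phase is `v² (a x - a') - 2 v (x - x') a'` up to a constant. For many
`x`, Weyl makes the leading coefficient nearly rational, and then the linear coefficient `2 (x - x')
a'` as well, to within `O(1/N)` up to factors of `R`. This holds for many multiples `x - x'` of the
fixed frequency, so Vinogradov's lemma gives precision `1/N²` for `a'` itself. -/
theorem exists_major_of_phase_average {N R : ℕ} (hR : 1 ≤ R)
    (hN : 145 * (204 * R ^ 2 * (9280 * R ^ 8)) ^ 3 ≤ N) (a : Fin N → UnitAddCircle)
    (a' : UnitAddCircle) (x' : Fin N) {s : ℤ} (hs : |s| ≤ N)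
    (h : 2 / R ≤ 𝔼 x : Fin N, ‖𝔼 u : Fin N, e ((((u : ℕ) : ℤ) - (x : ℕ) + s) ^ 2 • a x -
      (((u : ℕ) : ℤ) - (x' : ℕ) + s) ^ 2 • a')‖) :
    ∃ q : ℕ, 1 ≤ q ∧ q ≤ majorBound R ∧ ‖q • a'‖ ≤ majorBound R / N ^ 2 := by
  set Q₁ := 9280 * R ^ 8 with hQ₁
  set K := 204 * R ^ 2 * Q₁ with hK
  have hR' : (0 : ℝ) < R := by exact_mod_cast hR
  have hQ₁1 : 32 * R ^ 2 ≤ Q₁ := by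
    have : R ^ 2 ≤ R ^ 8 := Nat.pow_le_pow_right hR (by norm_num)
    omega
  have hQ₁0 : 1 ≤ Q₁ := Nat.succ_le_of_lt (by positivity)
  have hK1 : 1 ≤ K := Nat.succ_le_of_lt (by positivity)
  have hK3 : K ≤ K ^ 3 := Nat.le_self_pow (by norm_num) K
  have hN0 : 0 < N := by omega
  have hN' : (0 : ℝ) < N := by exact_mod_cast hN0
  have hKN : K ≤ N := by omega
  have hKR : 102 * R * Q₁ ≤ K := by
    rw [hK]
    exact Nat.mul_le_mul_right _ (by nlinarith)
  have hKR2 : 32 * R ^ 2 * R ≤ K := by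
    rw [hK]
    have : R ≤ Q₁ := by
      have : R ≤ R ^ 8 := Nat.le_self_pow (by norm_num) R
      omega
    exact Nat.mul_le_mul (by nlinarith) this
  have hN1 : 145 * (2 * R ^ 2) ^ 3 ≤ N := by
    refine le_trans (Nat.mul_le_mul_left _ (Nat.pow_le_pow_left ?_ 3)) hN
    rw [hK]
    calc 2 * R ^ 2 = 2 * R ^ 2 * 1 := by ring
      _ ≤ 204 * R ^ 2 * Q₁ := Nat.mul_le_mul (by omega) hQ₁0
  set κ : Fin N → UnitAddCircle := fun x => a x - a' with hκ
  set lam : Fin N → UnitAddCircle := fun x => (-(2 * (((x : ℕ) : ℤ) - (x' : ℕ)))) • a' with hlam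
  have hphase : ∀ x u : Fin N, ‖𝔼 u : Fin N, e ((((u : ℕ) : ℤ) - (x : ℕ) + s) ^ 2 • a x -
      (((u : ℕ) : ℤ) - (x' : ℕ) + s) ^ 2 • a')‖
      = ‖∑ u ∈ Finset.Ico (0 : ℤ) N, quadPhase (κ x) (lam x) (s - (x : ℕ)) u‖ / N := fun x _ => by
    rw [Fintype.expect_eq_sum_div_card, Fintype.card_fin, norm_div, Complex.norm_natCast,
      ← sum_fin_eq_sum_Ico N (quadPhase (κ x) (lam x) (s - (x : ℕ)))]
    congr 1
    have : ∀ u : Fin N, e ((((u : ℕ) : ℤ) - (x : ℕ) + s) ^ 2 • a x -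
      (((u : ℕ) : ℤ) - (x' : ℕ) + s) ^ 2 • a') = e (-((((x : ℕ) : ℤ) - (x' : ℕ)) ^ 2 • a')) *
        quadPhase (κ x) (lam x) (s - (x : ℕ)) ((u : ℕ) : ℤ) := fun u => by
      rw [quadPhase, ← e_add]
      congr 1
      set v : ℤ := ((u : ℕ) : ℤ) + (s - (x : ℕ)) with hv
      set β : ℤ := ((x : ℕ) : ℤ) - (x' : ℕ) with hβ
      rw [show (((u : ℕ) : ℤ) - (x : ℕ) + s) = v by rw [hv]; ring,
        show (((u : ℕ) : ℤ) - (x' : ℕ) + s) ^ 2 = v ^ 2 + v * (2 * β) + β ^ 2 by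
          rw [hv, hβ]; ring]
      have hl : v • lam x = -((v * (2 * β)) • a') := by
        simp only [hlam, neg_smul, smul_neg, smul_smul, hβ]
      rw [hl]
      simp only [hκ, smul_sub, add_smul]
      abel
    simp_rw [this, ← Finset.mul_sum, norm_mul, norm_e, one_mul]
  have hx0 : Fin N := x'
  simp_rw [fun x => hphase x hx0] at h
  -- the set of good `x`
  set X := Finset.univ.filter fun x : Fin N => (N : ℝ) ≤ R *
    ‖∑ u ∈ Finset.Ico (0 : ℤ) N, quadPhase (κ x) (lam x) (s - (x : ℕ)) u‖ with hX
  have hXc : N ≤ R * X.card := by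
    set g : Fin N → ℝ := fun x =>
      ‖∑ u ∈ Finset.Ico (0 : ℤ) N, quadPhase (κ x) (lam x) (s - (x : ℕ)) u‖ with hg
    have hg1 : ∀ x, g x ≤ N := fun x => by
      refine (norm_sum_le _ _).trans ((Finset.sum_le_card_nsmul _ _ 1 fun u _ =>
        (norm_quadPhase _ _ _ _).le).trans ?_)
      simp
    have hb : ∀ x, g x / N ≤ (if (N : ℝ) ≤ R * g x then 1 else 0) + 1 / R := fun x => by
      split_ifs with hh
      · have : g x / N ≤ 1 := (div_le_one hN').mpr (hg1 x)
        have : (0 : ℝ) ≤ 1 / R := by positivity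
        linarith
      · rw [zero_add, div_le_div_iff₀ hN' hR']
        push Not at hh
        linarith
    have h2 := h.trans (expect_mono hb)
    have : Nonempty (Fin N) := ⟨x'⟩
    rw [Finset.expect_add_distrib, Finset.expect_const Finset.univ_nonempty,
      Fintype.expect_eq_sum_div_card, Finset.sum_boole, Fintype.card_fin] at h2
    have h3 : 1 / (R : ℝ) ≤ X.card / N := by
      have : (2 : ℝ) / R = 1 / R + 1 / R := by ring
      linarith
    rw [div_le_div_iff₀ hR' hN'] at h3
    have h4 : (N : ℝ) ≤ R * X.card := by linarith
    exact_mod_cast h4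
  have hden : ∀ x ∈ X, ∃ q : ℕ, 1 ≤ q ∧ q ≤ 32 * R ^ 2 ∧ ‖q • κ x‖ ≤ 9280 * R ^ 8 / N ^ 2 :=
    fun x hx => exists_denominator_of_quadPhase hR hN1 _ _ _ (Finset.mem_filter.mp hx).2
  choose! q hq1 hq2 hq3 using hden
  -- The denominator of `κ x` depends on `x` but takes at most `32 R²` values, so one value is kept
  -- on a positive proportion of the good `x`.
  obtain ⟨q₀, hq₀, hcard⟩ := Finset.exists_le_card_fiber_of_nsmul_le_card_of_maps_to
    (s := X) (t := Finset.Icc 1 (32 * R ^ 2)) (f := q) (b := (X.card : ℝ) / (32 * R ^ 2))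
    (fun x hx => Finset.mem_Icc.mpr ⟨hq1 x hx, hq2 x hx⟩)
    (Finset.nonempty_Icc.mpr (Nat.succ_le_of_lt (by positivity)))
    (le_of_eq (by rw [Nat.card_Icc, Nat.add_sub_cancel, nsmul_eq_mul]; push_cast; field_simp))
  rw [Finset.mem_Icc] at hq₀
  set Y := X.filter fun x => q x = q₀ with hY
  set S : Finset ℤ := Y.image fun x : Fin N => ((x : ℕ) : ℤ) - (x' : ℕ) with hS
  have hScard : S.card = Y.card :=
    Finset.card_image_of_injective _ fun x y hxy => by
      ext; omega
  obtain ⟨q₂, hq₂1, hq₂2, hq₂3⟩ := exists_denominator hK1 hN ((2 * q₀) • a') (S := S)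
    (fun n hn => by
      obtain ⟨x, -, rfl⟩ := Finset.mem_image.mp hn
      have := x.2; have := x'.2
      rw [Finset.mem_Icc]; constructor <;> omega)
    (by
      rw [hScard]
      have h1 : (X.card : ℝ) ≤ 32 * R ^ 2 * Y.card := by
        rw [div_le_iff₀ (by positivity)] at hcard; linarith
      have h2 : X.card ≤ 32 * R ^ 2 * Y.card := by exact_mod_cast h1
      calc N ≤ R * X.card := hXc
        _ ≤ R * (32 * R ^ 2 * Y.card) := Nat.mul_le_mul_left _ h2
        _ = 32 * R ^ 2 * R * Y.card := by ring
        _ ≤ K * Y.card := Nat.mul_le_mul_right _ hKR2)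
    (fun n hn => by
      obtain ⟨x, hx, rfl⟩ := Finset.mem_image.mp hn
      have hxX := (Finset.mem_filter.mp hx).1
      have hxq := (Finset.mem_filter.mp hx).2
      have h1 : ‖q₀ • κ x‖ ≤ Q₁ / N ^ 2 := by
        have := hq3 x hxX
        rw [hxq] at this
        refine this.trans (le_of_eq ?_)
        rw [hQ₁]; push_cast; ring
      have h2 := norm_linear_le_of_quadPhase hR hq₀.1 (hq₀.2.trans hQ₁1) (hKR.trans hKN) (κ x)
        (lam x) (c := s - (x : ℕ)) (by
          have := x.2
          rw [abs_le] at hs ⊢; constructor <;> omega) h1 (Finset.mem_filter.mp hxX).2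
      have h3 : (((x : ℕ) : ℤ) - (x' : ℕ)) • ((2 * q₀) • a') = -(q₀ • lam x) := by
        simp only [hlam, neg_smul, smul_neg, neg_neg]
        rw [← natCast_zsmul, ← natCast_zsmul _ q₀, smul_smul, smul_smul]
        congr 1
        push_cast; ring
      rw [h3, norm_neg]
      refine h2.trans (le_of_eq ?_)
      rw [hK]; push_cast; ring)
  have hmb : majorBound R = 580 * K ^ 4 := rfl
  refine ⟨q₂ * (2 * q₀), Nat.succ_le_of_lt (by have := hq₀.1; positivity), ?_, ?_⟩
  · rw [hmb]
    have hKR3 : 2 * q₀ ≤ 2 * K := by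
      refine Nat.mul_le_mul_left _ (hq₀.2.trans ?_)
      calc 32 * R ^ 2 = 32 * R ^ 2 * 1 := by ring
        _ ≤ 32 * R ^ 2 * R := Nat.mul_le_mul_left _ hR
        _ ≤ K := hKR2
    calc q₂ * (2 * q₀) ≤ 8 * K * (2 * K) := Nat.mul_le_mul hq₂2 hKR3
      _ = 16 * K ^ 2 := by ring
      _ ≤ 580 * K ^ 4 := Nat.mul_le_mul (by norm_num) (Nat.pow_le_pow_right hK1 (by norm_num))
  · rw [mul_smul, hmb]
    refine hq₂3.trans (le_of_eq ?_)
    push_cast; ring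

end Weyl

/-! ### Counts with a character in the last variable see only major arcs -/

section MajorArcs

variable {M : ℕ} [NeZero M] {N : ℕ}

theorem chi_mul_intCast (a : ZMod M) (n : ℤ) :
    chi (a * (n : ZMod M)) = e (n • ZMod.toAddCircle a) := by
  rw [chi, ← map_zsmul, zsmul_eq_mul, mul_comm]

/-- The frequency `a` is close to a rational with denominator at most `Q`, at scale `N²`. -/
def IsMajor (N Q : ℕ) (a : ZMod M) : Prop :=
  ∃ q : ℕ, 1 ≤ q ∧ q ≤ Q ∧ ‖q • ZMod.toAddCircle a‖ ≤ Q / N ^ 2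

/-- If the counting operator is large for characters in the last variable then one of the
frequencies lies in a major arc. -/
theorem exists_isMajor_of_cnt {R : ℕ} (hR : 1 ≤ R)
    (hN : 145 * (204 * R ^ 2 * (9280 * R ^ 8)) ^ 3 ≤ N) {s : ℤ} (hs : |s| ≤ N)
    {f₀ f₁ : Fin N → ZMod M → ℂ} (h₀ : ∀ x y, ‖f₀ x y‖ ≤ 1) (h₁ : ∀ x y, ‖f₁ x y‖ ≤ 1)
    {c : Fin N → ℂ} (hc : ∀ x, ‖c x‖ ≤ 1) (a : Fin N → ZMod M) {η : ℝ} (hη : 0 < η)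
    (hηR : 2 ≤ η ^ 2 * R) (h : η ≤ ‖cnt s f₀ f₁ fun x y => c x * chi (a x * y)‖) :
    ∃ x, c x ≠ 0 ∧ IsMajor N (majorBound R) (a x) := by
  have hN0 : 0 < N := lt_of_lt_of_le (by positivity) hN
  have : Nonempty (Fin N) := ⟨⟨0, hN0⟩⟩
  have hR' : (0 : ℝ) < R := by exact_mod_cast hR
  set P : Fin N → Fin N → ℝ := fun x x' => ‖𝔼 u : Fin N,
    e ((((u : ℕ) : ℤ) - (x : ℕ) + s) ^ 2 • ZMod.toAddCircle (a x) -
      (((u : ℕ) : ℤ) - (x' : ℕ) + s) ^ 2 • ZMod.toAddCircle (a x'))‖ with hP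
  -- Cauchy-Schwarz in `(u, y)` removes `f₁`; for fixed `y` the functions `f₀` and the characters in
  -- `y` are independent of `u`, leaving only the quadratic phases. Keeping the factor `‖c x'‖` is
  -- what yields `c x' ≠ 0`.
  have h1 : η ^ 2 ≤ 𝔼 x, 𝔼 x', ‖c x'‖ * P x x' := by
    have e1 : cnt s f₀ f₁ (fun x y => c x * chi (a x * y)) = 𝔼 x, 𝔼 z : Fin N × ZMod M,
        f₀ x z.2 * (c x * chi (a x * (z.2 + disp M s x z.1 ^ 2))) * f₁ z.1 z.2 := by
      refine Finset.expect_congr rfl fun x _ => ?_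
      rw [← Finset.univ_product_univ, Finset.expect_product]
      refine Finset.expect_congr rfl fun u _ => Finset.expect_congr rfl fun y _ => ?_
      ring
    rw [e1] at h
    refine (pow_le_pow_left₀ hη.le h 2).trans ((normSq_expect_expect_le
      (Q := fun z : Fin N × ZMod M => f₁ z.1 z.2) (fun z => h₁ _ _) _).trans ?_)
    refine (norm_expect_le _ _).trans (expect_mono fun x => (norm_expect_le _ _).trans
      (expect_mono fun x' => ?_))
    rw [← Finset.univ_product_univ, Finset.expect_product, Finset.expect_comm]
    refine (norm_expect_le _ _).trans (expect_le_of_forall fun y => ?_)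
    have e2 : ∀ u : Fin N, f₀ x y * (c x * chi (a x * (y + disp M s x u ^ 2))) *
        conj (f₀ x' y * (c x' * chi (a x' * (y + disp M s x' u ^ 2))))
        = (f₀ x y * conj (f₀ x' y) * (c x * conj (c x')) * (chi (a x * y) * conj (chi (a x' * y))))
          * e ((((u : ℕ) : ℤ) - (x : ℕ) + s) ^ 2 • ZMod.toAddCircle (a x) -
      (((u : ℕ) : ℤ) - (x' : ℕ) + s) ^ 2 • ZMod.toAddCircle (a x')) := fun u => by
      have e3 : ∀ x : Fin N, chi (a x * (y + disp M s x u ^ 2)) = chi (a x * y) *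
          e ((((u : ℕ) : ℤ) - (x : ℕ) + s) ^ 2 • ZMod.toAddCircle (a x)) := fun x => by
        rw [← chi_mul_intCast, ← chi_add]
        congr 1
        rw [disp]; push_cast; ring
      rw [e3, e3, sub_eq_add_neg (_ • _), e_add, e_neg]
      simp only [map_mul]
      ring
    simp_rw [e2, ← Finset.mul_expect]
    rw [norm_mul]
    refine mul_le_mul_of_nonneg_right ?_ (norm_nonneg _)
    simp only [norm_mul, RCLike.norm_conj, norm_chi, mul_one]
    have i1 : ‖f₀ x y‖ * ‖f₀ x' y‖ ≤ 1 := mul_le_one₀ (h₀ _ _) (norm_nonneg _) (h₀ _ _)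
    have i2 : ‖c x‖ * ‖c x'‖ ≤ ‖c x'‖ := mul_le_of_le_one_left (norm_nonneg _) (hc x)
    calc ‖f₀ x y‖ * ‖f₀ x' y‖ * (‖c x‖ * ‖c x'‖) ≤ 1 * ‖c x'‖ := by gcongr
      _ = _ := one_mul _
  rw [Finset.expect_comm] at h1
  obtain ⟨x', hx'⟩ := exists_le_of_le_expect' h1
  rw [← Finset.mul_expect] at hx'
  have hcx : c x' ≠ 0 := fun h0 => by
    rw [h0, norm_zero, zero_mul] at hx'
    nlinarith [pow_pos hη 2]
  refine ⟨x', hcx, exists_major_of_phase_average hR hN (fun x => ZMod.toAddCircle (a x)) _ x' hs ?_⟩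
  have h2 : 0 ≤ 𝔼 x, P x x' := expect_nonneg' fun _ => norm_nonneg _
  have h3 : η ^ 2 ≤ 𝔼 x, P x x' := hx'.trans (mul_le_of_le_one_left h2 (hc x'))
  refine le_trans ?_ h3
  rw [div_le_iff₀ hR']
  exact hηR

/-- Frequencies outside the major arcs may be discarded. -/
theorem norm_cnt_lt_of_not_isMajor {R : ℕ} (hR : 1 ≤ R)
    (hN : 145 * (204 * R ^ 2 * (9280 * R ^ 8)) ^ 3 ≤ N) {s : ℤ} (hs : |s| ≤ N)
    {f₀ f₁ : Fin N → ZMod M → ℂ} (h₀ : ∀ x y, ‖f₀ x y‖ ≤ 1) (h₁ : ∀ x y, ‖f₁ x y‖ ≤ 1)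
    {c : Fin N → ℂ} (hc : ∀ x, ‖c x‖ ≤ 1) (a : Fin N → ZMod M) {η : ℝ} (hη : 0 < η)
    (hηR : 2 ≤ η ^ 2 * R) (hmaj : ∀ x, IsMajor N (majorBound R) (a x) → c x = 0) :
    ‖cnt s f₀ f₁ fun x y => c x * chi (a x * y)‖ < η := by
  by_contra hcon
  push Not at hcon
  obtain ⟨x, hx, hm⟩ := exists_isMajor_of_cnt hR hN hs h₀ h₁ hc a hη hηR hcon
  exact hx (hmaj x hm)

-- A union bound over denominators up to `Q`. Since `M ≤ B N²`, an arc of width of order `Q / N²`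
-- contains a number of frequencies bounded independently of `N`.
open Classical in
theorem card_isMajor_le {Q : ℕ} (hN : 0 < N) {B : ℕ} (hM : M ≤ B * N ^ 2) :
    ((Finset.univ.filter fun a : ZMod M => IsMajor N Q a).card : ℝ)
      ≤ Q * (Q * (2 * Q * B + 1)) := by
  have hN' : (0 : ℝ) < N := by exact_mod_cast hN
  have hM' : (M : ℝ) ≤ B * N ^ 2 := by exact_mod_cast hM
  have h1 : (Finset.univ.filter fun a : ZMod M => IsMajor N Q a) ⊆
      (Finset.Icc 1 Q).biUnion fun q => Finset.univ.filter fun a : ZMod M =>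
        ‖q • ZMod.toAddCircle a‖ ≤ Q / N ^ 2 := by
    intro a ha
    obtain ⟨q, hq1, hq2, hq3⟩ := (Finset.mem_filter.mp ha).2
    simp only [Finset.mem_biUnion, Finset.mem_Icc, Finset.mem_filter, Finset.mem_univ, true_and]
    exact ⟨q, ⟨hq1, hq2⟩, hq3⟩
  have h2 : ((Finset.univ.filter fun a : ZMod M => IsMajor N Q a).card : ℝ)
      ≤ ∑ q ∈ Finset.Icc 1 Q, ((Finset.univ.filter fun a : ZMod M =>
        ‖q • ZMod.toAddCircle a‖ ≤ Q / N ^ 2).card : ℝ) := by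
    exact_mod_cast (Finset.card_le_card h1).trans Finset.card_biUnion_le
  refine h2.trans ?_
  have h3 : ∀ q ∈ Finset.Icc 1 Q, ((Finset.univ.filter fun a : ZMod M =>
        ‖q • ZMod.toAddCircle a‖ ≤ Q / N ^ 2).card : ℝ) ≤ Q * (2 * Q * B + 1) := fun q hq => by
    rw [Finset.mem_Icc] at hq
    refine (card_norm_nsmul_le (by omega) _).trans ?_
    have hq' : (q : ℝ) ≤ Q := by exact_mod_cast hq.2
    rw [abs_of_nonneg (by positivity)]
    have h4 : 2 * ((Q : ℝ) / N ^ 2) * M ≤ 2 * Q * B := by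
      calc 2 * ((Q : ℝ) / N ^ 2) * (M : ℝ) ≤ 2 * ((Q : ℝ) / N ^ 2) * (B * N ^ 2) := by gcongr
        _ = 2 * (Q : ℝ) * B := by field_simp
    gcongr
  refine (Finset.sum_le_card_nsmul _ _ _ h3).trans ?_
  rw [nsmul_eq_mul, Nat.card_Icc, Nat.add_sub_cancel]

end MajorArcs

/-! ### From the `U³` norm of the dual function to one major-arc frequency -/

section Inverse

variable {M : ℕ} [NeZero M] {N : ℕ}

/-- For fixed `b, b'` the other two directions form the `U²` norm of the derivative, which is the
fourth moment of its Fourier coefficients. -/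
theorem boxNorm_id_id_id (F : ZMod M → ℂ) :
    boxNorm id id id F = 𝔼 b : ZMod M, 𝔼 b' : ZMod M, ∑ ξ, ‖dft (der b b' F) ξ‖ ^ 4 := by
  have h1 : boxNorm id id id F = 𝔼 b : ZMod M, 𝔼 b' : ZMod M, 𝔼 a : ZMod M, 𝔼 a' : ZMod M,
      𝔼 y : ZMod M, ‖𝔼 k, der a a' (der b b' F) (y + k)‖ ^ 2 := by
    unfold boxNorm
    simp_rw [id]
    calc _ = 𝔼 a : ZMod M, 𝔼 b : ZMod M, 𝔼 a' : ZMod M, 𝔼 b' : ZMod M,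
          𝔼 y : ZMod M, ‖𝔼 k, der a a' (der b b' F) (y + k)‖ ^ 2 :=
          Finset.expect_congr rfl fun _ _ => Finset.expect_comm _ _ _
      _ = 𝔼 b : ZMod M, 𝔼 a : ZMod M, 𝔼 a' : ZMod M, 𝔼 b' : ZMod M,
          𝔼 y : ZMod M, ‖𝔼 k, der a a' (der b b' F) (y + k)‖ ^ 2 := Finset.expect_comm _ _ _
      _ = 𝔼 b : ZMod M, 𝔼 a : ZMod M, 𝔼 b' : ZMod M, 𝔼 a' : ZMod M,
          𝔼 y : ZMod M, ‖𝔼 k, der a a' (der b b' F) (y + k)‖ ^ 2 :=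
          Finset.expect_congr rfl fun _ _ => Finset.expect_congr rfl fun _ _ =>
            Finset.expect_comm _ _ _
      _ = _ := Finset.expect_congr rfl fun _ _ => Finset.expect_comm _ _ _
  rw [h1]
  refine Finset.expect_congr rfl fun b _ => Finset.expect_congr rfl fun b' _ => ?_
  set G := der b b' F
  rw [← expect_normSq_autocorrelation, Finset.expect_comm]
  have h2 : ∀ a' : ZMod M, 𝔼 a : ZMod M, 𝔼 y : ZMod M, ‖𝔼 k, der a a' G (y + k)‖ ^ 2
      = 𝔼 h, ‖𝔼 y, G (y + h) * conj (G y)‖ ^ 2 := fun a' => by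
    rw [← expect_add_right _ a']
    refine Finset.expect_congr rfl fun h _ => ?_
    have h3 : ∀ y : ZMod M, 𝔼 k, der (h + a') a' G (y + k) = 𝔼 y, G (y + h) * conj (G y) :=
      fun y => by
        rw [← expect_add_right (fun z => G (z + h) * conj (G z)) (y + a')]
        refine Finset.expect_congr rfl fun k _ => ?_
        rw [der]
        congr 2
        · ring
        · congr 1; ring
    simp_rw [h3]
    simp
  simp_rw [h2]
  simp

/-- The correlation has Fourier transform `dft F ν * dft K (-ν)`; bound the first factor uniformly
and sum the second by Parseval. -/
theorem expect_normSq_correlation_le {F K : ZMod M → ℂ} (hK : ∀ y, ‖K y‖ ≤ 1) {m : ℝ}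
    (hm : ∀ ν, ‖dft F ν‖ ^ 2 ≤ m) : 𝔼 b, ‖𝔼 y, F (y + b) * K y‖ ^ 2 ≤ m := by
  have h1 : ∀ ν, dft (fun b => 𝔼 y, F (y + b) * K y) ν = dft F ν * dft K (-ν) := fun ν => by
    simp only [dft]
    rw [mul_comm, Finset.expect_mul_expect]
    simp_rw [Finset.expect_mul]
    rw [Finset.expect_comm]
    refine Finset.expect_congr rfl fun y _ => ?_
    rw [← expect_sub_right _ y]
    refine Finset.expect_congr rfl fun b _ => ?_
    rw [add_sub_cancel, mul_sub, sub_eq_add_neg, chi_add, neg_mul]; ring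
  have hm0 : 0 ≤ m := (by positivity : 0 ≤ ‖dft F 0‖ ^ 2).trans (hm 0)
  rw [← sum_normSq_dft]
  calc ∑ ν, ‖dft (fun b => 𝔼 y, F (y + b) * K y) ν‖ ^ 2 ≤ ∑ ν, m * ‖dft K (-ν)‖ ^ 2 :=
        Finset.sum_le_sum fun ν _ => by
          rw [h1, norm_mul, mul_pow]
          exact mul_le_mul_of_nonneg_right (hm ν) (by positivity)
    _ = m * ∑ ν, ‖dft K ν‖ ^ 2 := by
        rw [Finset.mul_sum]
        exact Fintype.sum_equiv (Equiv.neg _) _ _ fun ν => rfl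
    _ ≤ m := mul_le_of_le_one_right hm0 (sum_normSq_dft_le_one hK)

theorem exists_max_dft (F : ZMod M → ℂ) : ∃ ξ, ∀ ν, ‖dft F ν‖ ≤ ‖dft F ξ‖ := by
  obtain ⟨ξ, -, h⟩ := Finset.exists_max_image (Finset.univ : Finset (ZMod M)) (fun ν => ‖dft F ν‖)
    Finset.univ_nonempty
  exact ⟨ξ, fun ν => h ν (Finset.mem_univ _)⟩

theorem sum_dft_pow_four_le {F : ZMod M → ℂ} (hF : ∀ y, ‖F y‖ ≤ 1) {ξ : ZMod M}
    (hξ : ∀ ν, ‖dft F ν‖ ≤ ‖dft F ξ‖) : ∑ ν, ‖dft F ν‖ ^ 4 ≤ ‖dft F ξ‖ ^ 2 := by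
  calc ∑ ν, ‖dft F ν‖ ^ 4 ≤ ∑ ν, ‖dft F ξ‖ ^ 2 * ‖dft F ν‖ ^ 2 :=
        Finset.sum_le_sum fun ν _ => by
          rw [show ‖dft F ν‖ ^ 4 = ‖dft F ν‖ ^ 2 * ‖dft F ν‖ ^ 2 by ring]
          exact mul_le_mul_of_nonneg_right (pow_le_pow_left₀ (norm_nonneg _) (hξ ν) 2)
            (by positivity)
    _ = ‖dft F ξ‖ ^ 2 * ∑ ν, ‖dft F ν‖ ^ 2 := by rw [Finset.mul_sum]
    _ ≤ _ := mul_le_of_le_one_right (by positivity) (sum_normSq_dft_le_one hF)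

-- Splitting the coefficients by whether the frequency is major: by the contrapositive of
-- `exists_isMajor_of_cnt` the minor part contributes less than `η`.
open Classical in
theorem norm_cnt_le_major {R : ℕ} (hR : 1 ≤ R)
    (hN : 145 * (204 * R ^ 2 * (9280 * R ^ 8)) ^ 3 ≤ N) {s : ℤ} (hs : |s| ≤ N)
    {f₀ f₁ : Fin N → ZMod M → ℂ} (h₀ : ∀ x y, ‖f₀ x y‖ ≤ 1) (h₁ : ∀ x y, ‖f₁ x y‖ ≤ 1)
    {c : Fin N → ℂ} (hc : ∀ x, ‖c x‖ ≤ 1) (a : Fin N → ZMod M) {η : ℝ} (hη : 0 < η)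
    (hηR : 2 ≤ η ^ 2 * R) :
    ‖cnt s f₀ f₁ fun x y => c x * chi (a x * y)‖ ≤ η + ‖cnt s f₀ f₁ fun x y =>
      (if IsMajor N (majorBound R) (a x) then c x else 0) * chi (a x * y)‖ := by
  have h1 := norm_cnt_lt_of_not_isMajor hR hN hs h₀ h₁
    (c := fun x => if IsMajor N (majorBound R) (a x) then 0 else c x)
    (fun x => by split_ifs <;> simp [hc]) a hη hηR (fun x hx => by rw [if_pos hx])
  have h2 : cnt s f₀ f₁ (fun x y => c x * chi (a x * y)) =
      cnt s f₀ f₁ (fun x y => (if IsMajor N (majorBound R) (a x) then 0 else c x) *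
        chi (a x * y)) + cnt s f₀ f₁ (fun x y =>
          (if IsMajor N (majorBound R) (a x) then c x else 0) * chi (a x * y)) := by
    simp only [cnt, ← Finset.expect_add_distrib]
    refine Finset.expect_congr rfl fun x _ => Finset.expect_congr rfl fun u _ =>
      Finset.expect_congr rfl fun y _ => ?_
    split_ifs <;> ring
  rw [h2]
  exact (norm_add_le _ _).trans (add_le_add h1.le le_rfl)

theorem norm_cnt_le_expect {s : ℤ} {f₀ f₁ : Fin N → ZMod M → ℂ} (h₀ : ∀ x y, ‖f₀ x y‖ ≤ 1)
    (h₁ : ∀ x y, ‖f₁ x y‖ ≤ 1) (c : Fin N → ℂ) (a : Fin N → ZMod M) :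
    ‖cnt s f₀ f₁ fun x y => c x * chi (a x * y)‖ ≤ 𝔼 x, ‖c x‖ := by
  refine (norm_expect_le _ _).trans (expect_mono fun x => ?_)
  have : Nonempty (Fin N) := ⟨x⟩
  refine (norm_expect_le _ _).trans (expect_le_of_forall fun u =>
    (norm_expect_le _ _).trans (expect_le_of_forall fun y => ?_))
  rw [norm_mul, norm_mul, norm_mul, norm_chi, mul_one]
  exact mul_le_of_le_one_left (norm_nonneg _)
    (mul_le_one₀ (h₀ _ _) (norm_nonneg _) (h₁ _ _))

/-- A dual function with large `U³` norm has large Fourier coefficients. -/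
theorem exists_large_dft {R B : ℕ} (hR : 1 ≤ R)
    (hN : 145 * (204 * R ^ 2 * (9280 * R ^ 8)) ^ 3 ≤ N) (hM : M ≤ B * N ^ 2) {s : ℤ}
    (hs : |s| ≤ N) {f₀ f₁ : Fin N → ZMod M → ℂ} (h₀ : ∀ x y, ‖f₀ x y‖ ≤ 1)
    (h₁ : ∀ x y, ‖f₁ x y‖ ≤ 1) {η : ℝ} (hη : 0 < η) (hηR : 8 ≤ η ^ 4 * R)
    (h : η ≤ 𝔼 x, boxNorm id id id (dual s f₀ f₁ x)) :
    ∃ α : Fin N → ZMod M, η ^ 4 / 4 ≤ (majorBound R * (majorBound R * (2 * majorBound R * B + 1))) *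
      𝔼 x, ‖dft (dual s f₀ f₁ x) (α x)‖ ^ 2 := by
  classical
  have hN0 : 0 < N := lt_of_lt_of_le (by positivity) hN
  have : Nonempty (Fin N) := ⟨⟨0, hN0⟩⟩
  set F := dual s f₀ f₁ with hF
  have hF1 : ∀ x y, ‖F x y‖ ≤ 1 := norm_dual_le h₀ h₁
  choose φ' hφ' using fun (x : Fin N) (b b' : ZMod M) => exists_max_dft (der b b' (F x))
  obtain ⟨b₀, hb₀⟩ : ∃ b₀, η ≤ 𝔼 x, 𝔼 b, ‖dft (der b b₀ (F x)) (φ' x b b₀)‖ ^ 2 := by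
    have h1 : η ≤ 𝔼 x, 𝔼 b, 𝔼 b', ‖dft (der b b' (F x)) (φ' x b b')‖ ^ 2 := by
      refine h.trans (expect_mono fun x => ?_)
      rw [boxNorm_id_id_id]
      exact expect_mono fun b => expect_mono fun b' =>
        sum_dft_pow_four_le (fun y => norm_der_le (hF1 x) y) (hφ' x b b')
    have e1 : 𝔼 x, 𝔼 b, 𝔼 b', ‖dft (der b b' (F x)) (φ' x b b')‖ ^ 2
        = 𝔼 b', 𝔼 x, 𝔼 b, ‖dft (der b b' (F x)) (φ' x b b')‖ ^ 2 := by
      rw [Finset.expect_comm (t := (Finset.univ : Finset (Fin N)))]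
      exact Finset.expect_congr rfl fun _ _ => Finset.expect_comm _ _ _
    rw [e1] at h1
    exact exists_le_of_le_expect' h1
  set φ : Fin N → ZMod M → ZMod M := fun x b => φ' x b b₀
  set lam : Fin N → ZMod M → ℂ := fun x b => dft (der b b₀ (F x)) (φ x b) with hlam
  have hlam1 : ∀ x b, ‖lam x b‖ ≤ 1 := fun x b => norm_dft_le_one (fun y => norm_der_le (hF1 x) y) _
  set H : Fin N → ZMod M → ℂ := fun x y => conj (F x (y + b₀)) with hH
  have hH1 : ∀ x y, ‖H x y‖ ≤ 1 := fun x y => norm_conj_le_one (hF1 _ _)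
  -- interchanging the roles of the variables
  set P : ZMod M → ZMod M → ℂ := fun b b' => cnt s (fun x => der b b' (f₀ x))
    (fun x => der b b' (f₁ x)) (fun x y => (conj (lam x b) * lam x b') *
      chi ((φ x b - φ x b') * y)) with hP
  -- Only one of the two copies of `F` is expanded. The other, `H`, does not involve `b`, so
  -- Cauchy-Schwarz over `(x, u, y)` removes it and doubles `b`, producing counts with frequencies
  -- `φ x b - φ x b'`.
  have h2 : η ^ 2 ≤ 𝔼 b, 𝔼 b', ‖P b b'‖ := by
    have e1 : ((𝔼 x, 𝔼 b, ‖lam x b‖ ^ 2 : ℝ) : ℂ) = 𝔼 b, 𝔼 z : Fin N × Fin N × ZMod M,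
        (dualTerm s f₀ f₁ z.1 z.2.1 (z.2.2 + b) * conj (lam z.1 b) * chi (φ z.1 b * z.2.2)) *
          H z.1 z.2.2 := by
      rw [ofReal_expect]
      conv_rhs => rw [Finset.expect_comm]
      simp_rw [ofReal_expect]
      rw [← Finset.univ_product_univ, Finset.expect_product]
      refine Finset.expect_congr rfl fun x _ => ?_
      conv_rhs => rw [Finset.expect_comm]
      refine Finset.expect_congr rfl fun b _ => ?_
      rw [← Finset.univ_product_univ, Finset.expect_product, Finset.expect_comm, normSq_eq]
      conv_lhs => rw [hlam]
      simp only [dft]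
      rw [Finset.expect_mul]
      refine Finset.expect_congr rfl fun y _ => ?_
      simp only [der, hF, hH]
      rw [dual]
      simp_rw [Finset.expect_mul]
      refine Finset.expect_congr rfl fun u _ => ?_
      simp only [hlam, dft, der, hF]
      ring
    have h3 : η ≤ ‖((𝔼 x, 𝔼 b, ‖lam x b‖ ^ 2 : ℝ) : ℂ)‖ := by
      rw [Complex.norm_real]; exact hb₀.trans (Real.le_norm_self _)
    rw [e1] at h3
    refine (pow_le_pow_left₀ hη.le h3 2).trans ((normSq_expect_expect_le
      (Q := fun z : Fin N × Fin N × ZMod M => H z.1 z.2.2) (fun z => hH1 _ _) _).trans ?_)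
    refine (norm_expect_le _ _).trans (expect_mono fun b => (norm_expect_le _ _).trans
      (expect_mono fun b' => le_of_eq ?_))
    congr 1
    simp only [hP]
    rw [cnt_eq_expect_dualTerm, ← Finset.univ_product_univ, Finset.expect_product]
    refine Finset.expect_congr rfl fun x _ => ?_
    rw [← Finset.univ_product_univ, Finset.expect_product]
    refine Finset.expect_congr rfl fun u _ => Finset.expect_congr rfl fun y _ => ?_
    have e2 : ∀ a : ZMod M, y - disp M s x u ^ 2 + a = y + a - disp M s x u ^ 2 :=
      fun a => by ring
    rw [sub_mul, sub_eq_add_neg, chi_add, chi_neg]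
    simp only [dualTerm, der, e2, map_mul, Complex.conj_conj]
    ring
  -- removing the minor arcs
  set maj : ZMod M → Prop := IsMajor N (majorBound R) with hmaj
  have h4 : η ^ 2 / 2 ≤ 𝔼 x, 𝔼 b', 𝔼 b, (if maj (φ x b - φ x b') then ‖lam x b‖ else 0) := by
    have h5 : ∀ b b', ‖P b b'‖ ≤ η ^ 2 / 2 +
        𝔼 x, (if maj (φ x b - φ x b') then ‖lam x b‖ else 0) := fun b b' => by
      refine (norm_cnt_le_major hR hN hs (fun x y => norm_der_le (h₀ x) y)
        (fun x y => norm_der_le (h₁ x) y)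
        (fun x => norm_mul_le_one' (norm_conj_le_one (hlam1 x b)) (hlam1 x b'))
        (fun x => φ x b - φ x b') (η := η ^ 2 / 2) (by positivity) (by nlinarith)).trans ?_
      refine add_le_add le_rfl ((norm_cnt_le_expect (fun x y => norm_der_le (h₀ x) y)
        (fun x y => norm_der_le (h₁ x) y) _ _).trans (expect_mono fun x => ?_))
      split_ifs with hh
      · rw [norm_mul, RCLike.norm_conj]
        exact mul_le_of_le_one_right (norm_nonneg _) (hlam1 _ _)
      · simp
    have h6 := h2.trans (expect_mono fun b => expect_mono fun b' => h5 b b')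
    simp_rw [Finset.expect_add_distrib, Finset.expect_const Finset.univ_nonempty] at h6
    have e1 : 𝔼 b, 𝔼 b', 𝔼 x, (if maj (φ x b - φ x b') then ‖lam x b‖ else 0)
        = 𝔼 x, 𝔼 b', 𝔼 b, (if maj (φ x b - φ x b') then ‖lam x b‖ else 0) := by
      rw [Finset.expect_comm]
      conv_rhs => rw [Finset.expect_comm]
      exact Finset.expect_congr rfl fun _ _ => Finset.expect_comm _ _ _
    rw [e1] at h6
    linarith
  -- Choosing the best `b'` for each `x` shows that many `φ x b` lie in a single translate of the
  -- major-arc set.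
  choose bx hbx using fun x => exists_le_of_le_expect' (le_refl
    (𝔼 b', 𝔼 b, (if maj (φ x b - φ x b') then ‖lam x b‖ else 0)))
  set ω : Fin N → ZMod M := fun x => φ x (bx x) with hω
  have h5 : (η ^ 2 / 2) ^ 2 ≤
      𝔼 x, 𝔼 b, (if maj (φ x b - ω x) then ‖lam x b‖ else 0) ^ 2 := by
    have hnn : ∀ x b, 0 ≤ (if maj (φ x b - ω x) then ‖lam x b‖ else 0) := fun x b => by
      split_ifs <;> simp
    refine (pow_le_expect_pow (fun x => expect_nonneg' (hnn x)) (by positivity)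
      (h4.trans (expect_mono hbx)) 2).trans (expect_mono fun x => pow_expect_le (hnn x) 2)
  choose α hα using fun x => exists_max_dft (F x)
  refine ⟨α, ?_⟩
  set Maj := Finset.univ.filter fun a : ZMod M => maj a with hMaj
  -- The unknown dependence of `φ x b` on `b` is removed by summing over all `ζ` in the bounded set
  -- `Maj`. For each fixed `ζ` the average over `b` is a correlation, bounded by the largest Fourier
  -- coefficient of `F x`.
  have h6 : ∀ x, 𝔼 b, (if maj (φ x b - ω x) then ‖lam x b‖ else 0) ^ 2
      ≤ Maj.card * ‖dft (F x) (α x)‖ ^ 2 := fun x => by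
    have i1 : ∀ b, (if maj (φ x b - ω x) then ‖lam x b‖ else 0) ^ 2 ≤
        ∑ ζ ∈ Maj, ‖𝔼 y, F x (y + b) * (H x y * chi ((ω x + ζ) * y))‖ ^ 2 := fun b => by
      split_ifs with hh
      · have e1 : ‖lam x b‖ ^ 2 = ‖𝔼 y, F x (y + b) *
            (H x y * chi ((ω x + (φ x b - ω x)) * y))‖ ^ 2 := by
          simp only [hlam, dft, der, hH, add_sub_cancel, mul_assoc]
        rw [e1]
        exact Finset.single_le_sum (f := fun ζ => ‖𝔼 y, F x (y + b) *
          (H x y * chi ((ω x + ζ) * y))‖ ^ 2) (fun _ _ => by positivity)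
          (Finset.mem_filter.mpr ⟨Finset.mem_univ _, hh⟩)
      · rw [zero_pow two_ne_zero]
        exact Finset.sum_nonneg fun _ _ => by positivity
    refine (expect_mono i1).trans ?_
    rw [Finset.expect_sum_comm, ← nsmul_eq_mul]
    refine Finset.sum_le_card_nsmul _ _ _ fun ζ _ => ?_
    refine expect_normSq_correlation_le (fun y => norm_mul_le_one' (hH1 x y) (norm_chi _).le)
      fun ν => pow_le_pow_left₀ (norm_nonneg _) (hα x ν) 2
  have h7 := h5.trans (expect_mono h6)
  rw [← Finset.mul_expect] at h7
  have h8 := card_isMajor_le (M := M) (Q := majorBound R) hN0 hM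
  refine le_trans (le_of_eq (by ring)) (h7.trans (mul_le_mul_of_nonneg_right ?_
    (expect_nonneg' fun _ => by positivity)))
  exact h8

/-- A dual function with large Fourier coefficients yields a single major-arc frequency. -/
theorem exists_major_frequency {R B : ℕ} (hR : 1 ≤ R)
    (hN : 145 * (204 * R ^ 2 * (9280 * R ^ 8)) ^ 3 ≤ N) (hM : M ≤ B * N ^ 2) {s : ℤ}
    (hs : |s| ≤ N) {f₀ f₁ : Fin N → ZMod M → ℂ} (h₀ : ∀ x y, ‖f₀ x y‖ ≤ 1)
    (h₁ : ∀ x y, ‖f₁ x y‖ ≤ 1) {η : ℝ} (hη : 0 < η) (hηR : 8 ≤ η ^ 2 * R) (α : Fin N → ZMod M)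
    (h : η ≤ 𝔼 x, ‖dft (dual s f₀ f₁ x) (α x)‖ ^ 2) :
    ∃ a : ZMod M, IsMajor N (majorBound R) a ∧
      η / 2 ≤ (majorBound R * (majorBound R * (2 * majorBound R * B + 1))) *
      𝔼 x, 𝔼 y, ‖f₀ x y‖ * ‖𝔼 u : Fin N, f₁ u y * chi (a * disp M s x u ^ 2)‖ := by
  classical
  have hN0 : 0 < N := lt_of_lt_of_le (by positivity) hN
  have : Nonempty (Fin N) := ⟨⟨0, hN0⟩⟩
  set lam : Fin N → ℂ := fun x => dft (dual s f₀ f₁ x) (α x) with hlam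
  have hlam1 : ∀ x, ‖lam x‖ ≤ 1 := fun x => norm_dft_le_one (norm_dual_le h₀ h₁ x) _
  have h1 : η ≤ ‖cnt s f₀ f₁ fun x y => conj (lam x) * chi (α x * y)‖ := by
    -- The mean square of the Fourier coefficients is itself a count whose last function is a
    -- character, so minor frequencies `α x` may be dropped.
    have e1 : cnt s f₀ f₁ (fun x y => conj (lam x) * chi (α x * y))
        = ((𝔼 x, ‖lam x‖ ^ 2 : ℝ) : ℂ) := by
      rw [cnt_eq_expect_dual, ofReal_expect]
      refine Finset.expect_congr rfl fun x _ => ?_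
      rw [normSq_eq]
      conv_rhs => rw [hlam]
      simp only [dft]
      rw [Finset.expect_mul]
      refine Finset.expect_congr rfl fun y _ => ?_
      simp only [hlam, dft]
      ring
    rw [e1, Complex.norm_real]
    exact h.trans (Real.le_norm_self _)
  have h2 := h1.trans (norm_cnt_le_major hR hN hs h₀ h₁
    (fun x => norm_conj_le_one (hlam1 x)) α (η := η / 2) (by positivity) (by linarith))
  set maj : ZMod M → Prop := IsMajor N (majorBound R) with hmaj
  set Maj := Finset.univ.filter fun a : ZMod M => maj a with hMaj
  set G : ZMod M → ℝ := fun a => 𝔼 x, 𝔼 y, ‖f₀ x y‖ *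
    ‖𝔼 u : Fin N, f₁ u y * chi (a * disp M s x u ^ 2)‖ with hG
  -- The frequency still depends on `x`; summing over all major `a` removes this dependence, and the
  -- largest term then supplies a single `a`.
  have h3 : η / 2 ≤ ∑ a ∈ Maj, G a := by
    have h4 : η / 2 ≤ ‖cnt s f₀ f₁ fun x y =>
      (if maj (α x) then conj (lam x) else 0) * chi (α x * y)‖ := by linarith
    refine h4.trans ?_
    have e1 : cnt s f₀ f₁ (fun x y => (if maj (α x) then conj (lam x) else 0) * chi (α x * y))
        = 𝔼 x, 𝔼 y, (if maj (α x) then conj (lam x) else 0) * (f₀ x y * (chi (α x * y) *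
          𝔼 u : Fin N, f₁ u y * chi (α x * disp M s x u ^ 2))) := by
      refine Finset.expect_congr rfl fun x _ => ?_
      rw [Finset.expect_comm]
      refine Finset.expect_congr rfl fun y _ => ?_
      simp_rw [Finset.mul_expect]
      refine Finset.expect_congr rfl fun u _ => ?_
      rw [mul_add, chi_add]; ring
    rw [e1]
    simp only [hG]
    rw [← Finset.expect_sum_comm]
    refine (norm_expect_le _ _).trans (expect_mono fun x => ?_)
    by_cases hx : maj (α x)
    · refine le_trans ?_ (Finset.single_le_sum (f := fun a => 𝔼 y, ‖f₀ x y‖ *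
        ‖𝔼 u : Fin N, f₁ u y * chi (a * disp M s x u ^ 2)‖) (fun a _ => expect_nonneg' fun y => by
          positivity) (Finset.mem_filter.mpr ⟨Finset.mem_univ _, hx⟩ : α x ∈ Maj))
      refine (norm_expect_le _ _).trans (expect_mono fun y => ?_)
      rw [if_pos hx, norm_mul, norm_mul, norm_mul, norm_chi, one_mul]
      exact mul_le_of_le_one_left (by positivity) (norm_conj_le_one (hlam1 x))
    · simp only [if_neg hx, zero_mul, Finset.expect_const_zero, norm_zero]
      exact Finset.sum_nonneg fun a _ => expect_nonneg' fun y => by positivity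
  have hne : Maj.Nonempty := by
    by_contra hcon
    rw [Finset.not_nonempty_iff_eq_empty.mp hcon, Finset.sum_empty] at h3
    linarith
  obtain ⟨a, ha, hmax⟩ := Finset.exists_max_image Maj G hne
  refine ⟨a, (Finset.mem_filter.mp ha).2, ?_⟩
  have hG0 : 0 ≤ G a := expect_nonneg' fun x => expect_nonneg' fun y => by positivity
  calc η / 2 ≤ Maj.card * G a := by
        rw [← nsmul_eq_mul]
        exact h3.trans (Finset.sum_le_card_nsmul _ _ _ hmax)
    _ ≤ _ := mul_le_mul_of_nonneg_right (card_isMajor_le (M := M) (Q := majorBound R) hN0 hM) hG0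

end Inverse

/-! ### Integer representatives of residue classes -/

section Representatives

variable {L : ℕ} [NeZero L]

/-- The representative of a residue class in `[A, A + L)`. -/
def rep (A : ℤ) (z : ZMod L) : ℤ := ((z - A).val : ℤ) + A

@[simp] theorem intCast_rep (A : ℤ) (z : ZMod L) : ((rep A z : ℤ) : ZMod L) = z := by
  simp [rep]

theorem rep_mem (A : ℤ) (z : ZMod L) : rep A z ∈ Finset.Ico A (A + L) := by
  have := ZMod.val_lt (z - (A : ZMod L))
  simp only [rep, Finset.mem_Ico]
  omega

theorem rep_intCast {A n : ℤ} (hn : n ∈ Finset.Ico A (A + L)) : rep A (n : ZMod L) = n := by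
  rw [Finset.mem_Ico] at hn
  rw [rep, ← Int.cast_sub, ZMod.val_intCast, Int.emod_eq_of_lt (by omega) (by omega)]
  omega

theorem sum_rep {E : Type*} [AddCommMonoid E] (A : ℤ) (h : ℤ → E) :
    ∑ z : ZMod L, h (rep A z) = ∑ n ∈ Finset.Ico A (A + L), h n :=
  Finset.sum_bij' (fun z _ => rep A z) (fun n _ => (n : ZMod L)) (fun z _ => rep_mem A z)
    (fun _ _ => Finset.mem_univ _) (fun z _ => intCast_rep A z) (fun _ hn => rep_intCast hn)
    (fun _ _ => rfl)

end Representatives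

/-! ### From a major-arc quadratic phase to a linear phase -/

section LinearPhase

/-- A quadratic exponential sum with major-arc phase is controlled by averages along short
progressions. -/
theorem norm_sum_quadratic_le {N T q Q : ℕ} (hN : 0 < N) (hT : 0 < T) (hqQ : q ≤ Q)
    (hqT : q * T ≤ N) {θ : UnitAddCircle} (hθ : ‖q • θ‖ ≤ Q / N ^ 2) {φ : ℤ → ℂ}
    (hφ : ∀ u, ‖φ u‖ ≤ 1) {c : ℤ} (hc : -2 * N ≤ c) (hc' : c ≤ N) :
    ‖∑ u ∈ Finset.Ico (0 : ℤ) N, φ u * e ((u + c) ^ 2 • θ)‖ ≤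
      (∑ u ∈ Finset.Ico (0 : ℤ) N, ‖𝔼 t : Fin T, φ (u + q * (t : ℕ))‖) + 37 * Q * T := by
  have hNR : (0 : ℝ) < N := by exact_mod_cast hN
  have : Nonempty (Fin T) := ⟨⟨0, hT⟩⟩
  have hqQ' : (q : ℝ) ≤ Q := by exact_mod_cast hqQ
  have hqT' : (q : ℝ) * T ≤ N := by exact_mod_cast hqT
  set ψ : ℤ → ℂ := fun u => φ u * e ((u + c) ^ 2 • θ) with hψ
  set S : ℂ := ∑ u ∈ Finset.Ico (0 : ℤ) N, e ((u + c) ^ 2 • θ) *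
    𝔼 t : Fin T, φ (u + q * (t : ℕ)) with hS
  have h1 : ∀ t : Fin T, ‖∑ u ∈ Finset.Ico (0 : ℤ) N, ψ u -
      ∑ u ∈ Finset.Ico (0 : ℤ) N, e ((u + c) ^ 2 • θ) * φ (u + q * (t : ℕ))‖ ≤ 37 * Q * T := by
    intro t
    have ht : ((t : ℕ) : ℝ) ≤ T := by exact_mod_cast t.2.le
    have i1 := norm_sum_shift_sub_le (φ := ψ) (fun u => by simp [hψ, norm_e, hφ]) 0 N
      (t := (q : ℤ) * (t : ℕ)) (by positivity)
    have i2 : ‖∑ u ∈ Finset.Ico (0 : ℤ) N, ψ (u + q * (t : ℕ)) -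
        ∑ u ∈ Finset.Ico (0 : ℤ) N, e ((u + c) ^ 2 • θ) * φ (u + q * (t : ℕ))‖
        ≤ 35 * Q * T := by
      rw [← Finset.sum_sub_distrib]
      refine (norm_sum_le _ _).trans ((Finset.sum_le_card_nsmul _ _ (35 * Q * T / N : ℝ)
        fun u hu => ?_).trans (le_of_eq ?_))
      · rw [Finset.mem_Ico] at hu
        have e1 : ψ (u + q * (t : ℕ)) - e ((u + c) ^ 2 • θ) * φ (u + q * (t : ℕ))
            = φ (u + q * (t : ℕ)) * e ((u + c) ^ 2 • θ) *
              (e ((2 * (u + c) * (t : ℕ) + q * (t : ℕ) ^ 2) • q • θ) - 1) := by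
          -- The increment of the square is divisible by `q`, so the phase changes by a multiple, of
          -- size at most `5 N T`, of `q θ`. This yields the error `7 · 5 Q T`, to which the
          -- boundary terms add `2 Q T`.
          have : (u + q * (t : ℕ) + c) ^ 2 • θ = (u + c) ^ 2 • θ +
              (2 * (u + c) * (t : ℕ) + q * (t : ℕ) ^ 2) • q • θ := by
            rw [← natCast_zsmul θ q, smul_smul, ← add_smul]
            congr 1
            ring
          rw [hψ]
          simp only []
          rw [this, e_add]
          ring
        rw [e1, norm_mul, norm_mul, norm_e, mul_one]
        refine (mul_le_of_le_one_left (norm_nonneg _) (hφ _)).trans ?_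
        refine ((norm_e_sub_one _).2).trans ?_
        have i3 := norm_zsmul_le' (2 * (u + c) * (t : ℕ) + q * (t : ℕ) ^ 2) (q • θ)
        have i4 : |((2 * (u + c) * (t : ℕ) + q * (t : ℕ) ^ 2 : ℤ) : ℝ)| ≤ 5 * N * T := by
          have j1 : |((u : ℝ) + c)| ≤ 2 * N := by
            rw [← Int.cast_add, ← Int.cast_abs]
            have : |u + c| ≤ 2 * N := by rw [abs_le]; omega
            exact_mod_cast this
          push_cast
          have j2 : |2 * ((u : ℝ) + c) * (t : ℕ)| ≤ 4 * N * T := by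
            rw [abs_mul, abs_mul, abs_two, Nat.abs_cast]
            have := mul_le_mul j1 ht (by positivity) (by positivity)
            linarith
          have j3 : |(q : ℝ) * (t : ℕ) ^ 2| ≤ N * T := by
            rw [abs_of_nonneg (by positivity)]
            have : (q : ℝ) * (t : ℕ) ≤ N :=
              (mul_le_mul_of_nonneg_left ht (by positivity)).trans hqT'
            have := mul_le_mul this ht (by positivity) (by positivity)
            linarith
          exact (abs_add_le _ _).trans (by linarith)
        have i5 := mul_le_mul i4 hθ (norm_nonneg _) (by positivity)
        have e2 : (5 * N * T : ℝ) * (Q / N ^ 2) = 5 * Q * T / N := by field_simp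
        rw [e2] at i5
        have e3 : (35 * Q * T / N : ℝ) = 7 * (5 * Q * T / N) := by ring
        rw [e3]
        linarith
      · rw [nsmul_eq_mul]
        simp only [Int.card_Ico, sub_zero, Int.toNat_natCast]
        field_simp
    push_cast at i1
    have i6 : (2 : ℝ) * (q * (t : ℕ)) ≤ 2 * Q * T := by
      have := mul_le_mul hqQ' ht (by positivity) (by positivity)
      linarith
    have := norm_sub_le_norm_sub_add_norm_sub (∑ u ∈ Finset.Ico (0 : ℤ) N, ψ u)
      (∑ u ∈ Finset.Ico (0 : ℤ) N, ψ (u + q * (t : ℕ)))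
      (∑ u ∈ Finset.Ico (0 : ℤ) N, e ((u + c) ^ 2 • θ) * φ (u + q * (t : ℕ)))
    linarith
  have h2 : ‖∑ u ∈ Finset.Ico (0 : ℤ) N, ψ u - S‖ ≤ 37 * Q * T := by
    have e1 : ∑ u ∈ Finset.Ico (0 : ℤ) N, ψ u - S = 𝔼 t : Fin T,
        (∑ u ∈ Finset.Ico (0 : ℤ) N, ψ u -
          ∑ u ∈ Finset.Ico (0 : ℤ) N, e ((u + c) ^ 2 • θ) * φ (u + q * (t : ℕ))) := by
      rw [Finset.expect_sub_distrib, Finset.expect_const Finset.univ_nonempty,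
        Finset.expect_sum_comm, hS]
      simp_rw [Finset.mul_expect]
    rw [e1]
    exact (norm_expect_le _ _).trans (expect_le_of_forall h1)
  have h3 : ‖S‖ ≤ ∑ u ∈ Finset.Ico (0 : ℤ) N, ‖𝔼 t : Fin T, φ (u + q * (t : ℕ))‖ := by
    refine (norm_sum_le _ _).trans (Finset.sum_le_sum fun u _ => ?_)
    rw [norm_mul, norm_e, one_mul]
  have h4 := norm_add_le (∑ u ∈ Finset.Ico (0 : ℤ) N, ψ u - S) S
  rw [sub_add_cancel] at h4
  linarith

/-- Averages along short progressions of common difference `q` see only frequencies `ξ` for which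
`q ξ` is close to an integer. -/
theorem expect_normSq_progression_le {L T q : ℕ} [NeZero L] (hT : 0 < T) {c : ℝ} (hc : 0 < c)
    {G : ZMod L → ℂ} (hG : ∀ z, ‖G z‖ ≤ 1) :
    𝔼 z, ‖𝔼 t : Fin T, G (z + ((q * (t : ℕ) : ℤ) : ZMod L))‖ ^ 2 ≤
      (∑ ξ with ‖q • ZMod.toAddCircle (N := L) ξ‖ ≤ c, ‖dft G ξ‖) + (1 / (2 * T * c)) ^ 2 := by
  have hTR : (0 : ℝ) < T := by exact_mod_cast hT
  have : Nonempty (Fin T) := ⟨⟨0, hT⟩⟩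
  -- The progression average is a Fourier multiplier whose symbol is a geometric sum in `q ξ`, hence
  -- at most `1 / (2 T c)` unless `q ξ` is within `c` of an integer.
  set D : ZMod L → ℂ := fun ξ => 𝔼 t : Fin T, chi (-(ξ * ((q * (t : ℕ) : ℤ) : ZMod L))) with hD
  rw [← sum_normSq_dft]
  have h1 : ∀ ξ, dft (fun z => 𝔼 t : Fin T, G (z + ((q * (t : ℕ) : ℤ) : ZMod L))) ξ
      = D ξ * dft G ξ := fun ξ => by
    rw [dft_expect, hD, Finset.expect_mul]
    exact Finset.expect_congr rfl fun t _ => dft_shift _ _ _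
  simp_rw [h1]
  rw [← Finset.sum_filter_add_sum_filter_not Finset.univ
    (fun ξ : ZMod L => ‖q • ZMod.toAddCircle ξ‖ ≤ c)]
  refine add_le_add (Finset.sum_le_sum fun ξ _ => ?_) ?_
  · have i1 : ‖D ξ‖ ≤ 1 := norm_expect_le_one fun t => (norm_chi _).le
    have i2 := norm_dft_le_one hG ξ
    rw [norm_mul]
    calc (‖D ξ‖ * ‖dft G ξ‖) ^ 2 ≤ (1 * ‖dft G ξ‖) ^ 2 := by gcongr
      _ = ‖dft G ξ‖ * ‖dft G ξ‖ := by ring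
      _ ≤ _ := mul_le_of_le_one_left (norm_nonneg _) i2
  · calc _ ≤ ∑ ξ with ¬ ‖q • ZMod.toAddCircle (N := L) ξ‖ ≤ c,
          (1 / (2 * T * c)) ^ 2 * ‖dft G ξ‖ ^ 2 := by
          refine Finset.sum_le_sum fun ξ hξ => ?_
          rw [norm_mul, mul_pow]
          refine mul_le_mul_of_nonneg_right (pow_le_pow_left₀ (norm_nonneg _) ?_ 2) (by positivity)
          rw [Finset.mem_filter, not_le] at hξ
          have j1 := norm_geom_sum_mul_le (q • ZMod.toAddCircle ξ) 0 T
          rw [← sum_fin_eq_sum_Ico T (fun n : ℤ => e (n • q • ZMod.toAddCircle ξ))] at j1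
          have j2 : ‖D ξ‖ = ‖∑ t : Fin T, e (((t : ℕ) : ℤ) • q • ZMod.toAddCircle ξ)‖ / T := by
            have : D ξ = conj ((∑ t : Fin T, e (((t : ℕ) : ℤ) • q • ZMod.toAddCircle ξ)) / T) := by
              rw [hD]
              simp only []
              rw [Finset.expect_eq_sum_div_card, Finset.card_univ, Fintype.card_fin, map_div₀,
                map_sum, Complex.conj_natCast]
              congr 1
              refine Finset.sum_congr rfl fun t _ => ?_
              rw [chi_neg, chi_mul_intCast, ← natCast_zsmul (ZMod.toAddCircle ξ) q, smul_smul,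
                mul_comm]
            rw [this, RCLike.norm_conj, norm_div, Complex.norm_natCast]
          rw [j2, div_le_div_iff₀ hTR (by positivity), one_mul]
          have j3 : ‖∑ t : Fin T, e (((t : ℕ) : ℤ) • q • ZMod.toAddCircle ξ)‖ * (2 * c) ≤ 1 :=
            (mul_le_mul_of_nonneg_left (by linarith [hξ.2]) (norm_nonneg _)).trans j1
          nlinarith
      _ ≤ ∑ ξ, (1 / (2 * T * c)) ^ 2 * ‖dft G ξ‖ ^ 2 :=
          Finset.sum_le_univ_sum_of_nonneg fun ξ => by positivity
      _ ≤ _ := by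
          rw [← Finset.mul_sum]
          exact mul_le_of_le_one_right (by positivity) (sum_normSq_dft_le_one hG)

/-- Functions with large averages along short progressions of common difference `q` correlate with
a common linear phase `β`, with `q β` close to an integer. -/
theorem exists_linear_phase {ι : Type*} {N T q : ℕ} (hN : 0 < N) (hT : 0 < T) (hq : 0 < q)
    (hqT : q * T ≤ N) {Y : Finset ι} (hY : Y.Nonempty) {f : ℤ → ι → ℂ} (hf : ∀ n y, ‖f n y‖ ≤ 1)
    {κ : ℝ} (hκ : 0 < κ)
    (h : κ * N * Y.card ≤ ∑ y ∈ Y, ∑ n ∈ Finset.Icc (-(N : ℤ)) (2 * N), ‖𝔼 t : Fin T,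
      (if n + q * (t : ℕ) ≤ 2 * N then f (n + q * (t : ℕ)) y else 0)‖) :
    ∃ β : UnitAddCircle, ‖q • β‖ ≤ 4 / (T * κ) ∧
      κ ^ 2 / 40 ≤ q * (40 * N / (T * κ) + 1) *
        𝔼 y ∈ Y, ‖𝔼 n ∈ Finset.Icc (-(N : ℤ)) (2 * N), f n y * e (n • β)‖ := by
  have hNR : (0 : ℝ) < N := by exact_mod_cast hN
  have hTR : (0 : ℝ) < T := by exact_mod_cast hT
  have hYR : (0 : ℝ) < Y.card := by exact_mod_cast hY.card_pos
  -- Representatives in `[-N, 4N)` leave room for `n ≤ 2N` shifted by `q t ≤ N`, so nothing wraps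
  -- around. The cutoff at `2N` makes the Fourier transform a sum over `[-N, 2N]` alone.
  have : NeZero (5 * N) := ⟨by omega⟩
  have : Nonempty (Fin T) := ⟨⟨0, hT⟩⟩
  set I := Finset.Icc (-(N : ℤ)) (2 * N) with hI
  set g : ι → ℤ → ℂ := fun y n => if n ≤ 2 * N then f n y else 0 with hg
  set G : ι → ZMod (5 * N) → ℂ := fun y z => g y (rep (-(N : ℤ)) z) with hG
  have hg1 : ∀ y n, ‖g y n‖ ≤ 1 := fun y n => by
    simp only [hg]; split_ifs <;> simp [hf]
  have hG1 : ∀ y z, ‖G y z‖ ≤ 1 := fun y z => hg1 _ _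
  set A : ι → ℤ → ℝ := fun y n => ‖𝔼 t : Fin T, g y (n + q * (t : ℕ))‖ with hA
  -- passing to second moments
  have h1 : κ ^ 2 / 4 * N * Y.card ≤ ∑ y ∈ Y, ∑ n ∈ I, A y n ^ 2 := by
    -- The constant `κ / 8`, summed over at most `4N` points, uses up half of the assumed lower
    -- bound.
    have i1 : ∀ y n, A y n ≤ κ / 8 + 2 / κ * A y n ^ 2 := fun y n => by
      rw [← sub_nonneg]
      have : κ / 8 + 2 / κ * A y n ^ 2 - A y n = (κ - 4 * A y n) ^ 2 / (8 * κ) := by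
        field_simp; ring
      rw [this]
      positivity
    have i2 : κ * N * Y.card ≤ ∑ y ∈ Y, ∑ n ∈ I, (κ / 8 + 2 / κ * A y n ^ 2) :=
      h.trans (Finset.sum_le_sum fun y _ => Finset.sum_le_sum fun n _ => i1 y n)
    have i3 : (I.card : ℝ) ≤ 4 * N := by
      have : I.card ≤ 4 * N := by rw [hI, Int.card_Icc]; omega
      exact_mod_cast this
    simp_rw [Finset.sum_add_distrib, ← Finset.mul_sum, Finset.sum_const, nsmul_eq_mul] at i2
    have i4 : (Y.card : ℝ) * (I.card * (κ / 8)) ≤ Y.card * (4 * N * (κ / 8)) := by gcongr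
    have i5 : κ * N * Y.card / 2 ≤ 2 / κ * ∑ y ∈ Y, ∑ n ∈ I, A y n ^ 2 := by linarith
    rw [div_mul_eq_mul_div, le_div_iff₀ hκ] at i5
    linarith
  -- second moments on the cyclic group
  have h2 : ∀ y, ∑ n ∈ I, A y n ^ 2 ≤
      5 * N * 𝔼 z, ‖𝔼 t : Fin T, G y (z + ((q * (t : ℕ) : ℤ) : ZMod (5 * N)))‖ ^ 2 := fun y => by
    set H : ZMod (5 * N) → ℝ := fun z =>
      ‖𝔼 t : Fin T, G y (z + ((q * (t : ℕ) : ℤ) : ZMod (5 * N)))‖ ^ 2 with hH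
    have i1 : ∑ z, H z = ∑ n ∈ Finset.Ico (-(N : ℤ)) (-N + (5 * N : ℕ)), H (n : ZMod (5 * N)) := by
      rw [← sum_rep (L := 5 * N) (-(N : ℤ)) fun n => H (n : ZMod (5 * N))]
      simp
    have i2 : (5 * N : ℝ) * 𝔼 z, H z = ∑ z, H z := by
      rw [Finset.expect_eq_sum_div_card, Finset.card_univ, ZMod.card, Nat.cast_mul, Nat.cast_ofNat,
        mul_div_cancel₀ _ (by positivity)]
    rw [i2, i1]
    calc ∑ n ∈ I, A y n ^ 2 = ∑ n ∈ I, H (n : ZMod (5 * N)) := by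
          refine Finset.sum_congr rfl fun n hn => ?_
          simp only [hA, hH, hG]
          congr 2
          refine Finset.expect_congr rfl fun t _ => ?_
          rw [← Int.cast_add, rep_intCast]
          have : q * (t : ℕ) ≤ N := (Nat.mul_le_mul_left q t.2.le).trans hqT
          simp only [hI, Finset.mem_Icc] at hn
          rw [Finset.mem_Ico]
          push_cast
          zify at this
          constructor <;> linarith [Int.mul_nonneg (Int.natCast_nonneg q) (Int.natCast_nonneg t)]
      _ ≤ _ := by
          refine Finset.sum_le_sum_of_subset_of_nonneg (fun n hn => ?_) fun n _ _ => by
            simp only [hH]; positivity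
          simp only [hI, Finset.mem_Icc] at hn
          rw [Finset.mem_Ico]
          push_cast
          omega
  -- restricting to the frequencies near multiples of `1 / q`
  set c : ℝ := 4 / (T * κ) with hc
  have hc0 : 0 < c := by positivity
  set Ξ := Finset.univ.filter fun ξ : ZMod (5 * N) => ‖q • ZMod.toAddCircle ξ‖ ≤ c with hΞ
  set W : ZMod (5 * N) → ℝ := fun ξ => ∑ y ∈ Y, ‖dft (G y) ξ‖ with hW
  have h3 : κ ^ 2 / 40 * Y.card ≤ ∑ ξ ∈ Ξ, W ξ := by
    have i1 := h1.trans (Finset.sum_le_sum fun y _ => (h2 y).trans (mul_le_mul_of_nonneg_left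
      (expect_normSq_progression_le (q := q) hT hc0 (hG1 y)) (by positivity)))
    rw [← Finset.mul_sum, Finset.sum_add_distrib, Finset.sum_const, nsmul_eq_mul,
      Finset.sum_comm] at i1
    -- The radius `c` is chosen so that the frequencies discarded here cost less than half of the
    -- second moment.
    have e1 : 1 / (2 * T * c) = κ / 8 := by rw [hc]; field_simp; norm_num
    rw [e1] at i1
    have i2 : (N : ℝ) * (κ ^ 2 / 4 * Y.card) ≤ N * (5 * (∑ ξ ∈ Ξ, W ξ + Y.card * (κ / 8) ^ 2)) := by
      linarith
    have i3 := le_of_mul_le_mul_left i2 hNR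
    have : 0 ≤ κ ^ 2 * Y.card := by positivity
    linarith
  have hne : Ξ.Nonempty := by
    by_contra hcon
    rw [Finset.not_nonempty_iff_eq_empty.mp hcon, Finset.sum_empty] at h3
    have : 0 < κ ^ 2 / 40 * Y.card := by positivity
    linarith
  -- The set `Ξ` does not depend on `y`, so the frequency can be chosen after summing over `y`. This
  -- makes `β` uniform in `y`.
  obtain ⟨ξ, hξ, hmax⟩ := Finset.exists_max_image Ξ W hne
  refine ⟨ZMod.toAddCircle ξ, (Finset.mem_filter.mp hξ).2, ?_⟩
  set E : ℝ := ∑ y ∈ Y, ‖𝔼 n ∈ I, f n y * e (n • ZMod.toAddCircle ξ)‖ with hE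
  have h4 : W ξ ≤ E := by
    refine Finset.sum_le_sum fun y _ => ?_
    have i1 : dft (G y) ξ = (∑ n ∈ I, f n y * e (n • ZMod.toAddCircle ξ)) / (5 * N : ℕ) := by
      rw [dft, Finset.expect_eq_sum_div_card, Finset.card_univ, ZMod.card]
      congr 1
      have e1 : ∀ z : ZMod (5 * N), G y z * chi (ξ * z)
          = g y (rep (-(N : ℤ)) z) * e (rep (-(N : ℤ)) z • ZMod.toAddCircle ξ) := fun z => by
        rw [← chi_mul_intCast, intCast_rep]
      simp_rw [e1]
      rw [sum_rep (-(N : ℤ)) fun n => g y n * e (n • ZMod.toAddCircle ξ)]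
      have e2 : I ⊆ Finset.Ico (-(N : ℤ)) (-N + (5 * N : ℕ)) := fun n hn => by
        simp only [hI, Finset.mem_Icc] at hn
        rw [Finset.mem_Ico]
        push_cast
        omega
      rw [← Finset.sum_subset e2]
      · refine Finset.sum_congr rfl fun n hn => ?_
        simp only [hI, Finset.mem_Icc] at hn
        simp only [hg, if_pos hn.2]
      · intro n hn hn'
        rw [Finset.mem_Ico] at hn
        simp only [hI, Finset.mem_Icc, not_and, not_le] at hn'
        simp only [hg, if_neg (not_le.mpr (hn' hn.1)), zero_mul]
    have i2 : I.card ≤ 5 * N := by rw [hI, Int.card_Icc]; omega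
    have i3 : 0 < I.card := Finset.card_pos.mpr ⟨0, by rw [hI, Finset.mem_Icc]; omega⟩
    rw [i1, Finset.expect_eq_sum_div_card, norm_div, norm_div, Complex.norm_natCast,
      Complex.norm_natCast]
    gcongr
  have h5 : (Ξ.card : ℝ) ≤ q * (40 * N / (T * κ) + 1) := by
    refine (card_norm_nsmul_le (M := 5 * N) hq c).trans (le_of_eq ?_)
    rw [abs_of_pos hc0, hc]
    push_cast
    ring
  have hE0 : 0 ≤ E := Finset.sum_nonneg fun y _ => norm_nonneg _
  have h6 : κ ^ 2 / 40 * Y.card ≤ q * (40 * N / (T * κ) + 1) * E := by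
    calc κ ^ 2 / 40 * Y.card ≤ Ξ.card * W ξ := by
          rw [← nsmul_eq_mul]; exact h3.trans (Finset.sum_le_card_nsmul _ _ _ hmax)
      _ ≤ Ξ.card * E := by gcongr
      _ ≤ _ := by gcongr
  rw [Finset.expect_eq_sum_div_card, ← mul_div_assoc, le_div_iff₀ hYR]
  exact h6

/-- Functions correlating with a major-arc quadratic phase correlate with a linear phase. -/
theorem exists_linear_phase_of_quadratic {ι : Type*} {N q Q : ℕ} (hN : 0 < N) (hq : 0 < q)
    (hqQ : q ≤ Q) {θ : UnitAddCircle} (hθ : ‖q • θ‖ ≤ Q / N ^ 2) {Y : Finset ι} (hY : Y.Nonempty)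
    {f : ℤ → ι → ℂ} (hf : ∀ n y, ‖f n y‖ ≤ 1) {c m : ℤ} (hc : -2 * N ≤ c) (hc' : c ≤ N)
    (hm : -N ≤ m) (hm' : m ≤ N) {η : ℝ} (hη : 0 < η) (hη1 : η ≤ 1) (hηN : 148 * Q ≤ η * N)
    (h : η * N * Y.card ≤
      ∑ y ∈ Y, ‖∑ u ∈ Finset.Ico (0 : ℤ) N, f (u + m) y * e ((u + c) ^ 2 • θ)‖) :
    ∃ β : UnitAddCircle, ‖q • β‖ ≤ 1184 * Q / η ^ 2 / N ∧
      η ^ 2 / 160 ≤ Q * (11840 * Q / η ^ 2 + 1) *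
        𝔼 y ∈ Y, ‖𝔼 n ∈ Finset.Icc (-(N : ℤ)) (2 * N), f n y * e (n • β)‖ := by
  have hNR : (0 : ℝ) < N := by exact_mod_cast hN
  have hQ0 : 0 < Q := hq.trans_le hqQ
  have hQR : (0 : ℝ) < Q := by exact_mod_cast hQ0
  have hYR : (0 : ℝ) < Y.card := by exact_mod_cast hY.card_pos
  -- The longest progressions for which the error `37 Q T` is at most `η N / 2`.
  set T : ℕ := ⌊η * N / (74 * Q)⌋₊ with hT
  have hT2 : (2 : ℝ) ≤ η * N / (74 * Q) := by rw [le_div_iff₀ (by positivity)]; linarith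
  have hT1 : (T : ℝ) ≤ η * N / (74 * Q) := Nat.floor_le (by positivity)
  have hT3 : η * N / (148 * Q) ≤ T := by
    have := Nat.lt_floor_add_one (η * N / (74 * Q))
    rw [← hT] at this
    have e1 : η * N / (148 * Q) = η * N / (74 * Q) / 2 := by field_simp; norm_num
    rw [e1]
    linarith
  have hT0 : (0 : ℝ) < T := lt_of_lt_of_le (by positivity) hT3
  rw [le_div_iff₀ (by positivity)] at hT1
  rw [div_le_iff₀ (by positivity)] at hT3
  have hqT : q * T ≤ N := by
    have : (q : ℝ) * T ≤ N := by
      have i1 : (q : ℝ) * T ≤ Q * T := by gcongr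
      have i2 : η * N ≤ N := mul_le_of_le_one_left hNR.le hη1
      nlinarith
    exact_mod_cast this
  set g : ι → ℤ → ℂ := fun y n => if n ≤ 2 * N then f n y else 0 with hg
  have hg1 : ∀ y n, ‖g y n‖ ≤ 1 := fun y n => by
    simp only [hg]; split_ifs <;> simp [hf]
  have h1 : η / 2 * N * Y.card ≤ ∑ y ∈ Y, ∑ n ∈ Finset.Icc (-(N : ℤ)) (2 * N), ‖𝔼 t : Fin T,
      (if n + q * (t : ℕ) ≤ 2 * N then f (n + q * (t : ℕ)) y else 0)‖ := by
    have i1 : ∀ y, ‖∑ u ∈ Finset.Ico (0 : ℤ) N, f (u + m) y * e ((u + c) ^ 2 • θ)‖ ≤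
        (∑ n ∈ Finset.Icc (-(N : ℤ)) (2 * N), ‖𝔼 t : Fin T, g y (n + q * (t : ℕ))‖) +
          37 * Q * T := fun y => by
      have e1 : ∑ u ∈ Finset.Ico (0 : ℤ) N, f (u + m) y * e ((u + c) ^ 2 • θ)
          = ∑ u ∈ Finset.Ico (0 : ℤ) N, g y (u + m) * e ((u + c) ^ 2 • θ) := by
        refine Finset.sum_congr rfl fun u hu => ?_
        rw [Finset.mem_Ico] at hu
        simp only [hg, if_pos (by omega : u + m ≤ 2 * N)]
      rw [e1]
      refine (norm_sum_quadratic_le hN (by exact_mod_cast hT0) hqQ hqT hθ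
        (φ := fun u => g y (u + m)) (fun u => hg1 _ _) hc hc').trans (add_le_add ?_ le_rfl)
      simp_rw [add_right_comm _ _ m]
      rw [sum_Ico_add (fun n => ‖𝔼 t : Fin T, g y (n + q * (t : ℕ))‖)]
      refine Finset.sum_le_sum_of_subset_of_nonneg (fun n hn => ?_) fun n _ _ => norm_nonneg _
      rw [Finset.mem_Ico] at hn
      rw [Finset.mem_Icc]
      omega
    have i2 := h.trans (Finset.sum_le_sum fun y _ => i1 y)
    rw [Finset.sum_add_distrib, Finset.sum_const, nsmul_eq_mul] at i2
    have i3 : (Y.card : ℝ) * (37 * Q * T) ≤ Y.card * (η * N / 2) :=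
      mul_le_mul_of_nonneg_left (by linarith) hYR.le
    have i4 : η / 2 * N * Y.card ≤
      ∑ y ∈ Y, ∑ n ∈ Finset.Icc (-(N : ℤ)) (2 * N), ‖𝔼 t : Fin T, g y (n + q * (t : ℕ))‖ := by
      linarith
    exact i4
  obtain ⟨β, hβ, hβ'⟩ := exists_linear_phase hN (by exact_mod_cast hT0) hq hqT hY hf
    (half_pos hη) h1
  have hinv : 1 / (T * (η / 2)) ≤ 296 * Q / η ^ 2 / N := by
    rw [div_div, div_le_div_iff₀ (by positivity) (by positivity)]
    nlinarith
  refine ⟨β, hβ.trans ?_, le_trans (le_of_eq (by ring)) (hβ'.trans ?_)⟩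
  · calc 4 / (T * (η / 2)) = 4 * (1 / (T * (η / 2))) := by ring
      _ ≤ 4 * (296 * Q / η ^ 2 / N) := by gcongr
      _ = _ := by ring
  · refine mul_le_mul_of_nonneg_right ?_ (Finset.expect_nonneg fun _ _ => norm_nonneg _)
    have i1 : 40 * N / (T * (η / 2)) ≤ 11840 * Q / η ^ 2 := by
      calc 40 * N / (T * (η / 2)) = 40 * N * (1 / (T * (η / 2))) := by ring
        _ ≤ 40 * N * (296 * Q / η ^ 2 / N) := by gcongr
        _ = _ := by field_simp; norm_num
    have hqQ' : (q : ℝ) ≤ Q := by exact_mod_cast hqQ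
    gcongr

end LinearPhase

/-! ### Choice of the primes `p`, `r` and injectivity of the progressions -/

section Moduli

/-- Both primes come from Bertrand's postulate. `p J ≤ N` lets differencing use up to `J` multiples
of `p`; `2N² ≤ p r` prevents wraparound in `y`; `2N < r` makes progressions injective; and `r ≤ 12 J
N` keeps them dense in the subgroup of multiples of `p`, which has order `r`. -/
theorem exists_moduli {N J : ℕ} (hJ : 1 ≤ J) (hN : 4 * J ≤ N) :
    ∃ p r : ℕ, p.Prime ∧ r.Prime ∧ p ≠ 2 ∧ p * J ≤ N ∧ N ≤ 2 * J * p ∧ 2 * N ^ 2 ≤ p * r ∧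
      p * r ≤ 6 * N ^ 2 ∧ 2 * N < r ∧ r ≤ 12 * J * N := by
  have hP2 : 2 ≤ N / (2 * J) := (Nat.le_div_iff_mul_le (by omega)).mpr (by omega)
  obtain ⟨p, hp, hp1, hp2⟩ := Nat.exists_prime_lt_and_le_two_mul (N / (2 * J)) (by omega)
  have h1 : N / (2 * J) * (2 * J) ≤ N := Nat.div_mul_le_self _ _
  have h2 : N < 2 * J * (N / (2 * J) + 1) := Nat.lt_mul_div_succ N (by omega)
  have hpJ : p * J ≤ N := by
    calc p * J ≤ 2 * (N / (2 * J)) * J := Nat.mul_le_mul_right J hp2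
      _ = N / (2 * J) * (2 * J) := by ring
      _ ≤ N := h1
  have hNp : N ≤ 2 * J * p := h2.le.trans (Nat.mul_le_mul_left _ hp1)
  have hpN : p ≤ N := (Nat.le_mul_of_pos_right p hJ).trans hpJ
  have hN0 : 0 < N := by omega
  obtain ⟨r, hr, hr1, hr2⟩ := Nat.exists_prime_lt_and_le_two_mul (2 * N ^ 2 / p + 1)
    (Nat.succ_ne_zero _)
  have h3 : 2 * N ^ 2 < p * (2 * N ^ 2 / p + 1) := Nat.lt_mul_div_succ _ hp.pos
  have h4 : 2 * N ^ 2 / p * p ≤ 2 * N ^ 2 := Nat.div_mul_le_self _ _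
  have h5 : p * (2 * N ^ 2 / p + 1) ≤ p * r := Nat.mul_le_mul_left p hr1.le
  have h6 : p * r ≤ 6 * N ^ 2 := by
    have := Nat.mul_le_mul_left p hr2
    have : N ≤ N ^ 2 := by nlinarith
    nlinarith
  have h7 : 2 * N ≤ 2 * N ^ 2 / p := by
    rw [Nat.le_div_iff_mul_le hp.pos]
    nlinarith
  refine ⟨p, r, hp, hr, by omega, hpJ, hNp, by omega, h6, by omega, ?_⟩
  have h8 : r * N ≤ 12 * J * N * N := by
    calc r * N ≤ r * (2 * J * p) := Nat.mul_le_mul_left r hNp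
      _ = 2 * J * (p * r) := by ring
      _ ≤ 2 * J * (6 * N ^ 2) := Nat.mul_le_mul_left _ h6
      _ = _ := by ring
  exact Nat.le_of_mul_le_mul_right h8 hN0

/-- A coincidence forces `r` to divide `2 e (t' - t)`. Each factor is smaller than the prime `r` in
absolute value, so one vanishes, and it can only be `t' - t`. -/
theorem prog_injective {p r M N T : ℕ} (hp : 0 < p) (hr : r.Prime) (hM : p * r = M)
    (hrN : 2 * N < r) (hT : T ≤ N) {e : ℤ} (he : e ≠ 0) (heN : |e| ≤ 2 * N) :
    Function.Injective (prog T ((2 * p * e : ℤ) : ZMod M)) := by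
  have hrZ : Prime (r : ℤ) := Nat.prime_iff_prime_int.mp hr
  intro t t' h
  simp only [prog, neg_inj] at h
  have h1 : (M : ℤ) ∣ 2 * p * e * (t' : ℕ) - 2 * p * e * (t : ℕ) := by
    rw [← ZMod.intCast_eq_intCast_iff_dvd_sub]
    push_cast at h ⊢
    exact h
  rw [← hM] at h1
  have h2 : ((p * r : ℕ) : ℤ) ∣ p * (2 * (e * ((t' : ℕ) - (t : ℕ)))) := by
    convert h1 using 1; ring
  push_cast at h2
  have h3 := Int.dvd_of_mul_dvd_mul_left (by exact_mod_cast hp.ne') h2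
  have small : ∀ z : ℤ, (r : ℤ) ∣ z → |z| ≤ 2 * N → z = 0 := fun z hz hz' =>
    Int.eq_zero_of_abs_lt_dvd hz (by omega)
  have htN := t.2
  have htN' := t'.2
  have hN1 : 1 ≤ N := by omega
  rcases hrZ.dvd_or_dvd h3 with h4 | h4
  · have := small 2 h4 (by rw [abs_two]; omega)
    omega
  · rcases hrZ.dvd_or_dvd h4 with h5 | h5
    · exact absurd (small e h5 heN) he
    · have := small _ h5 (by rw [abs_le]; omega)
      exact Fin.ext (by omega)

end Moduli

/-! ### A large count forces a large `U³` norm of the dual function -/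

section Uniformity

variable {M : ℕ} [NeZero M] {N : ℕ}

theorem boxNorm_conj {ι κ τ : Type*} [Fintype ι] [Fintype κ] [Fintype τ] (α : ι → ZMod M)
    (β : κ → ZMod M) (γ : τ → ZMod M) (F : ZMod M → ℂ) :
    boxNorm α β γ (fun y => conj (F y)) = boxNorm α β γ F := by
  have h : ∀ (a a' b b' y : ZMod M), der a a' (der b b' fun y => conj (F y)) y
      = conj (der a a' (der b b' F) y) := fun a a' b b' y => by
    simp only [der, map_mul]
  simp only [boxNorm, h, ← conj_expect, RCLike.norm_conj]

/-- The count is the inner product of the dual function with `f₂`, and the right side is the squared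
`L²` norm of the dual function. It allows `f₂` to be replaced by a function with structure, which
degree lowering needs. -/
theorem normSq_cnt_le (s : ℤ) (f₀ f₁ : Fin N → ZMod M → ℂ) {f₂ : Fin N → ZMod M → ℂ}
    (h₂ : ∀ x y, ‖f₂ x y‖ ≤ 1) :
    ‖cnt s f₀ f₁ f₂‖ ^ 2 ≤ ‖cnt s f₀ f₁ fun x y => conj (dual s f₀ f₁ x y)‖ := by
  rcases Nat.eq_zero_or_pos N with rfl | hN
  · simp [cnt]
  have : Nonempty (Fin N) := ⟨⟨0, hN⟩⟩
  rw [cnt_eq_expect_dual, cnt_eq_expect_dual]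
  have e1 : 𝔼 x, 𝔼 y, dual s f₀ f₁ x y * conj (dual s f₀ f₁ x y)
      = ((𝔼 x, 𝔼 y, ‖dual s f₀ f₁ x y‖ ^ 2 : ℝ) : ℂ) := by
    simp_rw [ofReal_expect, normSq_eq]
  rw [e1, Complex.norm_real]
  refine le_trans ?_ (Real.le_norm_self _)
  refine (normSq_expect_le _).trans (expect_mono fun x => ?_)
  simp_rw [mul_comm (dual s f₀ f₁ x _)]
  exact normSq_expect_mul_le (h₂ x) _

/-- The loss incurred when one direction of a box norm is replaced by the full group. -/
def lowered (ρ η : ℝ) : ℝ := ((η * ρ) ^ 16 / 8) ^ 8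

/-- If the counting operator is large then the dual functions have large `U³` norm. -/
theorem lowered_le_boxNorm_id {p r J T : ℕ} [Fact p.Prime] (hr : r.Prime) (hp2 : p ≠ 2)
    (hM : p * r = M) (hpJ : p * J ≤ N) (hJ1 : 1 ≤ J) (hrN : 2 * N < r) (hT : 0 < T) (hTN : T ≤ N)
    {f₀ f₁ f₂ : Fin N → ZMod M → ℂ} (h₀ : ∀ x y, ‖f₀ x y‖ ≤ 1) (h₁ : ∀ x y, ‖f₁ x y‖ ≤ 1)
    (h₂ : ∀ x y, ‖f₂ x y‖ ≤ 1) (s : ℤ) {δ ε ρ η : ℝ} (hδ : 0 < δ) (hδ1 : δ ≤ 1)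
    (hε : ε = (δ ^ 2) ^ 4 / 512) (hJ : 1 ≤ ε * J) (hTε : 12 * T ≤ ε * N) (hρ : 0 < ρ)
    (hρ' : ρ ≤ T / r) (hη : η = (ε / 2) ^ 8)
    (h1p : 9 ≤ ((η * ρ) ^ 16 / 16) ^ 8 * p)
    (h2p : 9 ≤ ((lowered ρ η * ρ) ^ 16 / 16) ^ 8 * p)
    (h3p : 9 ≤ ((lowered ρ (lowered ρ η) * ρ) ^ 16 / 16) ^ 8 * p)
    (h : δ ≤ ‖cnt s f₀ f₁ f₂‖) :
    lowered ρ (lowered ρ (lowered ρ η)) ≤ 𝔼 x, boxNorm id id id (dual s f₀ f₁ x) := by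
  have hp0 : 0 < p := (Fact.out : p.Prime).pos
  have hpN : p ≤ N := (Nat.le_mul_of_pos_right p hJ1).trans hpJ
  have hJN : J ≤ N := (Nat.le_mul_of_pos_left J hp0).trans hpJ
  have hr0 : (0 : ℝ) < r := by exact_mod_cast hr.pos
  have : Nonempty (Fin T) := ⟨⟨0, hT⟩⟩
  have hF1 : ∀ x y, ‖dual s f₀ f₁ x y‖ ≤ 1 := norm_dual_le h₀ h₁
  have hρ1 : ρ ≤ 1 := by
    refine hρ'.trans ((div_le_one hr0).mpr ?_)
    exact_mod_cast (by omega : T ≤ r)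
  have hδ2 : δ ^ 2 ≤ 1 := pow_le_one₀ hδ.le hδ1
  have hε1 : ε ≤ 1 := by
    rw [hε]
    have : (δ ^ 2) ^ 4 ≤ 1 := pow_le_one₀ (by positivity) hδ2
    linarith
  have hε0 : 0 < ε := by rw [hε]; positivity
  have hη0 : 0 ≤ η := by rw [hη]; positivity
  have hη1 : η ≤ 1 := by rw [hη]; exact pow_le_one₀ (by positivity) (by linarith)
  have low : ∀ η : ℝ, 0 ≤ η → η ≤ 1 → 0 ≤ lowered ρ η ∧ lowered ρ η ≤ 1 := fun η i1 i2 => by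
    refine ⟨by unfold lowered; positivity, pow_le_one₀ (by positivity) ?_⟩
    have : (η * ρ) ^ 16 ≤ 1 := pow_le_one₀ (by positivity) (by nlinarith)
    linarith
  obtain ⟨e, e', he, he', hee, heJ, heJ', hbox⟩ := exists_boxNorm_ge (by omega) hT hpJ h₀ h₁
    (fun x y => norm_conj_le_one (hF1 x y)) s (by positivity) hδ2 hε hJ hTε
    ((pow_le_pow_left₀ hδ.le h 2).trans (normSq_cnt_le s f₀ f₁ h₂))
  simp_rw [boxNorm_conj] at hbox
  rw [← hη] at hbox
  have inj : ∀ e : ℤ, e ≠ 0 → |e| ≤ 2 * N →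
      Function.Injective (prog T ((2 * p * e : ℤ) : ZMod M)) := fun e he heN =>
    prog_injective hp0 hr hM hrN hTN he heN
  have mul : ∀ (e : ℤ) (k : Fin T), ∃ t, prog T ((2 * p * e : ℤ) : ZMod M) k = (p : ZMod M) * t :=
    fun e k => ⟨-(2 * e * ((k : ℕ) : ZMod M)), by simp only [prog]; push_cast; ring⟩
  have step : ∀ {ι κ : Type} [Fintype ι] [Fintype κ] [Nonempty ι] [Nonempty κ]
      (α : ι → ZMod M) (β : κ → ZMod M) (e : ℤ), e ≠ 0 → |e| ≤ 2 * N →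
      ∀ η : ℝ, 0 ≤ η → η ≤ 1 → 9 ≤ ((η * ρ) ^ 16 / 16) ^ 8 * p →
      η ≤ 𝔼 x, boxNorm α β (prog T ((2 * p * e : ℤ) : ZMod M)) (dual s f₀ f₁ x) →
      lowered ρ η ≤ 𝔼 x, boxNorm id α β (dual s f₀ f₁ x) := by
    intro ι κ _ _ _ _ α β e he heN η i0 i1 ip hη'
    refine boxNorm_lowering hp2 hr.pos hM hpN h₀ h₁ s α β (inj e he heN) (mul e) hη'
      (by positivity) ?_ (t := (η * ρ) ^ 16 / 16) (by positivity) ?_ ip (by linarith)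
    · rw [Fintype.card_fin, mul_div_assoc]
      exact mul_le_mul_of_nonneg_left hρ' i0
    · have : (η * ρ) ^ 16 ≤ 1 := pow_le_one₀ (by positivity) (by nlinarith)
      linarith
  -- In each round the last progression is turned into the full group and moves to the front: first
  -- the one with slope `e' - e`, then `-e`, then `e'`.
  rw [abs_lt] at heJ heJ'
  have k1 := step _ _ (e' - e) (sub_ne_zero.mpr hee) (by rw [abs_le]; omega) _ hη0 hη1 h1p hbox
  have l1 := low _ hη0 hη1
  have k2 := step _ _ (-e) (neg_ne_zero.mpr he) (by rw [abs_le]; omega) _ l1.1 l1.2 h2p k1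
  have l2 := low _ l1.1 l1.2
  exact step _ _ e' he' (by rw [abs_le]; omega) _ l2.1 l2.2 h3p k2

end Uniformity

/-! ### From the integer count to the cyclic group -/

section Reduction

/-- The shifts that keep both `x` and `x + d` inside `[1, N]` form an interval of length `(N -
|d|)₊`, and for `x` in `[1, N]` the range of `s` captures all of them. Thus the Fejér weight becomes
an average of sharp cutoffs. -/
theorem fejer_sub_eq_sum {N : ℕ} (hN : 0 < N) (x : ℤ) (hx : x ∈ Finset.Icc (1 : ℤ) N) (d : ℤ) :
    (N : ℝ) ^ 2 * fejer N d = ∑ s ∈ Finset.Icc (1 - (N : ℤ)) (N - 1),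
      (if x + s ∈ Finset.Icc (1 : ℤ) N ∧ x + d + s ∈ Finset.Icc (1 : ℤ) N then 1 else 0) := by
  have hNR : (0 : ℝ) < N := by exact_mod_cast hN
  rw [Finset.mem_Icc] at hx
  have h1 : (Finset.Icc (1 - (N : ℤ)) (N - 1)).filter
      (fun s => x + s ∈ Finset.Icc (1 : ℤ) N ∧ x + d + s ∈ Finset.Icc (1 : ℤ) N)
      = Finset.Icc (1 - x + max 0 (-d)) (N - x - max 0 d) := by
    ext s
    simp only [Finset.mem_filter, Finset.mem_Icc]
    omega
  have h2 : (((Finset.Icc (1 - x + max 0 (-d)) (N - x - max 0 d)).card : ℤ) : ℝ)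
      = max (N - |(d : ℝ)|) 0 := by
    have : ((Finset.Icc (1 - x + max 0 (-d)) (N - x - max 0 d)).card : ℤ) = max (N - |d|) 0 := by
      rw [Int.card_Icc]
      rcases le_total 0 d with h | h
      · rw [abs_of_nonneg h]; omega
      · rw [abs_of_nonpos h]; omega
    rw [this]
    push_cast
    rfl
  rw [Int.cast_natCast] at h2
  rw [← Finset.sum_filter, Finset.sum_const, nsmul_one, h1, h2, fejer]
  have h3 : max (N - |(d : ℝ)|) 0 = N * max (1 - |(d : ℝ)| / N) 0 := by
    rw [mul_max_of_nonneg _ _ hNR.le, mul_zero, mul_sub, mul_one, mul_div_cancel₀ _ hNR.ne']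
  rw [h3]
  field_simp

variable {M : ℕ} [NeZero M] {N : ℕ}

/-- The first function of the counting operator, transferred to the cyclic group with a shift `s` and
restricted to the original range. -/
def trans₀ (M N : ℕ) [NeZero M] (s : ℤ) (f : ℤ × ℤ → ℂ) (x : Fin N) (y : ZMod M) : ℂ :=
  if rep 1 y ≤ (N : ℤ) ^ 2 ∧ ((x : ℕ) : ℤ) + 1 + s ∈ Finset.Icc (1 : ℤ) N then
    f ((x : ℕ) + 1, rep 1 y) else 0

/-- The second function of the counting operator, transferred to the cyclic group with a shift `s`. -/
def trans₁ (M N : ℕ) [NeZero M] (s : ℤ) (f : ℤ × ℤ → ℂ) (u : Fin N) (y : ZMod M) : ℂ :=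
  f ((u : ℕ) + (1 - s), rep 1 y)

/-- The third function of the counting operator, transferred to the cyclic group. -/
def trans₂ (M N : ℕ) [NeZero M] (f : ℤ × ℤ → ℂ) (x : Fin N) (y : ZMod M) : ℂ :=
  f ((x : ℕ) + 1, rep 1 y)

theorem norm_trans₀_le {s : ℤ} {f : ℤ × ℤ → ℂ} (hf : OneBounded f) (x : Fin N) (y : ZMod M) :
    ‖trans₀ M N s f x y‖ ≤ 1 := by
  unfold trans₀
  split_ifs
  · exact hf _
  · simp

theorem sum_Icc_eq_sum_fin {E : Type*} [AddCommMonoid E] (N : ℕ) (a : ℤ) (φ : ℤ → E) :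
    ∑ n ∈ Finset.Icc (1 + a) (N + a), φ n = ∑ x : Fin N, φ ((x : ℕ) + (1 + a)) := by
  rw [sum_fin_eq_sum_Ico N fun n => φ (n + (1 + a)), sum_Ico_add]
  refine Finset.sum_congr ?_ fun _ _ => rfl
  ext n
  simp only [Finset.mem_Icc, Finset.mem_Ico]
  omega

/-- The weight-free form of the counting operator with a fixed shift. -/
def shiftSum (N : ℕ) (f₀ f₁ f₂ : ℤ × ℤ → ℂ) (s : ℤ) : ℂ :=
  ∑ x : Fin N, ∑ u : Fin N, ∑ y ∈ Finset.Icc (1 : ℤ) ((N : ℤ) ^ 2),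
    if ((x : ℕ) : ℤ) + 1 + s ∈ Finset.Icc (1 : ℤ) N then
      f₀ ((x : ℕ) + 1, y) * f₁ ((u : ℕ) + (1 - s), y) *
        f₂ ((x : ℕ) + 1, y + (((u : ℕ) : ℤ) - (x : ℕ) - s) ^ 2) else 0

/-- For fixed `s` the cutoff says that `x + d` lies in `[1 - s, N - s]`, which is parametrised by
`u`; hence `d = u - x - s` for the zero-based indices `x, u`. -/
theorem sum_shiftSum (hN : 0 < N) (f₀ f₁ f₂ : ℤ × ℤ → ℂ) :
    (N : ℂ) ^ 5 * Lam N f₀ f₁ f₂ =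
      ∑ s ∈ Finset.Icc (1 - (N : ℤ)) (N - 1), shiftSum N f₀ f₁ f₂ s := by
  have hNC : (N : ℂ) ≠ 0 := by exact_mod_cast hN.ne'
  have h1 : (N : ℂ) ^ 5 * Lam N f₀ f₁ f₂ = ∑ x ∈ Finset.Icc (1 : ℤ) N,
      ∑ y ∈ Finset.Icc (1 : ℤ) ((N : ℤ) ^ 2), ∑ d ∈ Finset.Icc (-(N : ℤ)) N,
        (((N : ℝ) ^ 2 * fejer N d : ℝ) : ℂ) * (f₀ (x, y) * f₁ (x + d, y) * f₂ (x, y + d ^ 2)) := by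
    rw [Lam_eq_sum hN]
    simp_rw [Finset.expect_eq_sum_div_card, Int.card_Icc]
    have e1 : (((N : ℤ) ^ 2 + 1 - 1).toNat : ℂ) = (N : ℂ) ^ 2 := by
      have : ((N : ℤ) ^ 2 + 1 - 1).toNat = N ^ 2 := by
        rw [add_sub_cancel_right]; exact_mod_cast Int.toNat_natCast (N ^ 2)
      rw [this]; push_cast; rfl
    have e2 : (((N : ℤ) + 1 - 1).toNat : ℂ) = N := by simp
    rw [e2]
    simp_rw [e1, ← Finset.sum_div]
    have e3 : ∀ S : ℂ, (N : ℂ) ^ 5 * (S / (N : ℂ) ^ 2 / N) = (N : ℂ) ^ 2 * S := fun S => by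
      field_simp
    rw [e3]
    simp_rw [Finset.mul_sum]
    refine Finset.sum_congr rfl fun x _ => Finset.sum_congr rfl fun y _ =>
      Finset.sum_congr rfl fun d _ => ?_
    push_cast
    ring
  rw [h1]
  have h2 : ∀ s, shiftSum N f₀ f₁ f₂ s = ∑ x ∈ Finset.Icc (1 : ℤ) N,
      ∑ y ∈ Finset.Icc (1 : ℤ) ((N : ℤ) ^ 2), ∑ d ∈ Finset.Icc (-(N : ℤ)) N,
        (if x + s ∈ Finset.Icc (1 : ℤ) N ∧ x + d + s ∈ Finset.Icc (1 : ℤ) N then 1 else 0) *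
          (f₀ (x, y) * f₁ (x + d, y) * f₂ (x, y + d ^ 2)) := fun s => by
    have e0 := sum_Icc_eq_sum_fin N 0 (fun x : ℤ => ∑ y ∈ Finset.Icc (1 : ℤ) ((N : ℤ) ^ 2),
      ∑ d ∈ Finset.Icc (-(N : ℤ)) N,
        (if x + s ∈ Finset.Icc (1 : ℤ) N ∧ x + d + s ∈ Finset.Icc (1 : ℤ) N then (1 : ℂ) else 0) *
          (f₀ (x, y) * f₁ (x + d, y) * f₂ (x, y + d ^ 2)))
    simp only [add_zero] at e0
    rw [e0, shiftSum]
    refine Finset.sum_congr rfl fun x _ => ?_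
    rw [Finset.sum_comm]
    refine Finset.sum_congr rfl fun y _ => ?_
    set X : ℤ := ((x : ℕ) : ℤ) + 1 with hX
    by_cases hx : X + s ∈ Finset.Icc (1 : ℤ) N
    · simp only [hx, if_true, true_and, boole_mul]
      rw [← Finset.sum_filter]
      have e1 : (Finset.Icc (-(N : ℤ)) N).filter (fun d => X + d + s ∈ Finset.Icc (1 : ℤ) N)
          = Finset.Icc (1 + (-s - X)) (N + (-s - X)) := by
        rw [Finset.mem_Icc] at hx
        ext d
        simp only [Finset.mem_filter, Finset.mem_Icc]
        omega
      rw [e1, sum_Icc_eq_sum_fin]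
      refine Finset.sum_congr rfl fun u _ => ?_
      have e2 : X + (((u : ℕ) : ℤ) + (1 + (-s - X))) = (u : ℕ) + (1 - s) := by ring
      have e3 : ((u : ℕ) : ℤ) + (1 + (-s - X)) = (u : ℕ) - (x : ℕ) - s := by rw [hX]; ring
      rw [e2, e3]
    · simp only [hx, if_false, false_and, zero_mul, Finset.sum_const_zero]
  simp_rw [h2]
  conv_rhs => rw [Finset.sum_comm]
  refine Finset.sum_congr rfl fun x hx => ?_
  conv_rhs => rw [Finset.sum_comm]
  refine Finset.sum_congr rfl fun y _ => ?_
  conv_rhs => rw [Finset.sum_comm]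
  refine Finset.sum_congr rfl fun d _ => ?_
  rw [← Finset.sum_mul, fejer_sub_eq_sum hN x hx d, Complex.ofReal_sum]
  congr 1
  exact Finset.sum_congr rfl fun s _ => by split_ifs <;> simp

/-- There is no wraparound: on the support of the first function `y ≤ N²` and `d² ≤ N²`, so `y + d²`
stays among the representatives `1, …, M`. -/
theorem cnt_trans (hM : 2 * N ^ 2 ≤ M) (f₀ f₁ f₂ : ℤ × ℤ → ℂ) (s : ℤ) :
    (N : ℂ) ^ 2 * M * cnt (-s) (trans₀ M N s f₀) (trans₁ M N s f₁) (trans₂ M N f₂)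
      = shiftSum N f₀ f₁ f₂ s := by
  rcases Nat.eq_zero_or_pos N with rfl | hN
  · simp [shiftSum]
  have hNC : (N : ℂ) ≠ 0 := by exact_mod_cast hN.ne'
  have hMC : (M : ℂ) ≠ 0 := by exact_mod_cast NeZero.ne M
  rw [cnt]
  simp_rw [Finset.expect_eq_sum_div_card, Finset.card_univ, ZMod.card, Fintype.card_fin,
    ← Finset.sum_div]
  have e1 : ∀ S : ℂ, (N : ℂ) ^ 2 * M * (S / M / N / N) = S := fun S => by field_simp
  rw [e1, shiftSum]
  refine Finset.sum_congr rfl fun x _ => Finset.sum_congr rfl fun u _ => ?_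
  by_cases hx : ((x : ℕ) : ℤ) + 1 + s ∈ Finset.Icc (1 : ℤ) N
  swap
  · simp only [hx, trans₀, and_false, if_false, zero_mul, Finset.sum_const_zero]
  set d : ℤ := ((u : ℕ) : ℤ) - (x : ℕ) - s with hd
  have hd2 : d ^ 2 ≤ (N : ℤ) ^ 2 := by
    rw [sq_le_sq, Nat.abs_cast, abs_le]
    have := u.2
    rw [Finset.mem_Icc] at hx
    omega
  have hMZ : (2 : ℤ) * (N : ℤ) ^ 2 ≤ M := by exact_mod_cast hM
  set Φ : ℤ → ℂ := fun n => if n ≤ (N : ℤ) ^ 2 then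
    f₀ ((x : ℕ) + 1, n) * f₁ ((u : ℕ) + (1 - s), n) * f₂ ((x : ℕ) + 1, n + d ^ 2) else 0 with hΦ
  have e2 : ∀ y : ZMod M, trans₀ M N s f₀ x y * trans₁ M N s f₁ u y *
      trans₂ M N f₂ x (y + disp M (-s) x u ^ 2) = Φ (rep 1 y) := fun y => by
    simp only [hΦ]
    by_cases hy : rep 1 y ≤ (N : ℤ) ^ 2
    · simp only [trans₀, trans₁, trans₂, hx, hy, and_self, if_true]
      have i1 := Finset.mem_Ico.mp (rep_mem 1 y)
      have i2 : y + disp M (-s) x u ^ 2 = ((rep 1 y + d ^ 2 : ℤ) : ZMod M) := by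
        simp only [disp, hd]
        push_cast
        rw [intCast_rep]
        ring
      rw [i2, rep_intCast]
      rw [Finset.mem_Ico]
      constructor <;> nlinarith
    · simp only [trans₀, hy, false_and, if_false, zero_mul]
  refine (Finset.sum_congr rfl fun y _ => e2 y).trans ((sum_rep 1 Φ).trans ?_)
  rw [hΦ, ← Finset.sum_filter]
  have e3 : (Finset.Ico (1 : ℤ) (1 + M)).filter (fun n => n ≤ (N : ℤ) ^ 2)
      = Finset.Icc (1 : ℤ) ((N : ℤ) ^ 2) := by
    ext n
    simp only [Finset.mem_filter, Finset.mem_Ico, Finset.mem_Icc]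
    have : 0 ≤ (N : ℤ) ^ 2 := by positivity
    omega
  rw [e3]
  simp only [hx, if_true]

/-- A large value of the counting operator yields a large value on the cyclic group. -/
theorem exists_shift_cnt (hN : 0 < N) (hM : 2 * N ^ 2 ≤ M) (hM' : M ≤ 6 * N ^ 2) {δ : ℝ}
    {f₀ f₁ f₂ : ℤ × ℤ → ℂ} (h : δ ≤ ‖Lam N f₀ f₁ f₂‖) :
    ∃ s : ℤ, |s| < N ∧
      δ / 12 ≤ ‖cnt (-s) (trans₀ M N s f₀) (trans₁ M N s f₁) (trans₂ M N f₂)‖ := by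
  have hNR : (0 : ℝ) < N := by exact_mod_cast hN
  obtain ⟨s, hs, hmax⟩ := Finset.exists_max_image (Finset.Icc (1 - (N : ℤ)) (N - 1))
    (fun s => ‖shiftSum N f₀ f₁ f₂ s‖) ⟨0, by rw [Finset.mem_Icc]; omega⟩
  refine ⟨s, by rw [Finset.mem_Icc] at hs; rw [abs_lt]; omega, ?_⟩
  -- There are at most `2N` shifts; together with the normalisation `N² M ≤ 6 N⁴` this gives the
  -- factor `12`.
  have h1 : (N : ℝ) ^ 5 * ‖Lam N f₀ f₁ f₂‖ ≤ 2 * N * ‖shiftSum N f₀ f₁ f₂ s‖ := by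
    have e1 : (N : ℝ) ^ 5 * ‖Lam N f₀ f₁ f₂‖ = ‖(N : ℂ) ^ 5 * Lam N f₀ f₁ f₂‖ := by
      rw [norm_mul, norm_pow, Complex.norm_natCast]
    rw [e1, sum_shiftSum hN]
    refine (norm_sum_le _ _).trans ((Finset.sum_le_card_nsmul _ _ _ hmax).trans ?_)
    rw [nsmul_eq_mul]
    refine mul_le_mul_of_nonneg_right ?_ (norm_nonneg _)
    have : (Finset.Icc (1 - (N : ℤ)) (N - 1)).card ≤ 2 * N := by rw [Int.card_Icc]; omega
    exact_mod_cast this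
  rw [← cnt_trans hM, norm_mul, norm_mul, norm_pow, Complex.norm_natCast, Complex.norm_natCast]
    at h1
  set c := ‖cnt (-s) (trans₀ M N s f₀) (trans₁ M N s f₁) (trans₂ M N f₂)‖ with hc
  have hc0 : 0 ≤ c := norm_nonneg _
  have hM6 : (M : ℝ) ≤ 6 * N ^ 2 := by exact_mod_cast hM'
  have h2 : (N : ℝ) ^ 5 * δ ≤ (N : ℝ) ^ 5 * (12 * c) := by
    calc (N : ℝ) ^ 5 * δ ≤ N ^ 5 * ‖Lam N f₀ f₁ f₂‖ := by gcongr
      _ ≤ 2 * N * (N ^ 2 * M * c) := h1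
      _ ≤ 2 * N * (N ^ 2 * (6 * N ^ 2) * c) := by gcongr
      _ = _ := by ring
  have h3 := le_of_mul_le_mul_left h2 (by positivity)
  linarith

end Reduction

/-! ### Calculus of polynomially bounded parameters -/

section Tame

/-- The function `g` is positive, and polynomially bounded above and below on `(0, 1]`. -/
def Tame (g : ℝ → ℝ) : Prop :=
  ∃ (C : ℝ) (k : ℕ), 0 < C ∧
    ∀ δ, 0 < δ → δ ≤ 1 → 0 < g δ ∧ g δ ≤ C / δ ^ k ∧ (g δ)⁻¹ ≤ C / δ ^ k

theorem div_pow_le_div_pow {C C' δ : ℝ} {k k' : ℕ} (hC : 0 ≤ C) (hCC' : C ≤ C') (hk : k ≤ k')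
    (hδ : 0 < δ) (hδ1 : δ ≤ 1) : C / δ ^ k ≤ C' / δ ^ k' :=
  div_le_div₀ (hC.trans hCC') hCC' (by positivity) (pow_le_pow_of_le_one hδ.le hδ1 hk)

namespace Tame

variable {g h : ℝ → ℝ}

theorem const {c : ℝ} (hc : 0 < c) : Tame fun _ => c := by
  have : 0 < c⁻¹ := by positivity
  exact ⟨c + c⁻¹, 0, by positivity, fun δ _ _ => ⟨hc, by simp [this.le], by simp [hc.le]⟩⟩

theorem id : Tame fun δ => δ := by
  refine ⟨1, 1, one_pos, fun δ h0 h1 => ⟨h0, ?_, by simp⟩⟩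
  rw [pow_one]
  exact h1.trans ((one_le_div h0).mpr h1)

theorem inv (hg : Tame g) : Tame fun δ => (g δ)⁻¹ := by
  obtain ⟨C, k, hC, H⟩ := hg
  refine ⟨C, k, hC, fun δ h0 h1 => ?_⟩
  obtain ⟨i1, i2, i3⟩ := H δ h0 h1
  exact ⟨by positivity, i3, by rwa [inv_inv]⟩

theorem mul (hg : Tame g) (hh : Tame h) : Tame fun δ => g δ * h δ := by
  obtain ⟨C, k, hC, H⟩ := hg
  obtain ⟨C', k', hC', H'⟩ := hh
  refine ⟨C * C', k + k', by positivity, fun δ h0 h1 => ?_⟩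
  obtain ⟨i1, i2, i3⟩ := H δ h0 h1
  obtain ⟨j1, j2, j3⟩ := H' δ h0 h1
  have e1 : C * C' / δ ^ (k + k') = C / δ ^ k * (C' / δ ^ k') := by
    rw [pow_add, div_mul_div_comm]
  refine ⟨by positivity, ?_, ?_⟩
  · rw [e1]; exact mul_le_mul i2 j2 j1.le (i1.le.trans i2)
  · rw [e1, mul_inv]; gcongr

theorem div (hg : Tame g) (hh : Tame h) : Tame fun δ => g δ / h δ := by
  simp only [div_eq_mul_inv]
  exact hg.mul hh.inv

theorem pow (hg : Tame g) (n : ℕ) : Tame fun δ => g δ ^ n := by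
  induction n with
  | zero => simpa using const one_pos
  | succ n ih => simpa only [pow_succ] using ih.mul hg

theorem add (hg : Tame g) (hh : Tame h) : Tame fun δ => g δ + h δ := by
  obtain ⟨C, k, hC, H⟩ := hg
  obtain ⟨C', k', hC', H'⟩ := hh
  refine ⟨C + C', k + k', by positivity, fun δ h0 h1 => ?_⟩
  obtain ⟨i1, i2, i3⟩ := H δ h0 h1
  obtain ⟨j1, j2, j3⟩ := H' δ h0 h1
  refine ⟨by positivity, ?_, ?_⟩
  · rw [add_div]
    exact add_le_add (i2.trans (div_pow_le_div_pow hC.le le_rfl (by omega) h0 h1))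
      (j2.trans (div_pow_le_div_pow hC'.le le_rfl (by omega) h0 h1))
  · exact (inv_anti₀ i1 (by linarith)).trans
      (i3.trans (div_pow_le_div_pow hC.le (by linarith) (by omega) h0 h1))

theorem natCeil (hg : Tame g) : Tame fun δ => (⌈g δ⌉₊ : ℝ) := by
  obtain ⟨C, k, hC, H⟩ := hg
  obtain ⟨C', k', hC', H'⟩ := Tame.add ⟨C, k, hC, H⟩ (const one_pos)
  refine ⟨C + C', k + k', by positivity, fun δ h0 h1 => ?_⟩
  obtain ⟨i1, i2, i3⟩ := H δ h0 h1
  obtain ⟨j1, j2, j3⟩ := H' δ h0 h1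
  refine ⟨Nat.cast_pos.mpr (Nat.ceil_pos.mpr i1), ?_, ?_⟩
  · exact (Nat.ceil_lt_add_one i1.le).le.trans
      (j2.trans (div_pow_le_div_pow hC'.le (by linarith) (by omega) h0 h1))
  · exact (inv_anti₀ i1 (Nat.le_ceil _)).trans
      (i3.trans (div_pow_le_div_pow hC.le (by linarith) (by omega) h0 h1))

/-- This merges the finitely many size conditions of the argument into the single pair `C`, `k` of
the final statement. -/
theorem exists_common_bound {l : List (ℝ → ℝ)} (hl : ∀ g ∈ l, Tame g) :
    ∃ (C : ℝ) (k : ℕ), 0 < C ∧ ∀ g ∈ l, ∀ δ, 0 < δ → δ ≤ 1 → g δ ≤ C / δ ^ k := by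
  induction l with
  | nil => exact ⟨1, 0, one_pos, by simp⟩
  | cons a l ih =>
    obtain ⟨C, k, hC, H⟩ := ih fun g hg => hl g (List.mem_cons_of_mem _ hg)
    obtain ⟨C', k', hC', H'⟩ := hl a List.mem_cons_self
    refine ⟨C + C', k + k', by positivity, fun g hg δ h0 h1 => ?_⟩
    rcases List.mem_cons.mp hg with rfl | hg
    · exact (H' δ h0 h1).2.1.trans (div_pow_le_div_pow hC'.le (by linarith) (by omega) h0 h1)
    · exact (H g hg δ h0 h1).trans (div_pow_le_div_pow hC.le (by linarith) (by omega) h0 h1)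

end Tame

end Tame

/-! ### Explicit parameters and their polynomial dependence on `δ` -/

section Parameters

/-- An upper bound for the number of major-arc frequencies. -/
def majorCount (R : ℕ) : ℝ :=
  majorBound R * (majorBound R * (2 * majorBound R * (6 : ℕ) + 1))

/-- The correlation which remains after differencing. -/
def corr (δ : ℝ) : ℝ := ((δ / 12) ^ 2) ^ 4 / 512

/-- A lower bound for the density of the progressions in the cyclic group. -/
def progDensity (δ : ℝ) : ℝ := corr δ ^ 2 / 576

/-- The size of the box norm after replacing `i` directions by the full group. -/
def boxSize (i : ℕ) (δ : ℝ) : ℝ := (lowered (progDensity δ))^[i] ((corr δ / 2) ^ 8)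

/-- The lower bound for the modulus that makes the `i`-th replacement possible. -/
def boxScale (i : ℕ) (δ : ℝ) : ℝ :=
  36 / (corr δ * ((boxSize i δ * progDensity δ) ^ 16 / 16) ^ 8)

/-- The Weyl parameter for the `U³` step. -/
def weylCube (δ : ℝ) : ℕ := ⌈8 / boxSize 3 δ ^ 4⌉₊

/-- The size of the Fourier coefficients of the dual functions. -/
def dftSize (δ : ℝ) : ℝ := boxSize 3 δ ^ 4 / 4 / majorCount (weylCube δ)

/-- The Weyl parameter for the frequency step. -/
def weylFreq (δ : ℝ) : ℕ := ⌈8 / dftSize δ ^ 2⌉₊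

/-- The size of the correlation with a quadratic phase. -/
def phaseSize (δ : ℝ) : ℝ := dftSize δ / 2 / majorCount (weylFreq δ)

/-- The threshold for the length in the Weyl estimates. -/
def weylScale (R : ℕ) : ℕ := 145 * (204 * R ^ 2 * (9280 * R ^ 8)) ^ 3

theorem tame_corr : Tame corr :=
  (((Tame.id.div (.const (by norm_num))).pow 2).pow 4).div (.const (by norm_num))

theorem tame_progDensity : Tame progDensity := (tame_corr.pow 2).div (.const (by norm_num))

theorem tame_boxSize (i : ℕ) : Tame (boxSize i) := by
  induction i with
  | zero => exact (tame_corr.div (.const (by norm_num))).pow 8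
  | succ i ih =>
    have : boxSize (i + 1) = fun δ => ((boxSize i δ * progDensity δ) ^ 16 / 8) ^ 8 := by
      funext δ
      rw [boxSize, Function.iterate_succ_apply']
      rfl
    rw [this]
    exact (((ih.mul tame_progDensity).pow 16).div (.const (by norm_num))).pow 8

theorem tame_boxScale (i : ℕ) : Tame (boxScale i) :=
  (Tame.const (by norm_num)).div (tame_corr.mul
    (((((tame_boxSize i).mul tame_progDensity).pow 16).div (.const (by norm_num))).pow 8))

theorem tame_majorBound {R : ℝ → ℕ} (hR : Tame fun δ => (R δ : ℝ)) :
    Tame fun δ => (majorBound (R δ) : ℝ) := by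
  simp only [majorBound, Nat.cast_mul, Nat.cast_pow, Nat.cast_ofNat]
  exact (Tame.const (by norm_num)).mul (((((Tame.const (by norm_num)).mul (hR.pow 2)).mul
    ((Tame.const (by norm_num)).mul (hR.pow 8)))).pow 4)

theorem tame_weylScale {R : ℝ → ℕ} (hR : Tame fun δ => (R δ : ℝ)) :
    Tame fun δ => (weylScale (R δ) : ℝ) := by
  simp only [weylScale, Nat.cast_mul, Nat.cast_pow, Nat.cast_ofNat]
  exact (Tame.const (by norm_num)).mul (((((Tame.const (by norm_num)).mul (hR.pow 2)).mul
    ((Tame.const (by norm_num)).mul (hR.pow 8)))).pow 3)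

theorem tame_majorCount {R : ℝ → ℕ} (hR : Tame fun δ => (R δ : ℝ)) :
    Tame fun δ => majorCount (R δ) :=
  (tame_majorBound hR).mul ((tame_majorBound hR).mul ((((Tame.const (by norm_num)).mul
    (tame_majorBound hR)).mul (.const (by norm_num))).add (.const one_pos)))

theorem tame_weylCube : Tame fun δ => (weylCube δ : ℝ) :=
  ((Tame.const (by norm_num)).div ((tame_boxSize 3).pow 4)).natCeil

theorem tame_dftSize : Tame dftSize :=
  (((tame_boxSize 3).pow 4).div (.const (by norm_num))).div (tame_majorCount tame_weylCube)

theorem tame_weylFreq : Tame fun δ => (weylFreq δ : ℝ) :=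
  ((Tame.const (by norm_num)).div (tame_dftSize.pow 2)).natCeil

theorem tame_phaseSize : Tame phaseSize :=
  (tame_dftSize.div (.const (by norm_num))).div (tame_majorCount tame_weylFreq)

theorem Tame.pos {g : ℝ → ℝ} (hg : Tame g) {δ : ℝ} (hδ : 0 < δ) (hδ1 : δ ≤ 1) : 0 < g δ := by
  obtain ⟨C, k, -, H⟩ := hg
  exact (H δ hδ hδ1).1

end Parameters

/-! ### Assembly of the inverse theorem -/

section Main

variable {M : ℕ} [NeZero M] {N : ℕ}

/-- A single major-arc quadratic phase on the cyclic group yields a linear phase on the integers. -/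
theorem exists_linear_phase_of_frequency (hN : 0 < N) (hM : 2 * N ^ 2 ≤ M) {s : ℤ} (hs : |s| < N)
    {f₀ f₁ : ℤ × ℤ → ℂ} (h₀ : OneBounded f₀) (h₁ : OneBounded f₁) {a : ZMod M} {q Q : ℕ}
    (hq : 0 < q) (hqQ : q ≤ Q) (ha : ‖q • ZMod.toAddCircle a‖ ≤ Q / N ^ 2) {η : ℝ} (hη : 0 < η)
    (hηN : 148 * Q ≤ η * N)
    (h : η ≤ 𝔼 x, 𝔼 y, ‖trans₀ M N s f₀ x y‖ *
      ‖𝔼 u : Fin N, trans₁ M N s f₁ u y * chi (a * disp M (-s) x u ^ 2)‖) :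
    ∃ β : UnitAddCircle, ‖q • β‖ ≤ 1184 * Q / η ^ 2 / N ∧
      η ^ 2 / 160 ≤ Q * (11840 * Q / η ^ 2 + 1) * 𝔼 y ∈ Finset.Icc (1 : ℤ) ((N : ℤ) ^ 2),
        ‖𝔼 n ∈ Finset.Icc (-(N : ℤ)) (2 * N), f₁ (n, y) * e (n • β)‖ := by
  have hNR : (0 : ℝ) < N := by exact_mod_cast hN
  have hMR : (0 : ℝ) < M := by exact_mod_cast NeZero.pos M
  have : Nonempty (Fin N) := ⟨⟨0, hN⟩⟩
  -- Fixing one good `x` suffices: `f₀` is then bounded by `1` and only serves to restrict `y` to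
  -- `[1, N²]`.
  obtain ⟨x, hx⟩ := exists_le_of_le_expect' h
  have hxN := x.2
  rw [abs_lt] at hs
  set c : ℤ := -(x : ℕ) - s with hc
  set θ := ZMod.toAddCircle a with hθ
  set Φ : ℤ → ℝ := fun n => ‖∑ u ∈ Finset.Ico (0 : ℤ) N, f₁ (u + (1 - s), n) *
    e ((u + c) ^ 2 • θ)‖ with hΦ
  have e1 : ∀ y : ZMod M, ‖𝔼 u : Fin N, trans₁ M N s f₁ u y * chi (a * disp M (-s) x u ^ 2)‖
      = Φ (rep 1 y) / N := fun y => by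
    rw [Finset.expect_eq_sum_div_card, Finset.card_univ, Fintype.card_fin, norm_div,
      Complex.norm_natCast, hΦ]
    congr 2
    rw [← sum_fin_eq_sum_Ico N fun n => f₁ (n + (1 - s), rep 1 y) * e ((n + c) ^ 2 • θ)]
    refine Finset.sum_congr rfl fun u _ => ?_
    rw [trans₁, hθ, ← chi_mul_intCast]
    congr 3
    simp only [disp, hc]
    push_cast
    ring
  have hΦN : ∀ n, Φ n ≤ N := fun n => by
    refine (norm_sum_le _ _).trans ((Finset.sum_le_card_nsmul _ _ 1 fun u _ => ?_).trans ?_)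
    · rw [norm_mul, norm_e, mul_one]; exact h₁ _
    · simp
  have hη1 : η ≤ 1 := by
    refine hx.trans (expect_le_of_forall fun y => ?_)
    rw [e1]
    exact mul_le_one₀ (norm_trans₀_le h₀ x y) (by positivity) ((div_le_one hNR).mpr (hΦN _))
  set Y := Finset.Icc (1 : ℤ) ((N : ℤ) ^ 2) with hY
  have hYc : (Y.card : ℝ) = N ^ 2 := by
    have : Y.card = N ^ 2 := by
      rw [hY, Int.card_Icc, add_sub_cancel_right]; exact_mod_cast Int.toNat_natCast (N ^ 2)
    rw [this]; push_cast; rfl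
  have hYne : Y.Nonempty := by
    refine ⟨1, Finset.mem_Icc.mpr ⟨le_rfl, ?_⟩⟩
    have : (1 : ℤ) ≤ N := by omega
    nlinarith
  have h2 : η * N * Y.card ≤ ∑ y ∈ Y, Φ y := by
    have i1 : η ≤ (∑ y : ZMod M, (if rep 1 y ≤ (N : ℤ) ^ 2 then Φ (rep 1 y) else 0)) / N / M := by
      refine hx.trans ?_
      rw [Finset.expect_eq_sum_div_card, Finset.card_univ, ZMod.card]
      refine div_le_div_of_nonneg_right ?_ hMR.le
      rw [Finset.sum_div]
      refine Finset.sum_le_sum fun y _ => ?_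
      rw [e1]
      split_ifs with hy
      · exact mul_le_of_le_one_left (by positivity) (norm_trans₀_le h₀ x y)
      · simp [trans₀, hy]
    rw [sum_rep 1 (fun n : ℤ => if n ≤ (N : ℤ) ^ 2 then Φ n else 0), ← Finset.sum_filter] at i1
    have e3 : (Finset.Ico (1 : ℤ) (1 + M)).filter (fun n => n ≤ (N : ℤ) ^ 2) = Y := by
      ext n
      have : (2 : ℤ) * (N : ℤ) ^ 2 ≤ M := by exact_mod_cast hM
      have : 0 ≤ (N : ℤ) ^ 2 := by positivity
      simp only [hY, Finset.mem_filter, Finset.mem_Ico, Finset.mem_Icc]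
      omega
    rw [e3, le_div_iff₀ hMR, le_div_iff₀ hNR] at i1
    refine le_trans ?_ i1
    rw [hYc]
    have i2 : (N : ℝ) ^ 2 ≤ M := by
      have : N ^ 2 ≤ M := by omega
      exact_mod_cast this
    calc η * N * N ^ 2 ≤ η * N * M := by gcongr
      _ = _ := by ring
  exact exists_linear_phase_of_quadratic hN hq hqQ ha hYne (f := fun n y => f₁ (n, y))
    (fun n y => h₁ _) (c := c) (m := 1 - s) (by omega) (by omega) (by omega) (by omega) hη hη1
    hηN h2

/-- The inverse theorem, with explicit parameters. -/
theorem exists_linear_phase_of_Lam (hN : 0 < N) {δ : ℝ} (hδ : 0 < δ) (hδ1 : δ ≤ 1)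
    {f₀ f₁ f₂ : ℤ × ℤ → ℂ} (h₀ : OneBounded f₀) (h₁ : OneBounded f₁) (h₂ : OneBounded f₂)
    (h : δ ≤ ‖Lam N f₀ f₁ f₂‖) (hcorr : 24 / corr δ ≤ N) (hbox : ∀ i < 3, boxScale i δ ≤ N)
    (hcube : (weylScale (weylCube δ) : ℝ) ≤ N) (hfreq : (weylScale (weylFreq δ) : ℝ) ≤ N)
    (hphase : 148 * majorBound (weylFreq δ) / phaseSize δ ≤ N) :
    ∃ (β : UnitAddCircle) (q : ℕ), 0 < q ∧ q ≤ majorBound (weylFreq δ) ∧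
      ‖q • β‖ ≤ 1184 * majorBound (weylFreq δ) / phaseSize δ ^ 2 / N ∧
      phaseSize δ ^ 2 / 160 ≤
        majorBound (weylFreq δ) * (11840 * majorBound (weylFreq δ) / phaseSize δ ^ 2 + 1) *
        𝔼 y ∈ Finset.Icc (1 : ℤ) ((N : ℤ) ^ 2),
          ‖𝔼 n ∈ Finset.Icc (-(N : ℤ)) (2 * N), f₁ (n, y) * e (n • β)‖ := by
  have hNR : (0 : ℝ) < N := by exact_mod_cast hN
  set ε := corr δ with hε
  have hε0 : 0 < ε := tame_corr.pos hδ hδ1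
  have hε1 : ε ≤ 1 / 512 := by
    rw [hε, corr]
    have : ((δ / 12) ^ 2) ^ 4 ≤ 1 := pow_le_one₀ (by positivity)
      (pow_le_one₀ (by positivity) (by linarith))
    linarith
  set ρ := progDensity δ with hρ
  have hρ0 : 0 < ρ := tame_progDensity.pos hδ hδ1
  rw [div_le_iff₀ hε0] at hcorr
  -- the modulus
  set J : ℕ := ⌈1 / ε⌉₊ with hJ
  have hJ1 : 1 / ε ≤ J := Nat.le_ceil _
  have hJ2 : (J : ℝ) ≤ 2 / ε := by
    have i1 : (J : ℝ) < 1 / ε + 1 := Nat.ceil_lt_add_one (by positivity)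
    have i2 : 1 ≤ 1 / ε := by rw [le_div_iff₀ hε0]; linarith
    have e1 : 2 / ε = 1 / ε + 1 / ε := by ring
    linarith
  have hJ0 : 1 ≤ J := Nat.one_le_iff_ne_zero.mpr (Nat.ceil_pos.mpr (by positivity)).ne'
  rw [div_le_iff₀ hε0] at hJ1
  rw [le_div_iff₀ hε0] at hJ2
  have hJN : 4 * J ≤ N := by
    have : ε * (4 * J) ≤ ε * N := by linarith
    exact_mod_cast le_of_mul_le_mul_left this hε0
  obtain ⟨p, r, hp, hr, hp2, hpJ, hNp, hM1, hM2, hrN, hrJ⟩ := exists_moduli hJ0 hJN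
  have : Fact p.Prime := ⟨hp⟩
  have : NeZero (p * r) := ⟨Nat.mul_ne_zero hp.ne_zero hr.ne_zero⟩
  have hp0 : (0 : ℝ) < p := by exact_mod_cast hp.pos
  have hr0 : (0 : ℝ) < r := by exact_mod_cast hr.pos
  -- the length of the progressions
  set T : ℕ := ⌊ε * N / 12⌋₊ with hT
  have hT1 : (T : ℝ) ≤ ε * N / 12 := Nat.floor_le (by positivity)
  have hT2 : ε * N / 24 ≤ T := by
    have : ε * N / 12 < T + 1 := Nat.lt_floor_add_one _
    linarith
  have hT0 : 0 < T := by
    have : (0 : ℝ) < T := lt_of_lt_of_le (by positivity) hT2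
    exact_mod_cast this
  have hTN : T ≤ N := by
    have : (T : ℝ) ≤ N := by nlinarith
    exact_mod_cast this
  -- From `T ≥ ε N / 24` and `r ≤ 12 J N ≤ 24 N / ε` comes the density `ε² / 576`.
  have hρT : ρ ≤ T / r := by
    have i1 : (r : ℝ) ≤ 12 * J * N := by exact_mod_cast hrJ
    have i2 : ε * r ≤ 24 * N := by
      calc ε * r ≤ ε * (12 * J * N) := by gcongr
        _ = 12 * (J * ε) * N := by ring
        _ ≤ 12 * 2 * N := by gcongr
        _ = _ := by ring
    rw [le_div_iff₀ hr0, hρ, progDensity, ← hε]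
    calc ε ^ 2 / 576 * r = ε / 576 * (ε * r) := by ring
      _ ≤ ε / 576 * (24 * N) := by gcongr
      _ = ε * N / 24 := by ring
      _ ≤ T := hT2
  -- large primes
  have hp4 : ε * N ≤ 4 * p := by
    have i1 : (N : ℝ) ≤ 2 * J * p := by exact_mod_cast hNp
    calc ε * N ≤ ε * (2 * J * p) := by gcongr
      _ = 2 * (J * ε) * p := by ring
      _ ≤ 2 * 2 * p := by gcongr
      _ = _ := by ring
  -- The prime satisfies `p ≥ ε N / 4`, which turns the constant `9` into the `36` of `boxScale`.
  have hscale : ∀ i < 3, 9 ≤ ((boxSize i δ * ρ) ^ 16 / 16) ^ 8 * p := fun i hi => by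
    have i0 := (tame_boxSize i).pos hδ hδ1
    have i1 := hbox i hi
    set t := ((boxSize i δ * ρ) ^ 16 / 16) ^ 8 with ht
    have ht0 : 0 < t := by positivity
    rw [boxScale, ← hε, ← hρ, ← ht, div_le_iff₀ (by positivity)] at i1
    have := mul_le_mul_of_nonneg_left hp4 ht0.le
    linarith
  obtain ⟨s, hs, hcnt⟩ := exists_shift_cnt (M := p * r) hN hM1 hM2 h
  have b₀ : ∀ x y, ‖trans₀ (p * r) N s f₀ x y‖ ≤ 1 := norm_trans₀_le h₀
  have b₁ : ∀ x y, ‖trans₁ (p * r) N s f₁ x y‖ ≤ 1 := fun x y => h₁ _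
  have hs' : |-s| ≤ N := by rw [abs_neg]; exact hs.le
  have hU : boxSize 3 δ ≤
      𝔼 x, boxNorm id id id (dual (-s) (trans₀ (p * r) N s f₀) (trans₁ (p * r) N s f₁) x) :=
    lowered_le_boxNorm_id hr hp2 rfl hpJ hJ0 hrN hT0 hTN b₀ b₁ (fun x y => h₂ _) (-s)
      (δ := δ / 12) (by positivity) (by linarith) hε (by linarith) (by linarith) hρ0 hρT rfl
      (hscale 0 (by norm_num)) (hscale 1 (by norm_num)) (hscale 2 (by norm_num)) hcnt
  -- Fourier coefficients
  have hη3 := (tame_boxSize 3).pos hδ hδ1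
  have hη4 := tame_dftSize.pos hδ hδ1
  have hη5 := tame_phaseSize.pos hδ hδ1
  have hR1 : 1 ≤ weylCube δ := Nat.one_le_iff_ne_zero.mpr (Nat.ceil_pos.mpr (by positivity)).ne'
  have hR2 : 1 ≤ weylFreq δ := Nat.one_le_iff_ne_zero.mpr (Nat.ceil_pos.mpr (by positivity)).ne'
  have hc1 := (tame_majorCount tame_weylCube).pos hδ hδ1
  have hc2 := (tame_majorCount tame_weylFreq).pos hδ hδ1
  obtain ⟨α, hα⟩ := exists_large_dft hR1 (by exact_mod_cast hcube) hM2 hs' b₀ b₁ hη3 (by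
    rw [← div_le_iff₀' (by positivity)]; exact Nat.le_ceil _) hU
  have hα' : dftSize δ ≤ _ := (div_le_iff₀' hc1).mpr hα
  obtain ⟨a, ⟨q, hq, hqQ, hqa⟩, ha⟩ := exists_major_frequency hR2 (by exact_mod_cast hfreq) hM2 hs'
    b₀ b₁ hη4 (by rw [← div_le_iff₀' (by positivity)]; exact Nat.le_ceil _) α hα'
  have ha' : phaseSize δ ≤ _ := (div_le_iff₀' hc2).mpr ha
  rw [div_le_iff₀' hη5] at hphase
  obtain ⟨β, hβ⟩ := exists_linear_phase_of_frequency hN hM1 hs h₀ h₁ hq hqQ hqa hη5 hphase ha'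
  exact ⟨β, q, hq, hqQ, hβ⟩

/-- Counted from the base point `x = 1`, only `N` shifts `s` occur, and each allows at most `N`
values of `d`. -/
theorem sum_fejer_le_one (hN : 0 < N) : ∑ d ∈ Finset.Icc (-(N : ℤ)) N, fejer N d ≤ 1 := by
  have hNR : (0 : ℝ) < (N : ℝ) ^ 2 := by positivity
  have h1 : (N : ℝ) ^ 2 * ∑ d ∈ Finset.Icc (-(N : ℤ)) N, fejer N d ≤ N ^ 2 := by
    rw [Finset.mul_sum, Finset.sum_congr rfl fun d _ =>
      fejer_sub_eq_sum hN 1 (Finset.mem_Icc.mpr ⟨le_rfl, by omega⟩) d, Finset.sum_comm]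
    have h2 : ∀ s ∈ Finset.Icc (1 - (N : ℤ)) (N - 1), (∑ d ∈ Finset.Icc (-(N : ℤ)) N,
        if 1 + s ∈ Finset.Icc (1 : ℤ) N ∧ 1 + d + s ∈ Finset.Icc (1 : ℤ) N then (1 : ℝ) else 0)
          ≤ if s ∈ Finset.Ico (0 : ℤ) N then (N : ℝ) else 0 := fun s _ => by
      by_cases hs : s ∈ Finset.Ico (0 : ℤ) N
      · rw [if_pos hs, ← Finset.sum_filter, Finset.sum_const, nsmul_one]
        have : ((Finset.Icc (-(N : ℤ)) N).filter fun d =>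
            1 + s ∈ Finset.Icc (1 : ℤ) N ∧ 1 + d + s ∈ Finset.Icc (1 : ℤ) N).card ≤ N := by
          calc _ ≤ (Finset.Ico (-s) (N - s)).card := Finset.card_le_card fun d hd => by
                simp only [Finset.mem_filter, Finset.mem_Icc, Finset.mem_Ico] at hd ⊢
                omega
            _ = N := by rw [Int.card_Ico]; omega
        exact_mod_cast this
      · rw [if_neg hs]
        refine (Finset.sum_eq_zero fun d _ => if_neg fun hd => hs ?_).le
        simp only [Finset.mem_Icc, Finset.mem_Ico] at hd ⊢
        omega
    refine (Finset.sum_le_sum h2).trans ?_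
    rw [← Finset.sum_filter, Finset.sum_const, nsmul_eq_mul, sq]
    refine mul_le_mul_of_nonneg_right ?_ (by positivity)
    have : ((Finset.Icc (1 - (N : ℤ)) (N - 1)).filter
        fun s => s ∈ Finset.Ico (0 : ℤ) N).card ≤ N := by
      calc _ ≤ (Finset.Ico (0 : ℤ) N).card := Finset.card_le_card fun d hd =>
            (Finset.mem_filter.mp hd).2
        _ = N := by simp
    exact_mod_cast this
  exact le_of_mul_le_mul_left (by rwa [mul_one]) hNR

theorem norm_Lam_le_one (hN : 0 < N) {f₀ f₁ f₂ : ℤ × ℤ → ℂ} (h₀ : OneBounded f₀)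
    (h₁ : OneBounded f₁) (h₂ : OneBounded f₂) : ‖Lam N f₀ f₁ f₂‖ ≤ 1 := by
  have hne : ∀ n : ℤ, 1 ≤ n → (Finset.Icc (1 : ℤ) n).Nonempty := fun n hn =>
    ⟨1, Finset.mem_Icc.mpr ⟨le_rfl, hn⟩⟩
  have hN1 : (1 : ℤ) ≤ N := by omega
  rw [Lam_eq_sum hN]
  refine (norm_expect_le _ _).trans (Finset.expect_le (hne _ hN1) fun x _ => ?_)
  refine (norm_expect_le _ _).trans
    (Finset.expect_le (hne _ (one_le_pow₀ hN1)) fun y _ => ?_)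
  refine (norm_sum_le _ _).trans ((Finset.sum_le_sum fun d _ => ?_).trans (sum_fejer_le_one hN))
  have hf : 0 ≤ fejer N d := by unfold fejer; positivity
  rw [mul_assoc, mul_assoc, norm_mul, Complex.norm_real, Real.norm_of_nonneg hf]
  exact mul_le_of_le_one_right hf
    (norm_mul_le_one' (h₀ _) (norm_mul_le_one' (h₁ _) (h₂ _)))

/-- The inverse theorem with polynomial bounds. -/
theorem inverse_theorem :
    ∃ (C : ℝ) (k : ℕ), 0 < C ∧
      ∀ (N : ℕ) (δ : ℝ) (f₀ f₁ f₂ : ℤ × ℤ → ℂ), 0 < N → 0 < δ →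
        OneBounded f₀ → OneBounded f₁ →
        OneBounded f₂ →
        δ ≤ ‖Lam N f₀ f₁ f₂‖ →
          (N : ℝ) ≤ C / δ ^ k ∨
          ∃ (β : UnitAddCircle) (q : ℕ), 0 < q ∧ (q : ℝ) ≤ C / δ ^ k ∧
            ‖q • β‖ ≤ C / δ ^ k / (N : ℝ) ∧
            δ ^ k / C ≤
              𝔼 y ∈ Finset.Icc (1 : ℤ) ((N : ℤ) ^ 2),
                ‖𝔼 x ∈ Finset.Icc (-(N : ℤ)) (2 * (N : ℤ)),
                  f₁ (x, y) * e (x • β)‖ := by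
  have hQ : Tame fun δ => (majorBound (weylFreq δ) : ℝ) := tame_majorBound tame_weylFreq
  have hη := tame_phaseSize
  have t1 : Tame fun δ => 24 / corr δ := (Tame.const (by norm_num)).div tame_corr
  have t2 : Tame fun δ => 148 * (majorBound (weylFreq δ) : ℝ) / phaseSize δ :=
    ((Tame.const (by norm_num)).mul hQ).div hη
  have t3 : Tame fun δ => 1184 * (majorBound (weylFreq δ) : ℝ) / phaseSize δ ^ 2 :=
    ((Tame.const (by norm_num)).mul hQ).div (hη.pow 2)
  have t4 : Tame fun δ => majorBound (weylFreq δ) *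
      (11840 * majorBound (weylFreq δ) / phaseSize δ ^ 2 + 1) / (phaseSize δ ^ 2 / 160) :=
    (hQ.mul ((((Tame.const (by norm_num)).mul hQ).div (hη.pow 2)).add (.const one_pos))).div
      ((hη.pow 2).div (.const (by norm_num)))
  obtain ⟨C, k, hC, H⟩ := Tame.exists_common_bound (l := [_, _, _, _, _, _, _, _, _, _])
    (List.forall_mem_cons.mpr ⟨t1, List.forall_mem_cons.mpr ⟨t2, List.forall_mem_cons.mpr ⟨t3,
      List.forall_mem_cons.mpr ⟨t4, List.forall_mem_cons.mpr ⟨hQ,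
      List.forall_mem_cons.mpr ⟨tame_weylScale tame_weylCube,
      List.forall_mem_cons.mpr ⟨tame_weylScale tame_weylFreq,
      List.forall_mem_cons.mpr ⟨tame_boxScale 0, List.forall_mem_cons.mpr ⟨tame_boxScale 1,
      List.forall_mem_cons.mpr ⟨tame_boxScale 2, List.forall_mem_nil _⟩⟩⟩⟩⟩⟩⟩⟩⟩⟩)
  simp only [List.forall_mem_cons] at H
  obtain ⟨H1, H2, H3, H4, H5, H6, H7, H8, H9, H10, -⟩ := H
  refine ⟨C, k, hC, fun N δ f₀ f₁ f₂ hN hδ h₀ h₁ h₂ h => ?_⟩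
  -- The parameters are controlled only on `(0, 1]`; larger `δ` cannot occur because the count is at
  -- most `1` in modulus.
  have hδ1 : δ ≤ 1 := h.trans (norm_Lam_le_one hN h₀ h₁ h₂)
  refine or_iff_not_imp_left.mpr fun hlarge => ?_
  have hlt : C / δ ^ k ≤ N := (not_le.mp hlarge).le
  obtain ⟨β, q, hq, hqQ, hβ, hE⟩ := exists_linear_phase_of_Lam hN hδ hδ1 h₀ h₁ h₂ h
    ((H1 δ hδ hδ1).trans hlt) (fun i hi => by
      interval_cases i
      · exact (H8 δ hδ hδ1).trans hlt
      · exact (H9 δ hδ hδ1).trans hlt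
      · exact (H10 δ hδ hδ1).trans hlt)
    ((H6 δ hδ hδ1).trans hlt) ((H7 δ hδ hδ1).trans hlt) ((H2 δ hδ hδ1).trans hlt)
  refine ⟨β, q, hq, le_trans (by exact_mod_cast hqQ) (H5 δ hδ hδ1), hβ.trans
    (div_le_div_of_nonneg_right (H3 δ hδ hδ1) (Nat.cast_nonneg N)), ?_⟩
  have hη0 := hη.pos hδ hδ1
  have hQ0 := hQ.pos hδ hδ1
  have h4 := H4 δ hδ hδ1
  rw [div_le_iff₀ (by positivity), div_mul_eq_mul_div, le_div_iff₀ (by positivity)] at h4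
  rw [div_le_iff₀ hC]
  -- The lower bound `hE` carries a `δ`-dependent factor; the fourth tame function is the ratio of
  -- that factor to `phaseSize δ ^ 2 / 160`, so cancelling the latter leaves `C / δ ^ k`.
  refine le_of_mul_le_mul_left ?_ (by positivity : 0 < phaseSize δ ^ 2 / 160)
  have hE0 : 0 ≤ 𝔼 y ∈ Finset.Icc (1 : ℤ) ((N : ℤ) ^ 2),
      ‖𝔼 x ∈ Finset.Icc (-(N : ℤ)) (2 * (N : ℤ)), f₁ (x, y) * e (x • β)‖ :=
    Finset.expect_nonneg fun _ _ => norm_nonneg _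
  have h5 := mul_le_mul_of_nonneg_right hE (by positivity : 0 ≤ δ ^ k)
  have h6 := mul_le_mul_of_nonneg_right h4 hE0
  linarith

end Main

end CountingOperator

end

theorem theorem5p1 :
    ∃ (C : ℝ) (k : ℕ), 0 < C ∧
      ∀ (N : ℕ) (δ : ℝ) (f₀ f₁ f₂ : ℤ × ℤ → ℂ), 0 < N → 0 < δ →
        CountingOperator.OneBounded f₀ → CountingOperator.OneBounded f₁ →
        CountingOperator.OneBounded f₂ →
        δ ≤ ‖CountingOperator.Lam N f₀ f₁ f₂‖ →
          (N : ℝ) ≤ C / δ ^ k ∨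
          ∃ (β : UnitAddCircle) (q : ℕ), 0 < q ∧ (q : ℝ) ≤ C / δ ^ k ∧
            ‖q • β‖ ≤ C / δ ^ k / (N : ℝ) ∧
            δ ^ k / C ≤
              𝔼 y ∈ Finset.Icc (1 : ℤ) ((N : ℤ) ^ 2),
                ‖𝔼 x ∈ Finset.Icc (-(N : ℤ)) (2 * (N : ℤ)),
                  f₁ (x, y) * CountingOperator.e (x • β)‖ :=
  CountingOperator.inverse_theorem
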